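/- Let $u$ be an integer with $u\equiv 1 \pmod 4$ such that $u^2+64$ is square-free, and consider the elliptic curves over $\mathbb{Q}$ $$E_1(u):\ y^2+xy=x^3+\tfrac14(u-1)x^2-x,\qquad E_2(u):\ y^2+xy=x^3+\tfrac14(u-1)x^2+4x+u.$$ For an elliptic curve $E$ over $\mathbb{Q}$, let $\Omega_E$ be the least positive real period of the Néron differential of $E$ (the invariant differential $dx/(2y+a_1x+a_3)$ of a globally minimal Weierstrass equation), where a period is the integral of the differential along a closed path on $E(\mathbb{C})$. Let $C_\infty(E)=\Omega_E$ if $E(\mathbb{R})$ is connected and $C_\infty(E)=2\Omega_E$ otherwise. Let $C_{\mathrm{fin}}(E)=\prod_p [E(\mathbb{Q}_p):E_0(\mathbb{Q}_p)]$, the product being over the primes of bad reduction, where $E_0(\mathbb{Q}_p)$ is the subgroup of points with nonsingular reduction on a minimal Weierstrass equation at $p$. Then: (i) $E_1(u)(\mathbb{Q})_{\mathrm{tors}}\simeq E_2(u)(\mathbb{Q})_{\mathrm{tors}}\simeq \mathbb{Z}/2\mathbb{Z}$; (ii) $\Omega_{E_1(u)}=\Omega_{E_2(u)}$ (both exist),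 $C_\infty(E_1(u))=2\,\Omega_{E_1(u)}$ and $C_\infty(E_2(u))=\Omega_{E_2(u)}$; (iii) $C_{\mathrm{fin}}(E_1(u))=1$ and $C_{\mathrm{fin}}(E_2(u))=2^k$, where $u^2+64=p_1\cdots p_k$ with $p_1,\dots,p_k$ prime. -/

import Mathlib

open scoped Matrix WeierstrassCurve

/-- The curve `E₁(u) : y² + xy = x³ + ((u - 1) / 4) x² - x` over `ℚ`. -/
def curveE₁ (u : ℤ) : WeierstrassCurve ℚ := ⟨1, ((u : ℚ) - 1) / 4, 0, -1, 0⟩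

/-- The curve `E₂(u) : y² + xy = x³ + ((u - 1) / 4) x² + 4x + u` over `ℚ`. -/
def curveE₂ (u : ℤ) : WeierstrassCurve ℚ := ⟨1, ((u : ℚ) - 1) / 4, 0, 4, (u : ℚ)⟩

/-! ### Periods of the Néron differential -/

/-- The gradient `(F_X, F_Y, F_Z)` of the homogeneous Weierstrass cubic `F(X, Y, Z)` at a vector. -/
noncomputable def cubicGradient (W : WeierstrassCurve ℂ) (v : Fin 3 → ℂ) : Fin 3 → ℂ :=
  ![MvPolynomial.eval v W.toProjective.polynomialX,
    MvPolynomial.eval v W.toProjective.polynomialY,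
    MvPolynomial.eval v W.toProjective.polynomialZ]

/-- `z` is a period of the invariant differential `ω = dx / (2y + a₁x + a₃)` of the Weierstrass
curve `W` over `ℂ`: it is the integral of `ω` along a closed `C¹` path on the projective curve
`W(ℂ)`. The path is given by a closed `C¹` lift `γ` to the nonzero vectors of the cone
`F(X, Y, Z) = 0` in `ℂ³` (a closed path on the curve always has such a lift, since it can be
rescaled). The pull-back of `ω` to `[0, 1]` is `c(t) dt`, where `γ × γ' = c ∇F(γ)`; in homogeneous
coordinates this says
`ω = (Z dX - X dZ) / F_Y = (Y dZ - Z dY) / F_X = (X dY - Y dX) / F_Z`,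
which is `dx / (2y + a₁x + a₃) = - dy / F_x` where `Z = 1`, and does not depend on the lift. -/
def IsPeriod (W : WeierstrassCurve ℂ) (z : ℂ) : Prop :=
  ∃ (γ : ℝ → Fin 3 → ℂ) (c : ℝ → ℂ),
    ContDiffOn ℝ 1 γ (Set.Icc 0 1) ∧
    ContinuousOn c (Set.Icc 0 1) ∧
    γ 0 = γ 1 ∧
    (∀ t ∈ Set.Icc (0 : ℝ) 1,
      γ t ≠ 0 ∧ W.toProjective.Equation (γ t) ∧
      γ t ⨯₃ derivWithin γ (Set.Icc 0 1) t = c t • cubicGradient W (γ t)) ∧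
    z = ∫ t in (0 : ℝ)..1, c t

/-- A Weierstrass equation over `ℚ` is globally minimal if it is integral with discriminant of
minimal valuation at every prime `p`. (Its coefficients are then `p`-integral for all `p`, that is,
they are integers.) -/
def IsGlobalMinimal (W : WeierstrassCurve ℚ) : Prop :=
  ∀ (p : ℕ) [Fact p.Prime], WeierstrassCurve.IsMinimal ℤ_[p] (W.baseChange ℚ_[p])

/-- `z` is a period of the Néron differential of `W` over `ℚ`, that is, of the invariant
differential of a globally minimal Weierstrass equation of `W`. (Two such equations have the same
invariant differential up to sign, hence the same periods.) -/
def IsNeronPeriod (W : WeierstrassCurve ℚ) (z : ℂ) : Prop :=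
  ∃ C : WeierstrassCurve.VariableChange ℚ,
    IsGlobalMinimal (C • W) ∧ IsPeriod ((C • W).baseChange ℂ) z

/-- The set of positive real periods of the Néron differential. -/
def positiveRealPeriods (W : WeierstrassCurve ℚ) : Set ℝ :=
  {T : ℝ | 0 < T ∧ IsNeronPeriod W (T : ℂ)}

/-- `Ω_E`, the least positive real period of the Néron differential. -/
noncomputable def leastRealPeriod (W : WeierstrassCurve ℚ) : ℝ :=
  sInf (positiveRealPeriods W)

/-- `E(ℝ)`, as a subset of the real projective plane: `PointClass ℝ` is the quotient of `ℝ³` by the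
scaling action of `ℝˣ`, with the quotient topology (the class of `0` is never nonsingular). -/
def realLocus (W : WeierstrassCurve ℚ) : Set (WeierstrassCurve.Projective.PointClass ℝ) :=
  {P | (W.baseChange ℝ).toProjective.NonsingularLift P}

open scoped Classical in
/-- `C_∞(E)`, which is `Ω_E` if `E(ℝ)` is connected and `2 Ω_E` if it is not. -/
noncomputable def archimedeanFactor (W : WeierstrassCurve ℚ) : ℝ :=
  if IsConnected (realLocus W) then leastRealPeriod W else 2 * leastRealPeriod W

/-! ### Tamagawa factors -/

section Tamagawa

variable (R : Type*) [CommRing R] [IsDomain R] [IsDiscreteValuationRing R]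
variable {K : Type*} [Field K] [Algebra R K] [IsFractionRing R K]

/-- A point of a minimal Weierstrass curve over `K` has nonsingular reduction. The point at infinity
reduces to itself, and so does a point whose coordinates are not both in `R` (then neither is);
a point with coordinates in `R` reduces coordinatewise. -/
def HasNonsingularReduction (W : WeierstrassCurve K) [W.IsMinimal R] :
    W.toAffine.Point → Prop
  | .zero => True
  | .some x y _ => ∀ a b : R, algebraMap R K a = x → algebraMap R K b = y →
      (W.reduction R).toAffine.Nonsingular (IsLocalRing.residue R a) (IsLocalRing.residue R b)

open scoped Classical in
/-- The subgroup `E₀(K)` of points with nonsingular reduction. (These points form a subgroup, so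
that the closure adds nothing.) -/
noncomputable def nonsingularReductionSubgroup (W : WeierstrassCurve K) [W.IsMinimal R] :
    AddSubgroup W.toAffine.Point :=
  AddSubgroup.closure {P | HasNonsingularReduction R W P}

open scoped Classical in
/-- The Tamagawa factor `[E(K) : E₀(K)]`, computed on a minimal Weierstrass equation. -/
noncomputable def localTamagawa (W : WeierstrassCurve K) : ℕ :=
  (nonsingularReductionSubgroup R (W.minimal R)).index

end Tamagawa

/-- The set of primes at which `W` has bad reduction. -/
def badPrimes (W : WeierstrassCurve ℚ) : Set Nat.Primes :=
  {p | haveI : Fact (p : ℕ).Prime := ⟨p.2⟩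
    ¬ ((W.baseChange ℚ_[p]).minimal ℤ_[p]).HasGoodReduction ℤ_[p]}

/-- The Tamagawa factor of `W` at `p`. -/
noncomputable def tamagawaFactor (W : WeierstrassCurve ℚ) (p : Nat.Primes) : ℕ :=
  haveI : Fact (p : ℕ).Prime := ⟨p.2⟩
  localTamagawa ℤ_[p] (W.baseChange ℚ_[p])

/-- `C_fin(E)`, the product of the Tamagawa factors at the (finitely many) bad primes. -/
noncomputable def tamagawaProduct (W : WeierstrassCurve ℚ) : ℕ :=
  ∏ᶠ p ∈ badPrimes W, tamagawaFactor W p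

/-! Torsion. The two equations read `(2y+x)² = x(4x²+ux-4)` and `(2y+x)² = (4x+u)(x²+4)`, so each
curve has one visible rational point `T` of order two. A second such point on E₁, or a rational half
of `T` on E₂, would make `u²+64` a rational square (`sq_ne_sq_add`). A half of `T` on E₁ would need
`x²+1 = 0`, and a second point of order two on E₂ would need `x²+4 = 0`. Odd torsion is excluded
over `ℚ_[2]`: repeated doubling eventually makes `‖x‖` grow strictly, while the multiples `2^j P` of
a point of odd order recur (`eq_zero_of_odd_nsmul_eq_zero`).

Tamagawa factors. The discriminants are `u²+64` and `-(u²+64)²`, so both equations are globally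
minimal and the bad primes are the odd primes `p ∣ u²+64`. On E₁ the discriminant is a uniformizer
at such `p`, and a rational point with singular reduction would force its square to divide it. On E₂
the point `T` reduces to the node, and the valuation of `x - x(T)` modulo two detects nonsingular
reduction; translation by `T` changes its parity, which gives index two.

Real components. The quadratic `4x²+ux-4` has roots of both signs, so E₁(ℝ) has an oval, while `x²+4
> 0` lets a single real parameter sweep out E₂(ℝ) up to the point at infinity.

Periods. A scaled and shifted `℘` of a rectangular lattice `ℤ + ℤit` uniformizes E₁(ℂ) compatibly
with the invariant differential. The ratio of root gaps is matched by the intermediate value theorem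
(`exists_halfPeriodGap_ratio_eq`). The map `x ↦ x - 1/x` is the `x`-coordinate of a 2-isogeny E₁ →
E₂ with kernel `{O, (0,0)}` which preserves invariant differentials, so `f - 1/f` uniformizes E₂
(`IsUniformization.sub_inv`). Paths on a curve with the same pulled-back differential and the same
start coincide, by uniqueness for an ordinary differential equation
(`IsPullbackPath.cross_eq_zero`); hence every period is a pole of the uniformization
(`IsUniformization.mem_of_isPeriod`). The poles added by the isogeny lie over `(0,0)`, at translates
of the half-period `(1+it)/2`, and none of them is real. Thus both curves have the same least
positive real period. -/

/-! ### Torsion -/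

/-- A group with a unique element `T` of order two that is not divisible by two, and without
elements of odd order, has torsion subgroup `{0, T}`. -/
theorem torsion_equiv_zmod_two {G : Type*} [AddCommGroup G] {T : G} (hT : T ≠ 0)
    (hTT : T + T = 0) (htwo : ∀ P : G, P + P = 0 → P = 0 ∨ P = T) (hfour : ∀ P : G, P + P ≠ T)
    (hodd : ∀ (P : G) (n : ℕ), Odd n → n • P = 0 → P = 0) :
    Nonempty (AddCommGroup.torsion G ≃+ ZMod 2) := by
  have hpow : ∀ (a : ℕ) (P : G), (2 ^ a) • P = 0 → P = 0 ∨ P = T := by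
    intro a
    induction a with
    | zero => intro P h; left; simpa using h
    | succ a ih =>
      intro P h
      rw [pow_succ, mul_smul, two_nsmul] at h
      rcases ih _ h with h | h
      · exact htwo P h
      · exact absurd h (hfour P)
  have hall : ∀ P ∈ AddCommGroup.torsion G, P = 0 ∨ P = T := by
    intro P hP
    obtain ⟨n, hn, hnP⟩ := isOfFinAddOrder_iff_nsmul_eq_zero.1 hP
    obtain ⟨a, m, hm, rfl⟩ := Nat.exists_eq_two_pow_mul_odd hn.ne'
    refine hpow a P (hodd _ m hm ?_)
    rw [← mul_smul, mul_comm, hnP]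
  have hTm : T ∈ AddCommGroup.torsion G :=
    isOfFinAddOrder_iff_nsmul_eq_zero.2 ⟨2, by norm_num, by rw [two_nsmul, hTT]⟩
  have hcard : Nat.card (AddCommGroup.torsion G) = 2 := by
    rw [Nat.card_eq_two_iff]
    refine ⟨0, ⟨T, hTm⟩, fun h => hT (congrArg Subtype.val h).symm, ?_⟩
    refine Set.eq_univ_of_forall fun P => ?_
    rcases hall P.1 P.2 with h | h
    · left; exact Subtype.ext h
    · right; exact Subtype.ext h
  have : Fact (Nat.Prime 2) := ⟨Nat.prime_two⟩
  have := isAddCyclic_of_prime_card hcard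
  exact ⟨(zmodAddCyclicAddEquiv (inferInstance) |>.symm.trans (by rw [hcard]))⟩

namespace WeierstrassCurve.Affine.Point

variable {F : Type*} [Field F] [DecidableEq F] {W : WeierstrassCurve.Affine F}

/-- The duplication formula. -/
theorem duplication {x y x' y' : F} {h : W.Nonsingular x y} {h' : W.Nonsingular x' y'}
    (hd : some x y h + some x y h = some x' y' h') :
    4 * x ^ 3 + W.b₂ * x ^ 2 + 2 * W.b₄ * x + W.b₆ ≠ 0 ∧
      x' * (4 * x ^ 3 + W.b₂ * x ^ 2 + 2 * W.b₄ * x + W.b₆) =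
        x ^ 4 - W.b₄ * x ^ 2 - 2 * W.b₆ * x - W.b₈ := by
  have hy : y ≠ W.negY x y := by
    intro hy
    rw [add_self_of_Y_eq hy] at hd
    exact some_ne_zero _ hd.symm
  have heq := (W.equation_iff x y).1 h.1
  have hd0 : y - W.negY x y ≠ 0 := sub_ne_zero.2 hy
  have hD : (y - W.negY x y) ^ 2 = 4 * x ^ 3 + W.b₂ * x ^ 2 + 2 * W.b₄ * x + W.b₆ := by
    simp only [negY, b₂, b₄, b₆]
    linear_combination 4 * heq
  refine ⟨hD ▸ pow_ne_zero 2 hd0, ?_⟩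
  rw [add_self_of_Y_ne hy] at hd
  have hx : W.addX x x (W.slope x x y y) = x' := by
    simpa using (Point.some.inj hd).1
  rw [← hx, ← hD, slope_of_Y_ne rfl hy, addX]
  field_simp
  simp only [negY, b₄, b₆, b₈]
  linear_combination -(8 * x + 4 * W.a₂ + W.a₁ ^ 2) * heq

end WeierstrassCurve.Affine.Point

/-! ### Absence of odd torsion, by 2-adic duplication. -/

section OddTorsion

open WeierstrassCurve.Affine WeierstrassCurve.Affine.Point

/-- In residue characteristic two, every unit is congruent to one. -/
theorem norm_sub_one_lt_one_of_norm_eq_one {x : ℚ_[2]} (hx : ‖x‖ = 1) : ‖x - 1‖ < 1 := by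
  obtain ⟨X, rfl⟩ : ∃ X : ℤ_[2], (X : ℚ_[2]) = x := ⟨⟨x, hx.le⟩, rfl⟩
  obtain ⟨n, hn, hm⟩ := PadicInt.exists_mem_range X
  rw [IsLocalRing.mem_maximalIdeal, PadicInt.mem_nonunits, PadicInt.norm_def,
    PadicInt.coe_sub, PadicInt.coe_natCast] at hm
  obtain rfl | rfl : n = 0 ∨ n = 1 := by omega
  · rw [Nat.cast_zero, sub_zero] at hm
    exact absurd hx hm.ne
  · rwa [Nat.cast_one] at hm

theorem padic_norm_add_lt {p : ℕ} [Fact p.Prime] {a b : ℚ_[p]} {r : ℝ} (ha : ‖a‖ < r)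
    (hb : ‖b‖ < r) : ‖a + b‖ < r :=
  (Padic.nonarchimedean a b).trans_lt (max_lt ha hb)

theorem padic_norm_sub_lt {p : ℕ} [Fact p.Prime] {a b : ℚ_[p]} {r : ℝ} (ha : ‖a‖ < r)
    (hb : ‖b‖ < r) : ‖a - b‖ < r := by
  rw [sub_eq_add_neg]; exact padic_norm_add_lt ha (by rwa [norm_neg])

theorem padic_norm_sub_eq {p : ℕ} [Fact p.Prime] {a b : ℚ_[p]} (h : ‖b‖ < ‖a‖) :
    ‖a - b‖ = ‖a‖ := by
  rw [sub_eq_add_neg, Padic.add_eq_max_of_ne (by rw [norm_neg]; exact h.ne'), norm_neg,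
    max_eq_left h.le]

theorem norm_two_lt_one : ‖(2 : ℚ_[2])‖ < 1 := by
  have := Padic.norm_p_lt_one (p := 2)
  exact_mod_cast this

theorem norm_four_lt_one : ‖(4 : ℚ_[2])‖ < 1 := by
  have h := norm_two_lt_one
  rw [show (4 : ℚ_[2]) = 2 * 2 by norm_num, norm_mul]
  nlinarith [norm_nonneg (2 : ℚ_[2])]

/-- The `2`-adic behaviour of the duplication formula on `x`-coordinates. -/
theorem norm_duplication {x x' b₂ b₄ b₆ b₈ : ℚ_[2]} (h₂ : ‖b₂‖ = 1) (h₄ : ‖b₄‖ < 1)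
    (h₆ : ‖b₆‖ < 1) (h₈ : ‖b₈‖ = 1) (hne : 4 * x ^ 3 + b₂ * x ^ 2 + 2 * b₄ * x + b₆ ≠ 0)
    (heq : x' * (4 * x ^ 3 + b₂ * x ^ 2 + 2 * b₄ * x + b₆) =
      x ^ 4 - b₄ * x ^ 2 - 2 * b₆ * x - b₈) :
    (1 < ‖x‖ → ‖x‖ < ‖x'‖) ∧ (‖x‖ < 1 → 1 < ‖x'‖) ∧ (‖x‖ = 1 → ‖x'‖ < 1) := by
  have hn := congrArg norm heq
  rw [norm_mul] at hn
  have hpos := norm_pos_iff.2 hne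
  have two := norm_two_lt_one
  have four := norm_four_lt_one
  have n4 := norm_nonneg b₄
  have n6 := norm_nonneg b₆
  have h24 : ‖2 * b₄‖ < 1 := by
    rw [norm_mul]; nlinarith [norm_nonneg (2 : ℚ_[2])]
  have h26 : ‖2 * b₆‖ < 1 := by
    rw [norm_mul]; nlinarith [norm_nonneg (2 : ℚ_[2])]
  -- For `‖x‖ > 1` the numerator has norm `‖x‖⁴` and the denominator norm less than `‖x‖³`. For `‖x‖
  -- < 1` the unit `b₈` dominates the numerator and the denominator is not a unit. For `‖x‖ = 1` the
  -- numerator is `1 - 1` modulo two and `b₂x²` makes the denominator a unit.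
  refine ⟨fun hx => ?_, fun hx => ?_, fun hx => ?_⟩
  · have hx2 : ‖x‖ < ‖x‖ ^ 2 := by nlinarith
    have hx3 : ‖x‖ ^ 2 < ‖x‖ ^ 3 := by nlinarith
    have hx4 : ‖x‖ ^ 3 < ‖x‖ ^ 4 := by nlinarith [pow_pos (one_pos.trans hx) 3]
    have hN : ‖x ^ 4 - b₄ * x ^ 2 - 2 * b₆ * x - b₈‖ = ‖x‖ ^ 4 := by
      rw [show x ^ 4 - b₄ * x ^ 2 - 2 * b₆ * x - b₈ = x ^ 4 - (b₄ * x ^ 2 + 2 * b₆ * x + b₈) by ring,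
        padic_norm_sub_eq, norm_pow]
      rw [norm_pow]
      refine padic_norm_add_lt (padic_norm_add_lt ?_ ?_) ?_
      · rw [norm_mul, norm_pow]; nlinarith
      · rw [norm_mul]; nlinarith
      · rw [h₈]; linarith
    have hD : ‖4 * x ^ 3 + b₂ * x ^ 2 + 2 * b₄ * x + b₆‖ < ‖x‖ ^ 3 := by
      refine padic_norm_add_lt (padic_norm_add_lt (padic_norm_add_lt ?_ ?_) ?_) ?_
      · rw [norm_mul, norm_pow]; nlinarith
      · rw [norm_mul, norm_pow, h₂]; linarith
      · rw [norm_mul]; nlinarith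
      · linarith
    rw [hN] at hn
    by_contra hle
    nlinarith [norm_nonneg x']
  · have n0 := norm_nonneg x
    have hx2 : ‖x‖ ^ 2 < 1 := by nlinarith
    have hx3 : ‖x‖ ^ 3 < 1 := by nlinarith
    have hx4 : ‖x‖ ^ 4 < 1 := by nlinarith
    have hN : ‖x ^ 4 - b₄ * x ^ 2 - 2 * b₆ * x - b₈‖ = 1 := by
      rw [← h₈, ← norm_neg b₈, show x ^ 4 - b₄ * x ^ 2 - 2 * b₆ * x - b₈ =
        -b₈ - (-x ^ 4 + b₄ * x ^ 2 + 2 * b₆ * x) by ring]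
      refine padic_norm_sub_eq ?_
      rw [norm_neg, h₈]
      refine padic_norm_add_lt (padic_norm_add_lt ?_ ?_) ?_
      · rwa [norm_neg, norm_pow]
      · rw [norm_mul, norm_pow]; nlinarith
      · rw [norm_mul]; nlinarith [norm_nonneg (2 * b₆)]
    have hD : ‖4 * x ^ 3 + b₂ * x ^ 2 + 2 * b₄ * x + b₆‖ < 1 := by
      refine padic_norm_add_lt (padic_norm_add_lt (padic_norm_add_lt ?_ ?_) ?_) h₆
      · rw [norm_mul, norm_pow]; nlinarith [norm_nonneg (4 : ℚ_[2])]
      · rwa [norm_mul, norm_pow, h₂, one_mul]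
      · rw [norm_mul]; nlinarith [norm_nonneg (2 * b₄)]
    rw [hN] at hn
    by_contra hle
    nlinarith [norm_nonneg x']
  · have h1 := norm_sub_one_lt_one_of_norm_eq_one hx
    have h8 := norm_sub_one_lt_one_of_norm_eq_one h₈
    have hx4 : ‖x ^ 4 - 1‖ < 1 := norm_sub_one_lt_one_of_norm_eq_one (by rw [norm_pow, hx, one_pow])
    have hN : ‖x ^ 4 - b₄ * x ^ 2 - 2 * b₆ * x - b₈‖ < 1 := by
      rw [show x ^ 4 - b₄ * x ^ 2 - 2 * b₆ * x - b₈ =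
        (x ^ 4 - 1) - (b₈ - 1) - b₄ * x ^ 2 - 2 * b₆ * x by ring]
      refine padic_norm_sub_lt (padic_norm_sub_lt (padic_norm_sub_lt hx4 h8) ?_) ?_
      · rwa [norm_mul, norm_pow, hx, one_pow, mul_one]
      · rwa [norm_mul, hx, mul_one]
    have hD : ‖4 * x ^ 3 + b₂ * x ^ 2 + 2 * b₄ * x + b₆‖ = 1 := by
      rw [show 4 * x ^ 3 + b₂ * x ^ 2 + 2 * b₄ * x + b₆ =
        b₂ * x ^ 2 - (-(4 * x ^ 3) - 2 * b₄ * x - b₆) by ring]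
      have hb : ‖b₂ * x ^ 2‖ = 1 := by rw [norm_mul, norm_pow, hx, h₂]; norm_num
      rw [padic_norm_sub_eq, hb]
      rw [hb]
      refine padic_norm_sub_lt (padic_norm_sub_lt ?_ ?_) h₆
      · rwa [norm_neg, norm_mul, norm_pow, hx, one_pow, mul_one]
      · rwa [norm_mul, hx, mul_one]
    rw [hD, mul_one] at hn
    rwa [hn]

theorem norm_intCast_of_even {B : ℤ} (h : Even B) : ‖((B : ℚ) : ℚ_[2])‖ < 1 := by
  have := (Padic.norm_intCast_lt_one_iff (p := 2) (k := B)).2 (by exact_mod_cast h.two_dvd)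
  simpa using this

theorem norm_intCast_of_odd {B : ℤ} (h : Odd B) : ‖((B : ℚ) : ℚ_[2])‖ = 1 := by
  refine le_antisymm (by simpa using Padic.norm_int_le_one (p := 2) B) (not_lt.1 fun hlt => ?_)
  have := (Padic.norm_intCast_lt_one_iff (p := 2) (k := B)).1 (by simpa using hlt)
  exact (Int.not_even_iff_odd.2 h) (even_iff_two_dvd.2 (by exact_mod_cast this))

/-- If `b₂`, `b₈` are odd and `b₄`, `b₆` even, there are no rational points of odd order. -/
theorem eq_zero_of_odd_nsmul_eq_zero {W : WeierstrassCurve ℚ} {B₂ B₄ B₆ B₈ : ℤ}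
    (h₂ : W.b₂ = B₂) (h₄ : W.b₄ = B₄) (h₆ : W.b₆ = B₆) (h₈ : W.b₈ = B₈)
    (o₂ : Odd B₂) (e₄ : Even B₄) (e₆ : Even B₆) (o₈ : Odd B₈)
    (P : W.toAffine.Point) (n : ℕ) (hn : Odd n) (hP : n • P = 0) : P = 0 := by
  by_contra hP0
  -- The sequence `2^j P` never vanishes and returns after `φ(n)` steps, since `2^φ(n) ≡ 1` modulo
  -- `n`. By `norm_duplication` its `x`-coordinates reach norm greater than one after at most two
  -- steps and then grow strictly, which contradicts the recurrence.
  set Q : ℕ → W.toAffine.Point := fun j => 2 ^ j • P with hQ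
  have hQs : ∀ j, Q (j + 1) = Q j + Q j := fun j => by
    simp only [hQ, pow_succ', mul_smul, two_nsmul]
  have hQ0 : ∀ j, Q j ≠ 0 := by
    intro j hj
    have h1 : addOrderOf P ∣ 2 ^ j := addOrderOf_dvd_of_nsmul_eq_zero hj
    have h2 : addOrderOf P ∣ n := addOrderOf_dvd_of_nsmul_eq_zero hP
    have hc : Nat.Coprime (2 ^ j) n := (Nat.coprime_two_left.2 hn).pow_left j
    have := Nat.eq_one_of_dvd_coprimes hc h1 h2
    exact hP0 (AddMonoid.addOrderOf_eq_one_iff.1 this)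
  have hper : ∀ j, Q (j + n.totient) = Q j := by
    intro j
    have hm : 2 ^ n.totient ≡ 1 [MOD n] := Nat.ModEq.pow_totient (Nat.coprime_two_left.2 hn)
    have hd : addOrderOf P ∣ n := addOrderOf_dvd_of_nsmul_eq_zero hP
    have : 2 ^ n.totient • P = 1 • P := nsmul_eq_nsmul_iff_modEq.2 (hm.of_dvd hd)
    simp only [hQ]
    rw [pow_add, mul_smul, this, one_smul]
  have hsome : ∀ j, ∃ x y h, Q j = some x y h := by
    intro j
    rcases hj : Q j with _ | ⟨x, y, h⟩
    · exact absurd hj (hQ0 j)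
    · exact ⟨x, y, h, rfl⟩
  choose x y h hxy using hsome
  have hx : ∀ j, ((1 < ‖(x j : ℚ_[2])‖ → ‖(x j : ℚ_[2])‖ < ‖(x (j + 1) : ℚ_[2])‖) ∧
      (‖(x j : ℚ_[2])‖ < 1 → 1 < ‖(x (j + 1) : ℚ_[2])‖) ∧
      (‖(x j : ℚ_[2])‖ = 1 → ‖(x (j + 1) : ℚ_[2])‖ < 1)) := by
    intro j
    have hd := hQs j
    rw [hxy, hxy] at hd
    obtain ⟨hne, heq⟩ := duplication hd.symm
    rw [h₂, h₄, h₆] at hne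
    rw [h₂, h₄, h₆, h₈] at heq
    refine norm_duplication (norm_intCast_of_odd o₂) (norm_intCast_of_even e₄)
      (norm_intCast_of_even e₆) (norm_intCast_of_odd o₈) ?_ ?_
    · exact_mod_cast hne
    · exact_mod_cast heq
  have hbig : ∃ j, 1 < ‖(x j : ℚ_[2])‖ := by
    rcases lt_trichotomy ‖(x 0 : ℚ_[2])‖ 1 with h0 | h0 | h0
    · exact ⟨1, (hx 0).2.1 h0⟩
    · exact ⟨2, (hx 1).2.1 ((hx 0).2.2 h0)⟩
    · exact ⟨0, h0⟩
  obtain ⟨j, hj⟩ := hbig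
  have hmono : ∀ m, 1 < ‖(x (j + m) : ℚ_[2])‖ ∧
      (0 < m → ‖(x j : ℚ_[2])‖ < ‖(x (j + m) : ℚ_[2])‖) := by
    intro m
    induction m with
    | zero => exact ⟨hj, fun h => absurd h (lt_irrefl 0)⟩
    | succ m ih =>
      have h1 := (hx (j + m)).1 ih.1
      refine ⟨ih.1.trans h1, fun _ => ?_⟩
      rcases Nat.eq_zero_or_pos m with rfl | hm
      · exact h1
      · exact (ih.2 hm).trans h1
  have hlt := (hmono n.totient).2 (Nat.totient_pos.2 hn.pos)
  have he := hper j
  rw [hxy, hxy] at he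
  have := (Point.some.inj he).1
  rw [this] at hlt
  exact lt_irrefl _ hlt

end OddTorsion

/-! ### Invariants and rational torsion of the two curves. -/

section Curves

open WeierstrassCurve.Affine WeierstrassCurve.Affine.Point

variable (u : ℤ)

theorem curveE₁_b₂ : (curveE₁ u).b₂ = (u : ℤ) := by simp [curveE₁, WeierstrassCurve.b₂]; ring
theorem curveE₁_b₄ : (curveE₁ u).b₄ = (-2 : ℤ) := by simp [curveE₁, WeierstrassCurve.b₄]
theorem curveE₁_b₆ : (curveE₁ u).b₆ = (0 : ℤ) := by simp [curveE₁, WeierstrassCurve.b₆]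
theorem curveE₁_b₈ : (curveE₁ u).b₈ = (-1 : ℤ) := by simp [curveE₁, WeierstrassCurve.b₈]
theorem curveE₂_b₂ : (curveE₂ u).b₂ = (u : ℤ) := by simp [curveE₂, WeierstrassCurve.b₂]; ring
theorem curveE₂_b₄ : (curveE₂ u).b₄ = (8 : ℤ) := by
  simp [curveE₂, WeierstrassCurve.b₄]; norm_num
theorem curveE₂_b₆ : (curveE₂ u).b₆ = (4 * u : ℤ) := by simp [curveE₂, WeierstrassCurve.b₆]
theorem curveE₂_b₈ : (curveE₂ u).b₈ = (u ^ 2 - 16 : ℤ) := by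
  simp [curveE₂, WeierstrassCurve.b₈]; ring

theorem curveE₁_Δ : (curveE₁ u).Δ = (u ^ 2 + 64 : ℤ) := by
  simp only [WeierstrassCurve.Δ, curveE₁_b₂, curveE₁_b₄, curveE₁_b₆, curveE₁_b₈]
  push_cast; ring

theorem curveE₂_Δ : (curveE₂ u).Δ = (-(u ^ 2 + 64) ^ 2 : ℤ) := by
  simp only [WeierstrassCurve.Δ, curveE₂_b₂, curveE₂_b₄, curveE₂_b₆, curveE₂_b₈]
  push_cast; ring

theorem curveE₁_Δ_ne_zero : (curveE₁ u).Δ ≠ 0 := by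
  rw [curveE₁_Δ]; exact_mod_cast (by positivity)

theorem curveE₂_Δ_ne_zero : (curveE₂ u).Δ ≠ 0 := by
  rw [curveE₂_Δ, Int.cast_ne_zero, neg_ne_zero]; positivity

variable {u}

theorem odd_of_modEq_one (hu : u ≡ 1 [ZMOD 4]) : Odd u := by
  rw [Int.odd_iff]; have := hu.eq; omega

/-- `u² + 64` is not the square of a rational number if it is square-free and odd. -/
theorem sq_ne_sq_add (hsq : Squarefree (u ^ 2 + 64)) (r : ℚ) : r ^ 2 ≠ (u : ℚ) ^ 2 + 64 := by
  intro hr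
  have hs : IsSquare (((u ^ 2 + 64 : ℤ)) : ℚ) := ⟨r, by push_cast; rw [← hr, sq]⟩
  obtain ⟨s, hs⟩ := Rat.isSquare_intCast_iff.1 hs
  have hunit := hsq s (by rw [hs])
  rw [Int.isUnit_iff] at hunit
  rcases hunit with rfl | rfl <;> nlinarith [sq_nonneg u]

/-- On a curve over `ℚ`, a doubled affine point equal to zero satisfies `2y + a₁x + a₃ = 0`. -/
theorem some_add_self_eq_zero_iff {W : WeierstrassCurve ℚ} {x y : ℚ}
    (h : W.toAffine.Nonsingular x y) :
    some x y h + some x y h = 0 ↔ 2 * y + W.a₁ * x + W.a₃ = 0 := by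
  constructor
  · intro h0
    by_contra hne
    have hy : y ≠ W.toAffine.negY x y := by
      intro hy; apply hne; rw [negY] at hy; linarith
    rw [add_self_of_Y_ne hy] at h0
    exact some_ne_zero _ h0
  · intro h0
    refine add_self_of_Y_eq ?_
    rw [negY]; linarith

/-- Here `T = (0, 0)`. A second point of order two is a root of `4x²+ux-4`, of discriminant `u²+64`.
Since `x(T) = 0`, a half of `T` annihilates the numerator of the duplication formula, which is
`(x²+1)²`. -/
theorem curveE₁_torsion (hu : u ≡ 1 [ZMOD 4]) (hsq : Squarefree (u ^ 2 + 64)) :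
    Nonempty (AddCommGroup.torsion (curveE₁ u).toAffine.Point ≃+ ZMod 2) := by
  have hT : (curveE₁ u).toAffine.Nonsingular 0 0 :=
    (equation_iff_nonsingular_of_Δ_ne_zero (curveE₁_Δ_ne_zero u)).1
      ((equation_iff _ _).2 (by simp [curveE₁]))
  refine torsion_equiv_zmod_two (T := some 0 0 hT) (some_ne_zero _)
    ((some_add_self_eq_zero_iff _).2 (by simp [curveE₁])) ?_ ?_
    (eq_zero_of_odd_nsmul_eq_zero (curveE₁_b₂ u) (curveE₁_b₄ u) (curveE₁_b₆ u) (curveE₁_b₈ u)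
      (odd_of_modEq_one hu) (by decide) (by decide) (by decide))
  · rintro (_ | ⟨x, y, h⟩) h0
    · left; rfl
    · right
      have h1 := (some_add_self_eq_zero_iff h).1 h0
      have h2 := (equation_iff _ _).1 h.1
      simp only [curveE₁, one_mul, zero_mul, add_zero] at h1 h2
      have hx : x = 0 := by
        by_contra hx
        have h3 : 4 * x ^ 2 + u * x - 4 = 0 := by
          refine (mul_eq_zero.1 (?_ : x * _ = 0)).resolve_left hx
          linear_combination (2 * y + x) * h1 - 4 * h2
        exact sq_ne_sq_add hsq (8 * x + u) (by linear_combination 16 * h3)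
      subst hx
      have hy : y = 0 := by linarith
      subst hy
      rfl
  · rintro (_ | ⟨x, y, h⟩) h0
    · exact some_ne_zero hT (h0.symm.trans (add_zero _))
    · have h1 := (duplication h0).2
      rw [curveE₁_b₄, curveE₁_b₆, curveE₁_b₈] at h1
      push_cast at h1
      nlinarith [sq_nonneg (x ^ 2), sq_nonneg x]

/-- Here `T = (-u/4, u/8)`, and the cofactor `x²+4` has no real root. The duplication formula with
`x(2P) = -u/4` collapses to the square `(x² + ux/2 - 4)² = 0`, whose roots satisfy `(4x+u)² =
u²+64`. -/
theorem curveE₂_torsion (hu : u ≡ 1 [ZMOD 4]) (hsq : Squarefree (u ^ 2 + 64)) :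
    Nonempty (AddCommGroup.torsion (curveE₂ u).toAffine.Point ≃+ ZMod 2) := by
  have hT : (curveE₂ u).toAffine.Nonsingular (-u / 4) (u / 8) :=
    (equation_iff_nonsingular_of_Δ_ne_zero (curveE₂_Δ_ne_zero u)).1
      ((equation_iff _ _).2 (by simp only [curveE₂]; ring))
  refine torsion_equiv_zmod_two (T := some _ _ hT) (some_ne_zero _)
    ((some_add_self_eq_zero_iff _).2 (by simp only [curveE₂]; ring)) ?_ ?_
    (eq_zero_of_odd_nsmul_eq_zero (curveE₂_b₂ u) (curveE₂_b₄ u) (curveE₂_b₆ u) (curveE₂_b₈ u)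
      (odd_of_modEq_one hu) (by decide) ⟨2 * u, by ring⟩
      ((odd_of_modEq_one hu).pow.sub_even (by decide)))
  · rintro (_ | ⟨x, y, h⟩) h0
    · left; rfl
    · right
      have h1 := (some_add_self_eq_zero_iff h).1 h0
      have h2 := (equation_iff _ _).1 h.1
      simp only [curveE₂, one_mul, zero_mul, add_zero] at h1 h2
      have hx : 4 * x + u = 0 := by
        refine (mul_eq_zero.1 (?_ : _ * (x ^ 2 + 4) = 0)).resolve_right (by positivity)
        linear_combination (2 * y + x) * h1 - 4 * h2
      obtain rfl : x = -u / 4 := by linarith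
      obtain rfl : y = u / 8 := by linarith
      rfl
  · rintro (_ | ⟨x, y, h⟩) h0
    · exact some_ne_zero hT (h0.symm.trans (add_zero _))
    · have h1 := (duplication h0).2
      rw [curveE₂_b₂, curveE₂_b₄, curveE₂_b₆, curveE₂_b₈] at h1
      push_cast at h1
      have h3 : (x ^ 2 + u / 2 * x - 4) ^ 2 = 0 := by linear_combination -h1
      exact sq_ne_sq_add hsq (4 * x + u) (by linear_combination 16 * (pow_eq_zero_iff two_ne_zero).1 h3)

end Curves

/-! ### Minimal models -/

section Minimality

open WeierstrassCurve.Affine WeierstrassCurve.Affine.Point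
open WithZero WeierstrassCurve

variable (R : Type*) [CommRing R] [IsDomain R] [IsDiscreteValuationRing R]
variable (K : Type*) [Field K] [Algebra R K] [IsFractionRing R K]

/-- The multiplicative valuation of the fraction field of a discrete valuation ring. -/
noncomputable abbrev dvrValuation : Valuation K ℤᵐ⁰ :=
  (IsDiscreteValuationRing.maximalIdeal R).valuation K

variable {K}

theorem dvrValuation_le_one_iff {x : K} :
    dvrValuation R K x ≤ 1 ↔ ∃ a : R, algebraMap R K a = x :=
  ⟨IsDiscreteValuationRing.exists_lift_of_le_one, by
    rintro ⟨a, rfl⟩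
    exact IsDedekindDomain.HeightOneSpectrum.valuation_le_one _ a⟩

theorem dvrValuation_lt_one_iff_residue {a : R} :
    dvrValuation R K (algebraMap R K a) < 1 ↔ IsLocalRing.residue R a = 0 := by
  rw [IsLocalRing.residue_eq_zero_iff]
  exact IsDedekindDomain.HeightOneSpectrum.valuation_lt_one_iff_mem _ a

theorem dvrValuation_irreducible {ϖ : R} (h : Irreducible ϖ) :
    dvrValuation R K (algebraMap R K ϖ) = exp (-1 : ℤ) := by
  rw [IsDedekindDomain.HeightOneSpectrum.valuation_of_algebraMap]
  exact IsDedekindDomain.HeightOneSpectrum.intValuation_singleton _ h.ne_zero h.maximalIdeal_eq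

theorem withZero_le_exp_neg_one {x : ℤᵐ⁰} (h : x < 1) : x ≤ exp (-1 : ℤ) := by
  rcases eq_or_ne x 0 with rfl | hx
  · exact zero_le
  · rw [← exp_log hx, ← exp_zero, exp_lt_exp] at h
    rw [← exp_log hx, exp_le_exp]
    omega

variable (W : WeierstrassCurve K)

/-- An integral Weierstrass equation whose discriminant has valuation less than `12` is minimal. -/
theorem isMinimal_of_valuation_Δ [IsIntegral R W] (h : exp (-12 : ℤ) < dvrValuation R K W.Δ) :
    IsMinimal R W := by
  refine ⟨⟨by simpa using ‹IsIntegral R W›, fun C hC hle => ?_⟩⟩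
  have hC' : IsIntegral R (C • W) := hC
  rw [← Subtype.coe_le_coe] at hle ⊢
  simp only [one_smul, valuation_Δ_aux_eq_of_isIntegral] at hle ⊢
  have hΔ : W.Δ = (C.u : K) ^ 12 * (C • W).Δ := by
    rw [variableChange_Δ, ← mul_assoc, ← mul_pow, Units.mul_inv, one_pow, one_mul]
  have h1 : dvrValuation R K (C • W).Δ ≤ 1 :=
    (dvrValuation_le_one_iff R).2 (Δ_integral_of_isIntegral R _)
  have hv : dvrValuation R K W.Δ = dvrValuation R K C.u ^ 12 * dvrValuation R K (C • W).Δ := by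
    rw [hΔ, map_mul, map_pow]
  -- The valuation is multiplicative, with a uniformizer at `exp (-1)`. Were `C.u` in the maximal
  -- ideal, `Δ(W) = u¹² Δ(C • W)` would have valuation at most `exp (-12)`.
  have hu : 1 ≤ dvrValuation R K C.u := by
    by_contra hlt
    have h2 := pow_le_pow_left' (withZero_le_exp_neg_one (not_le.1 hlt)) 12
    rw [hv] at h
    refine absurd (h.trans_le (mul_le_mul' h2 h1)) ?_
    rw [← exp_nsmul, mul_one]
    exact lt_irrefl _
  change dvrValuation R K (C • W).Δ ≤ dvrValuation R K W.Δ
  rw [hv]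
  exact le_mul_of_one_le_left' (one_le_pow_of_one_le' hu 12)

/-- Two minimal equations of the same curve have discriminants of the same valuation. -/
theorem valuation_Δ_eq_of_isMinimal [IsMinimal R W] (C : VariableChange K) [IsMinimal R (C • W)] :
    dvrValuation R K (C • W).Δ = dvrValuation R K W.Δ := by
  have key : ∀ (V : WeierstrassCurve K) [IsMinimal R V] (D : VariableChange K)
      [IsMinimal R (D • V)], dvrValuation R K (D • V).Δ ≤ dvrValuation R K V.Δ := by
    intro V _ D _
    have h := (IsMinimal.val_Δ_maximal (R := R) (W := V)).2 (j := D) inferInstance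
    rw [← Subtype.coe_le_coe, ← Subtype.coe_le_coe] at h
    simp only [one_smul, valuation_Δ_aux_eq_of_isIntegral] at h
    exact (le_total _ _).elim h id
  refine le_antisymm (key W C) ?_
  have : IsMinimal R (C⁻¹ • C • W) := by rwa [inv_smul_smul]
  have h := key (C • W) C⁻¹
  rwa [inv_smul_smul] at h

theorem valuation_u_eq_one_of_isMinimal [IsMinimal R W] (C : VariableChange K)
    [IsMinimal R (C • W)] (hΔ : W.Δ ≠ 0) : dvrValuation R K C.u = 1 := by
  have h := valuation_Δ_eq_of_isMinimal R W C
  rw [variableChange_Δ, map_mul, map_pow, Units.val_inv_eq_inv_val, map_inv₀] at h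
  have h0 : dvrValuation R K W.Δ ≠ 0 := (Valuation.ne_zero_iff _).2 hΔ
  have h1 := (mul_eq_right₀ h0).1 h
  rw [inv_pow, inv_eq_one] at h1
  exact (pow_eq_one_iff_left (by norm_num)).1 h1

variable [IsMinimal R W]

theorem exists_minimal_eq_smul (W : WeierstrassCurve K) :
    ∃ C : VariableChange K, W.minimal R = C • W := ⟨_, rfl⟩

theorem valuation_minimal_Δ : dvrValuation R K (W.minimal R).Δ = dvrValuation R K W.Δ := by
  obtain ⟨C, hC⟩ := exists_minimal_eq_smul R W
  have : IsMinimal R (C • W) := hC ▸ inferInstance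
  rw [hC, valuation_Δ_eq_of_isMinimal]

theorem not_hasGoodReduction_minimal_iff :
    ¬ (W.minimal R).HasGoodReduction R ↔ dvrValuation R K W.Δ < 1 := by
  have h : dvrValuation R K W.Δ ≤ 1 :=
    (dvrValuation_le_one_iff R).2 (Δ_integral_of_isIntegral R _)
  rw [hasGoodReduction_iff, ← valuation_minimal_Δ R W] at *
  constructor
  · intro hn
    exact lt_of_le_of_ne h fun he => hn ⟨inferInstance, he⟩
  · rintro hlt ⟨_, he⟩
    exact hlt.ne he

end Minimality

/-! ### Lines through a point of order two -/

section TwoTorsionPoint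

open WeierstrassCurve.Affine WeierstrassCurve.Affine.Point

variable {F : Type*} [Field F] [DecidableEq F] {W : WeierstrassCurve.Affine F}

/-- If `(e, f)` is a point of order two, the `x`-coordinates of three collinear points satisfy
`(x₁ - e)(x₂ - e)(x₃ - e) = (ℓ(e - x₁) + y₁ - f)²`. -/
theorem prod_sub_eq_sq {e f : F} (hT : W.Equation e f) (h2 : 2 * f + W.a₁ * e + W.a₃ = 0)
    {x₁ x₂ y₁ y₂ : F} (h₁ : W.Equation x₁ y₁) (h₂ : W.Equation x₂ y₂)
    (hxy : ¬(x₁ = x₂ ∧ y₁ = W.negY x₂ y₂)) :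
    (x₁ - e) * (x₂ - e) * (W.addX x₁ x₂ (W.slope x₁ x₂ y₁ y₂) - e) =
      (W.slope x₁ x₂ y₁ y₂ * (e - x₁) + y₁ - f) ^ 2 := by
  -- Substituting the line into the cubic gives a polynomial with roots `x₁, x₂, x₃`. At `X = e` the
  -- cubic itself vanishes because `(e, f)` lies on it, and what remains is a square because `2f +
  -- a₁e + a₃ = 0`.
  have h := congrArg (Polynomial.eval e) (addPolynomial_slope h₁ h₂ hxy)
  rw [addPolynomial_eq] at h
  simp only [Cubic.toPoly, Polynomial.eval_neg, Polynomial.eval_add, Polynomial.eval_mul,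
    Polynomial.eval_sub, Polynomial.eval_pow, Polynomial.eval_C, Polynomial.eval_X] at h
  rw [equation_iff] at hT
  generalize W.slope x₁ x₂ y₁ y₂ = ℓ at *
  generalize W.addX x₁ x₂ ℓ = x₃ at *
  linear_combination -h + hT + (ℓ * (e - x₁) + y₁ - f) * h2

/-- Translation by a point `(e, f)` of order two. -/
theorem addX_twoTorsion {e f : F} (hT : W.Equation e f) (h2 : 2 * f + W.a₁ * e + W.a₃ = 0)
    {x y : F} (h : W.Equation x y) (hx : e ≠ x) :
    (W.addX e x (W.slope e x f y) - e) * (x - e) =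
      3 * e ^ 2 + 2 * W.a₂ * e + W.a₄ - W.a₁ * f := by
  rw [equation_iff] at hT h
  have hd : e - x ≠ 0 := sub_ne_zero.2 hx
  rw [slope_of_X_ne hx, addX]
  field_simp
  linear_combination (x - e) * h + (e - x) * hT + (x - e) * (f - y) * h2

end TwoTorsionPoint

/-! ### Local Tamagawa factors -/

section Tamagawa

open WeierstrassCurve.Affine WeierstrassCurve.Affine.Point
open WithZero WeierstrassCurve

variable (R : Type*) [CommRing R] [IsDomain R] [IsDiscreteValuationRing R]
variable {K : Type*} [Field K] [Algebra R K] [IsFractionRing R K]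

/-- A nonzero element of even valuation. -/
def EvenValuation (z : K) : Prop := ∃ g : ℤᵐ⁰, g ≠ 0 ∧ dvrValuation R K z = g ^ 2

variable {R}

theorem EvenValuation.mul {z w : K} (hz : EvenValuation R z) (hw : EvenValuation R w) :
    EvenValuation R (z * w) := by
  obtain ⟨g, hg, hz⟩ := hz
  obtain ⟨h, hh, hw⟩ := hw
  exact ⟨g * h, mul_ne_zero hg hh, by rw [map_mul, hz, hw, mul_pow]⟩

theorem EvenValuation.inv {z : K} (hz : EvenValuation R z) : EvenValuation R z⁻¹ := by
  obtain ⟨g, hg, hz⟩ := hz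
  exact ⟨g⁻¹, inv_ne_zero hg, by rw [map_inv₀, hz, inv_pow]⟩

theorem EvenValuation.ne_zero {z : K} (hz : EvenValuation R z) : z ≠ 0 := by
  obtain ⟨g, hg, hz⟩ := hz
  rw [← Valuation.ne_zero_iff (dvrValuation R K), hz]
  exact pow_ne_zero 2 hg

theorem evenValuation_sq {z : K} (hz : z ≠ 0) : EvenValuation R (z ^ 2) :=
  ⟨_, (Valuation.ne_zero_iff (dvrValuation R K)).2 hz, map_pow _ _ _⟩

theorem EvenValuation.of_mul_right {z w : K} (h : EvenValuation R (z * w))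
    (hw : EvenValuation R w) : EvenValuation R z := by
  have := h.mul hw.inv
  rwa [mul_inv_cancel_right₀ hw.ne_zero] at this

theorem EvenValuation.of_mul_left {z w : K} (h : EvenValuation R (z * w))
    (hz : EvenValuation R z) : EvenValuation R w :=
  EvenValuation.of_mul_right (mul_comm z w ▸ h) hz

theorem not_evenValuation {b : K} (hb : dvrValuation R K b = exp (-1 : ℤ)) :
    ¬ EvenValuation R b := by
  rintro ⟨g, hg, h⟩
  rw [hb, ← exp_log hg, ← exp_nsmul, exp_inj, nsmul_eq_mul] at h
  push_cast at h
  omega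

theorem evenValuation_or {b z : K} (hb : dvrValuation R K b = exp (-1 : ℤ)) (hz : z ≠ 0) :
    EvenValuation R z ∨ EvenValuation R (b * z) := by
  have hz' := (Valuation.ne_zero_iff (dvrValuation R K)).2 hz
  rcases Int.even_or_odd' (log (dvrValuation R K z)) with ⟨k, hk | hk⟩
  · refine .inl ⟨exp k, exp_ne_zero, ?_⟩
    rw [← exp_log hz', hk, ← exp_nsmul, nsmul_eq_mul, Nat.cast_ofNat]
  · refine .inr ⟨exp k, exp_ne_zero, ?_⟩
    rw [map_mul, hb, ← exp_log hz', hk, ← exp_add, ← exp_nsmul, nsmul_eq_mul, Nat.cast_ofNat]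
    congr 1; ring

theorem valuation_add_eq_of_lt {a b : K} (h : dvrValuation R K b < dvrValuation R K a) :
    dvrValuation R K (a + b) = dvrValuation R K a :=
  Valuation.map_add_eq_of_lt_left _ h

/-- On `Y² + a₁XY = X³ + a₂X² + bX` with `b` a uniformizer, `X ≠ 0` has even valuation if and only
if it is not in the maximal ideal. -/
theorem evenValuation_iff_one_le {a₁ a₂ b X Y : K} (ha₁ : dvrValuation R K a₁ ≤ 1)
    (ha₂ : dvrValuation R K a₂ ≤ 1) (hb : dvrValuation R K b = exp (-1 : ℤ))
    (h2 : dvrValuation R K 2 = 1) (h : Y ^ 2 + a₁ * X * Y = X ^ 3 + a₂ * X ^ 2 + b * X) :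
    EvenValuation R X ↔ 1 ≤ dvrValuation R K X := by
  set v := dvrValuation R K with hv
  have hb1 : v b < 1 := by rw [hb, ← exp_zero, exp_lt_exp]; norm_num
  constructor
  · intro hX
    by_contra hlt
    rw [not_le] at hlt
    have hX0 := hX.ne_zero
    have hvX : v X ≠ 0 := (Valuation.ne_zero_iff v).2 hX0
    refine not_evenValuation hb (EvenValuation.of_mul_left (z := X) (w := b) ?_ hX)
    -- Completing the square gives `(2Y + a₁X)² = X(4b + X(…))`. If `X` is divisible by the square
    -- of a uniformizer, the bracket has the valuation of `b`, so `Xb` has even valuation; as `X`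
    -- does too, so would `b`. Otherwise `X` is itself a uniformizer.
    by_cases hX1 : v X < exp (-1 : ℤ)
    · have hD : (2 * Y + a₁ * X) ^ 2 = X * (4 * b + X * (4 * X + (a₁ ^ 2 + 4 * a₂))) := by
        linear_combination 4 * h
      have h4 : v 4 = 1 := by
        rw [show (4 : K) = 2 * 2 by norm_num, map_mul, h2, one_mul]
      have hle : v (4 * X + (a₁ ^ 2 + 4 * a₂)) ≤ 1 := by
        refine (v.map_add _ _).trans (max_le ?_ ((v.map_add _ _).trans (max_le ?_ ?_)))
        · rw [map_mul, h4, one_mul]; exact hlt.le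
        · rw [map_pow]; exact pow_le_one' ha₁ 2
        · rwa [map_mul, h4, one_mul]
      have hlt' : v (X * (4 * X + (a₁ ^ 2 + 4 * a₂))) < v (4 * b) := by
        rw [map_mul, map_mul, h4, one_mul, hb]
        exact (mul_le_of_le_one_right' hle).trans_lt hX1
      have hvD : v (2 * Y + a₁ * X) ^ 2 = v (X * b) := by
        rw [← map_pow, hD, map_mul, valuation_add_eq_of_lt hlt', map_mul, h4, one_mul, map_mul]
      refine ⟨v (2 * Y + a₁ * X), fun h0 => ?_, hvD.symm⟩
      rw [h0, zero_pow two_ne_zero, map_mul, eq_comm, mul_eq_zero, hb] at hvD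
      exact hvD.elim hvX exp_ne_zero
    · have hX2 : v X = exp (-1 : ℤ) := le_antisymm (withZero_le_exp_neg_one hlt) (not_lt.1 hX1)
      exact absurd hX (not_evenValuation hX2)
  · intro hX
    rcases hX.eq_or_lt with hX | hX
    · exact ⟨1, one_ne_zero, by rw [one_pow]; exact hX.symm⟩
    have hvX : v X ≠ 0 := (zero_lt_one.trans hX).ne'
    have hrhs : v (X ^ 3 + a₂ * X ^ 2 + b * X) = v X ^ 3 := by
      have h1 : v (a₂ * X ^ 2) < v (X ^ 3) := by
        rw [map_mul, map_pow, map_pow]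
        exact (mul_le_of_le_one_left' ha₂).trans_lt (pow_lt_pow_right₀ hX (by norm_num))
      have h3 : v (b * X) < v (X ^ 3 + a₂ * X ^ 2) := by
        rw [valuation_add_eq_of_lt h1, map_mul, map_pow]
        refine (mul_le_of_le_one_left' hb1.le).trans_lt ?_
        exact lt_self_pow₀ hX (by norm_num)
      rw [valuation_add_eq_of_lt h3, valuation_add_eq_of_lt h1, map_pow]
    have hY : v X < v Y := by
      by_contra hle
      rw [not_lt] at hle
      have : v (Y ^ 2 + a₁ * X * Y) ≤ v X ^ 2 := by
        refine (v.map_add _ _).trans (max_le ?_ ?_)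
        · rw [map_pow]; exact pow_le_pow_left' hle 2
        · rw [map_mul, map_mul, sq]
          exact mul_le_mul' (mul_le_of_le_one_left' ha₁) hle
      rw [h, hrhs] at this
      exact absurd this (not_le.2 (pow_lt_pow_right₀ hX (by norm_num)))
    have hlhs : v (Y ^ 2 + a₁ * X * Y) = v Y ^ 2 := by
      rw [valuation_add_eq_of_lt, map_pow]
      rw [map_mul, map_mul, map_pow, sq]
      have hY0 : 0 < v Y := zero_le.trans_lt hY
      exact mul_lt_mul_of_pos_right ((mul_le_of_le_one_left' ha₁).trans_lt hY) hY0
    rw [h, hrhs] at hlhs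
    -- Away from the integral points `Y²` and `X³` have the same valuation, so `X` has that of
    -- `(Y/X)²`.
    refine ⟨v Y / v X, div_ne_zero (zero_le.trans_lt hY).ne' hvX, ?_⟩
    rw [div_pow, ← hlhs, pow_succ (v X) 2, mul_div_cancel_left₀ _ (pow_ne_zero 2 hvX)]

variable {W : WeierstrassCurve K} [IsMinimal R W]

theorem integralModel_equation_iff {a b : R} :
    (W.integralModel R).toAffine.Equation a b ↔
      W.toAffine.Equation (algebraMap R K a) (algebraMap R K b) := by
  rw [← map_equation (W.integralModel R).toAffine (IsFractionRing.injective R K),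
    show (W.integralModel R).toAffine.map (algebraMap R K) = W from
      baseChange_integralModel_eq R W]

theorem reduction_equation {a b : R}
    (h : W.toAffine.Equation (algebraMap R K a) (algebraMap R K b)) :
    (W.reduction R).toAffine.Equation (IsLocalRing.residue R a) (IsLocalRing.residue R b) :=
  (integralModel_equation_iff.2 h).map _

theorem dvrValuation_a₁_le : dvrValuation R K W.a₁ ≤ 1 :=
  (dvrValuation_le_one_iff R).2 ⟨_, integralModel_a₁_eq R W⟩

/-- If the point `(e, f)` of order two reduces to a node and `b = 3e² + 2a₂e + a₄ - a₁f` is a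
uniformizer, then a point has nonsingular reduction if and only if `x - e` has even valuation. -/
theorem hasNonsingularReduction_iff {e f : R}
    (hT : W.toAffine.Equation (algebraMap R K e) (algebraMap R K f))
    (h2T : 2 * algebraMap R K f + W.a₁ * algebraMap R K e + W.a₃ = 0)
    (hb : dvrValuation R K (3 * algebraMap R K e ^ 2 + 2 * W.a₂ * algebraMap R K e + W.a₄ -
      W.a₁ * algebraMap R K f) = exp (-1 : ℤ))
    (h2 : dvrValuation R K 2 = 1) {x y : K} (h : W.toAffine.Nonsingular x y) :
    HasNonsingularReduction R W (.some x y h) ↔ EvenValuation R (x - algebraMap R K e) := by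
  set v := dvrValuation R K with hv
  set I := W.integralModel R with hI
  have heq := h.1
  have hT' := hT
  rw [equation_iff] at heq hT'
  -- With the origin moved to `(e, f)` the equation has the shape treated in
  -- `evenValuation_iff_one_le`.
  have hXY : (y - algebraMap R K f) ^ 2 + W.a₁ * (x - algebraMap R K e) * (y - algebraMap R K f) =
      (x - algebraMap R K e) ^ 3 + (W.a₂ + 3 * algebraMap R K e) * (x - algebraMap R K e) ^ 2 +
      (3 * algebraMap R K e ^ 2 + 2 * W.a₂ * algebraMap R K e + W.a₄ -
        W.a₁ * algebraMap R K f) * (x - algebraMap R K e) := by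
    linear_combination heq - hT' - (y - algebraMap R K f) * h2T
  have hA₂ : v (W.a₂ + 3 * algebraMap R K e) ≤ 1 :=
    (dvrValuation_le_one_iff R).2 ⟨I.a₂ + 3 * e, by
      simp only [hI, map_add, map_mul, map_ofNat, integralModel_a₂_eq]⟩
  rw [evenValuation_iff_one_le dvrValuation_a₁_le hA₂ hb h2 hXY]
  have h2I : 2 * f + I.a₁ * e + I.a₃ = 0 := by
    apply IsFractionRing.injective R K
    simp only [map_add, map_mul, _root_.map_zero, map_ofNat, hI, integralModel_a₁_eq, integralModel_a₃_eq]
    exact h2T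
  have hbI : IsLocalRing.residue R (3 * e ^ 2 + 2 * I.a₂ * e + I.a₄ - I.a₁ * f) = 0 := by
    rw [← dvrValuation_lt_one_iff_residue R (K := K)]
    simp only [map_add, map_sub, map_mul, map_pow, map_ofNat, hI, integralModel_a₁_eq,
      integralModel_a₂_eq, integralModel_a₄_eq]
    change v _ < 1
    rw [hb, ← exp_zero, exp_lt_exp]
    norm_num
  have h2r := congrArg (IsLocalRing.residue R) h2I
  simp only [map_add, map_sub, map_mul, map_pow, map_ofNat, _root_.map_zero] at h2r hbI
  constructor
  · intro hns
    by_contra hlt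
    rw [not_le] at hlt
    have hY : v (y - algebraMap R K f) < 1 := by
      by_contra hY
      rw [not_lt] at hY
      have h1 : v ((y - algebraMap R K f) ^ 2 +
          W.a₁ * (x - algebraMap R K e) * (y - algebraMap R K f)) =
          v (y - algebraMap R K f) ^ 2 := by
        rw [valuation_add_eq_of_lt, map_pow]
        rw [map_mul, map_mul, map_pow, sq]
        exact mul_lt_mul_of_pos_right
          (((mul_le_of_le_one_left' dvrValuation_a₁_le).trans_lt hlt).trans_le hY)
          (zero_lt_one.trans_le hY)
      rw [hXY] at h1
      have h3 : v ((x - algebraMap R K e) ^ 3 +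
          (W.a₂ + 3 * algebraMap R K e) * (x - algebraMap R K e) ^ 2 +
          (3 * algebraMap R K e ^ 2 + 2 * W.a₂ * algebraMap R K e + W.a₄ -
            W.a₁ * algebraMap R K f) * (x - algebraMap R K e)) < 1 := by
        refine v.map_add_lt (v.map_add_lt ?_ ?_) ?_
        · rw [map_pow]; exact pow_lt_one₀ zero_le hlt (by norm_num)
        · rw [map_mul, map_pow]
          exact (mul_le_of_le_one_left' hA₂).trans_lt (pow_lt_one₀ zero_le hlt (by norm_num))
        · rw [map_mul, hb]
          refine (mul_le_of_le_one_left' ?_).trans_lt hlt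
          rw [← exp_zero, exp_le_exp]; norm_num
      rw [h1] at h3
      exact absurd h3 (not_lt.2 (one_le_pow_of_one_le' hY 2))
    obtain ⟨X, hX⟩ := (dvrValuation_le_one_iff R).1 hlt.le
    obtain ⟨Y, hY'⟩ := (dvrValuation_le_one_iff R).1 hY.le
    have hXr : IsLocalRing.residue R X = 0 := by
      rw [← dvrValuation_lt_one_iff_residue R (K := K), hX]; exact hlt
    have hYr : IsLocalRing.residue R Y = 0 := by
      rw [← dvrValuation_lt_one_iff_residue R (K := K), hY']; exact hY
    have hn := hns (X + e) (Y + f) (by rw [map_add, hX]; ring) (by rw [map_add, hY']; ring)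
    rw [map_add, map_add, hXr, hYr, zero_add, zero_add, nonsingular_iff] at hn
    rcases hn.2 with hn | hn
    · apply hn
      simp only [reduction, map_a₁, map_a₂, map_a₄]
      linear_combination -hbI
    · apply hn
      simp only [reduction, map_a₁, map_a₃]
      linear_combination h2r
  · intro hge a b ha hb'
    by_contra hns
    subst ha hb'
    have hr := reduction_equation h.1
    have hrT := reduction_equation hT
    rw [nonsingular_iff, not_and_or, not_or, not_not, not_not] at hns
    obtain ⟨hP, hQ⟩ := hns.resolve_left (not_not.2 hr)
    rw [equation_iff] at hr hrT
    simp only [reduction, map_a₁, map_a₂, map_a₃, map_a₄, map_a₆] at hr hrT hP hQ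
    rw [← map_sub] at hge
    refine absurd ((dvrValuation_lt_one_iff_residue R (K := K)).2 ?_) (not_lt.2 hge)
    rw [map_sub]
    refine pow_eq_zero_iff (three_ne_zero) |>.1 ?_
    set r := IsLocalRing.residue R
    -- A nodal cubic has only one singular point. In coordinates centred at the node, `2F - X F_X -
    -- Y F_Y = X³`, so a singular point has `X = 0`, in every characteristic.
    linear_combination 2 * (hr - hrT + (r a - r e) * hbI - (r b - r f) * h2r) -
      (r a - r e) * (hP + hbI) - (r b - r f) * (hQ - h2r)

open scoped Classical in
/-- Under the assumptions of `hasNonsingularReduction_iff`, the points with nonsingular reduction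
have index two. -/
theorem index_nonsingularReductionSubgroup_eq_two {e f : R}
    (hT : W.toAffine.Nonsingular (algebraMap R K e) (algebraMap R K f))
    (h2T : 2 * algebraMap R K f + W.a₁ * algebraMap R K e + W.a₃ = 0)
    (hb : dvrValuation R K (3 * algebraMap R K e ^ 2 + 2 * W.a₂ * algebraMap R K e + W.a₄ -
      W.a₁ * algebraMap R K f) = exp (-1 : ℤ))
    (h2 : dvrValuation R K 2 = 1) :
    (nonsingularReductionSubgroup R W).index = 2 := by
  set e' := algebraMap R K e with he'
  set f' := algebraMap R K f with hf'
  set T : W.toAffine.Point := .some e' f' hT with hTdef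
  have hfneg : f' = W.toAffine.negY e' f' := by
    rw [negY]; linear_combination h2T
  have hTT : T + T = 0 := add_self_of_Y_eq hfneg
  have hnegT : -T = T := neg_eq_of_add_eq_zero_left hTT
  have hns := fun {x y : K} (h : W.toAffine.Nonsingular x y) =>
    hasNonsingularReduction_iff hT.1 h2T hb h2 h
  -- translation by `T`
  have htrans : ∀ {x y : K} (h : W.toAffine.Nonsingular x y), x ≠ e' →
      ∃ x' y' h', T + .some x y h = Point.some x' y' h' ∧ (x' - e') * (x - e') =
        3 * e' ^ 2 + 2 * W.a₂ * e' + W.a₄ - W.a₁ * f' := by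
    intro x y h hx
    refine ⟨_, _, _, add_of_X_ne hx.symm, addX_twoTorsion hT.1 h2T h.1 hx.symm⟩
  have hxe : ∀ {x y : K} (h : W.toAffine.Nonsingular x y), x = e' → Point.some x y h = T := by
    intro x y h hx
    rcases (X_eq_iff (h₁ := h) (h₂ := hT)).1 hx with h1 | h1
    · exact h1
    · rw [h1]; exact hnegT
  let E : AddSubgroup W.toAffine.Point :=
    { carrier := {P | HasNonsingularReduction R W P}
      zero_mem' := trivial
      neg_mem' := by
        rintro (_ | ⟨x, y, h⟩) hP
        · exact hP
        · exact (hns ((nonsingular_neg x y).2 h)).2 ((hns h).1 hP)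
      add_mem' := by
        rintro (_ | ⟨x₁, y₁, h₁⟩) (_ | ⟨x₂, y₂, h₂⟩) hP hQ
        · exact hP
        · rwa [← zero_def, zero_add]
        · rwa [← zero_def, add_zero]
        change HasNonsingularReduction R W (_ + _)
        by_cases hxy : x₁ = x₂ ∧ y₁ = W.toAffine.negY x₂ y₂
        · rw [add_of_Y_eq hxy.1 hxy.2]; trivial
        have e₁ := (hns h₁).1 hP
        have e₂ := (hns h₂).1 hQ
        have hprod := prod_sub_eq_sq hT.1 h2T h₁.1 h₂.1 hxy
        -- The product formula only controls `x₃ - e` when it is nonzero. If the sum were `T`, then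
        -- the second point would be `T` minus the first, and the product of their `x - e` would be
        -- `b`, of odd valuation.
        by_cases h3 : W.toAffine.addX x₁ x₂ (W.toAffine.slope x₁ x₂ y₁ y₂) = e'
        · exfalso
          have hsum : Point.some x₁ y₁ h₁ + .some x₂ y₂ h₂ = T := by
            rw [add_some hxy]; exact hxe _ h3
          have hQ' : Point.some x₂ y₂ h₂ = T + .some x₁ _ ((nonsingular_neg x₁ y₁).2 h₁) := by
            rw [← neg_some h₁, ← hsum]; abel
          obtain ⟨x', y', h', hs, hm⟩ := htrans ((nonsingular_neg x₁ y₁).2 h₁)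
            (sub_ne_zero.1 e₁.ne_zero)
          rw [hs] at hQ'
          obtain ⟨rfl, rfl⟩ := Point.some.inj hQ'
          exact not_evenValuation hb (hm ▸ e₂.mul e₁)
        · rw [add_some hxy]
          refine (hns _).2 (EvenValuation.of_mul_left ?_ (e₁.mul e₂))
          rw [hprod]
          refine evenValuation_sq fun h0 => ?_
          rw [h0, zero_pow two_ne_zero] at hprod
          exact mul_ne_zero (mul_ne_zero e₁.ne_zero e₂.ne_zero) (sub_ne_zero.2 h3) hprod }
  have hE : nonsingularReductionSubgroup R W = E := AddSubgroup.closure_eq E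
  have hmem : ∀ P, P ∈ E ↔ HasNonsingularReduction R W P := fun P => Iff.rfl
  have hTE : T ∉ E := fun h => ((hns hT).1 h).ne_zero (sub_self _)
  rw [hE, AddSubgroup.index_eq_two_iff]
  refine ⟨T, fun P => ?_⟩
  have hnot : ¬ (P + T ∈ E ∧ P ∈ E) := by
    rintro ⟨h1, h2⟩
    exact hTE (by simpa using E.sub_mem h1 h2)
  -- Translation by `T` replaces `x - e` by `b / (x - e)`, which reverses the parity of the
  -- valuation.
  have hor : P + T ∈ E ∨ P ∈ E := by
    rcases P with _ | ⟨x, y, h⟩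
    · exact .inr E.zero_mem
    by_cases hx : x = e'
    · rw [hxe h hx, hTT]; exact .inl E.zero_mem
    rcases evenValuation_or hb (sub_ne_zero.2 hx) with hev | hev
    · exact .inr ((hns h).2 hev)
    · left
      obtain ⟨x', y', h', hs, hm⟩ := htrans h hx
      rw [add_comm, hs]
      refine (hns h').2 ?_
      rw [← hm, mul_assoc, ← sq] at hev
      exact hev.of_mul_right (evenValuation_sq (sub_ne_zero.2 hx))
  rcases hor with h | h
  · exact .inl ⟨h, fun h' => hnot ⟨h, h'⟩⟩
  · exact .inr ⟨h, fun h' => hnot ⟨h', h⟩⟩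

open scoped Classical in
/-- If the discriminant is a uniformizer, all points have nonsingular reduction. -/
theorem index_nonsingularReductionSubgroup_eq_one
    (hΔ : dvrValuation R K W.Δ = exp (-1 : ℤ)) :
    (nonsingularReductionSubgroup R W).index = 1 := by
  rw [AddSubgroup.index_eq_one, eq_top_iff]
  refine fun P _ => AddSubgroup.subset_closure ?_
  rcases P with _ | ⟨x, y, h⟩
  · trivial
  rintro a b rfl rfl
  by_contra hns
  have hr := reduction_equation h.1
  rw [nonsingular_iff, not_and_or, not_or, not_not, not_not] at hns
  obtain ⟨hP, hQ⟩ := hns.resolve_left (not_not.2 hr)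
  obtain ⟨ϖ, hϖ⟩ := IsDiscreteValuationRing.exists_irreducible R
  set I := W.integralModel R with hI
  have hmem : ∀ z : R, IsLocalRing.residue R z = 0 → ∃ s, z = ϖ * s := by
    intro z hz
    rw [IsLocalRing.residue_eq_zero_iff, hϖ.maximalIdeal_eq, Ideal.mem_span_singleton] at hz
    exact hz
  obtain ⟨s, hs⟩ := hmem (3 * a ^ 2 + 2 * I.a₂ * a + I.a₄ - I.a₁ * b) (by
    simp only [reduction, map_a₁, map_a₂, map_a₄] at hP
    simp only [map_add, map_sub, map_mul, map_pow, map_ofNat]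
    linear_combination -hP)
  obtain ⟨t, ht⟩ := hmem (2 * b + I.a₁ * a + I.a₃) (by
    simp only [reduction, map_a₁, map_a₃] at hQ
    simp only [map_add, map_mul, map_ofNat]
    linear_combination hQ)
  have heq := (equation_iff _ _).1 (integralModel_equation_iff.2 h.1)
  -- Translate the point to the origin, which preserves `Δ`. Then `a₆ = 0` exactly, because the
  -- point lies on the curve, while singular reduction makes `a₃` and `a₄` divisible by `ϖ`. Every
  -- term of `Δ` is then divisible by `ϖ²`.
  have hdvd : ∃ k, I.Δ = ϖ ^ 2 * k := by
    have h1 : I.Δ = ((⟨1, a, 0, b⟩ : VariableChange R) • I).Δ := by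
      rw [variableChange_Δ]; simp
    have h3 : ((⟨1, a, 0, b⟩ : VariableChange R) • I).a₃ = ϖ * t := by
      rw [← ht, variableChange_a₃]; simp; ring
    have h4 : ((⟨1, a, 0, b⟩ : VariableChange R) • I).a₄ = ϖ * s := by
      rw [← hs, variableChange_a₄]; simp; ring
    have h6 : ((⟨1, a, 0, b⟩ : VariableChange R) • I).a₆ = 0 := by
      rw [variableChange_a₆]; simp
      linear_combination -heq
    rw [h1]
    generalize (⟨1, a, 0, b⟩ : VariableChange R) • I = V at h3 h4 h6
    rw [WeierstrassCurve.Δ, WeierstrassCurve.b₈, WeierstrassCurve.b₆, WeierstrassCurve.b₄,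
      h3, h4, h6]
    generalize V.b₂ = β
    generalize V.a₁ = α₁
    generalize V.a₂ = α₂
    exact ⟨-β ^ 2 * (-α₁ * t * s + α₂ * t ^ 2 - s ^ 2) - 8 * ϖ * (2 * s + α₁ * t) ^ 3 -
      27 * ϖ ^ 2 * t ^ 4 + 9 * β * (2 * s + α₁ * t) * ϖ * t ^ 2, by ring⟩
  obtain ⟨k, hk⟩ := hdvd
  rw [← integralModel_Δ_eq R W, ← hI, hk, map_mul, map_pow, map_mul, map_pow,
    dvrValuation_irreducible R hϖ] at hΔ
  have hk1 : dvrValuation R K (algebraMap R K k) ≤ 1 := (dvrValuation_le_one_iff R).2 ⟨k, rfl⟩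
  have := mul_le_of_le_one_right' (a := exp (-1 : ℤ) ^ 2) hk1
  rw [hΔ, ← exp_nsmul, exp_le_exp] at this
  norm_num at this

end Tamagawa

/-! ### The arithmetic of the two curves at the bad primes -/

section PadicValuation

open WeierstrassCurve.Affine WeierstrassCurve.Affine.Point
open WithZero WeierstrassCurve

variable {p : ℕ} [Fact p.Prime]

theorem dvrValuation_intCast_le_one (n : ℤ) : dvrValuation ℤ_[p] ℚ_[p] n ≤ 1 :=
  (dvrValuation_le_one_iff _).2 ⟨n, by simp⟩

theorem dvrValuation_intCast_lt_one_iff {n : ℤ} :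
    dvrValuation ℤ_[p] ℚ_[p] n < 1 ↔ (p : ℤ) ∣ n := by
  rw [← PadicInt.norm_int_lt_one_iff_dvd, ← PadicInt.mem_nonunits,
    ← IsLocalRing.mem_maximalIdeal, ← IsLocalRing.residue_eq_zero_iff,
    ← dvrValuation_lt_one_iff_residue ℤ_[p] (K := ℚ_[p])]
  simp

theorem dvrValuation_intCast_eq_one {n : ℤ} (h : ¬ (p : ℤ) ∣ n) :
    dvrValuation ℤ_[p] ℚ_[p] n = 1 :=
  le_antisymm (dvrValuation_intCast_le_one n)
    (not_lt.1 fun hlt => h (dvrValuation_intCast_lt_one_iff.1 hlt))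

theorem dvrValuation_of_squarefree {n : ℤ} (hn : Squarefree n) (h : (p : ℤ) ∣ n) :
    dvrValuation ℤ_[p] ℚ_[p] n = exp (-1 : ℤ) := by
  obtain ⟨m, rfl⟩ := h
  have hm : ¬ (p : ℤ) ∣ m := by
    rintro ⟨k, rfl⟩
    have := hn p ⟨k, by ring⟩
    rw [Int.isUnit_iff] at this
    have := (Fact.out : p.Prime).two_le
    omega
  have hp := dvrValuation_irreducible ℤ_[p] (K := ℚ_[p]) (PadicInt.irreducible_p (p := p))
  rw [map_natCast] at hp
  rw [Int.cast_mul, map_mul, dvrValuation_intCast_eq_one hm, mul_one, Int.cast_natCast, hp]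

theorem exp_le_dvrValuation_of_squarefree {n : ℤ} (hn : Squarefree n) :
    exp (-1 : ℤ) ≤ dvrValuation ℤ_[p] ℚ_[p] n := by
  by_cases h : (p : ℤ) ∣ n
  · rw [dvrValuation_of_squarefree hn h]
  · rw [dvrValuation_intCast_eq_one h, ← exp_zero, exp_le_exp]
    norm_num

end PadicValuation

/-! ### Points and partial derivatives under changes of variables. -/

section VariableChange

open WeierstrassCurve.Affine WeierstrassCurve.Affine.Point
open WeierstrassCurve

variable {F : Type*} [Field F] (W : WeierstrassCurve F) (C : VariableChange F)

theorem equation_variableChange {x y : F} (h : W.toAffine.Equation x y) :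
    (C • W).toAffine.Equation (C.u⁻¹ ^ 2 * (x - C.r))
      (C.u⁻¹ ^ 3 * (y - C.s * (x - C.r) - C.t)) := by
  rw [equation_iff] at h ⊢
  simp only [variableChange_def]
  generalize ((C.u⁻¹ : Fˣ) : F) = w
  linear_combination w ^ 6 * h

theorem two_mul_add_variableChange (x y : F) :
    2 * (C.u⁻¹ ^ 3 * (y - C.s * (x - C.r) - C.t)) + (C • W).a₁ * (C.u⁻¹ ^ 2 * (x - C.r)) +
      (C • W).a₃ = C.u⁻¹ ^ 3 * (2 * y + W.a₁ * x + W.a₃) := by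
  simp only [variableChange_def]
  ring

/-- At a point of order two the term with `C.s` vanishes, so the quantity whose valuation governs
the Tamagawa factor is only multiplied by `u⁻⁴`. This is needed because `W.minimal` is known only up
to a change of variables. -/
theorem derivative_variableChange (x y : F) :
    3 * (C.u⁻¹ ^ 2 * (x - C.r)) ^ 2 + 2 * (C • W).a₂ * (C.u⁻¹ ^ 2 * (x - C.r)) + (C • W).a₄ -
      (C • W).a₁ * (C.u⁻¹ ^ 3 * (y - C.s * (x - C.r) - C.t)) =
    C.u⁻¹ ^ 4 * (3 * x ^ 2 + 2 * W.a₂ * x + W.a₄ - W.a₁ * y -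
      C.s * (2 * y + W.a₁ * x + W.a₃)) := by
  simp only [variableChange_def]
  ring

end VariableChange

/-! ### Global minimality, bad primes and Tamagawa factors of the two curves. -/

section Curves

open WeierstrassCurve.Affine WeierstrassCurve.Affine.Point
open WithZero WeierstrassCurve

variable {u : ℤ}

theorem curveE₁_isIntegral (hu : u ≡ 1 [ZMOD 4]) (p : ℕ) [Fact p.Prime] :
    IsIntegral ℤ_[p] ((curveE₁ u).baseChange ℚ_[p]) := by
  obtain ⟨v, hv⟩ := hu.symm.dvd
  obtain rfl : u = 4 * v + 1 := by linarith
  refine ⟨⟨⟨1, v, 0, -1, 0⟩, ?_⟩⟩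
  ext <;> simp [curveE₁, WeierstrassCurve.baseChange]

theorem curveE₂_isIntegral (hu : u ≡ 1 [ZMOD 4]) (p : ℕ) [Fact p.Prime] :
    IsIntegral ℤ_[p] ((curveE₂ u).baseChange ℚ_[p]) := by
  obtain ⟨v, hv⟩ := hu.symm.dvd
  obtain rfl : u = 4 * v + 1 := by linarith
  refine ⟨⟨⟨1, v, 0, 4, 4 * v + 1⟩, ?_⟩⟩
  have h4 : ((4 : ℤ_[p]) : ℚ_[p]) = 4 := by
    simpa only [Nat.cast_ofNat] using PadicInt.coe_natCast (p := p) 4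
  ext <;> simp [curveE₂, WeierstrassCurve.baseChange, h4]

theorem curveE₁_baseChange_Δ (p : ℕ) [Fact p.Prime] :
    ((curveE₁ u).baseChange ℚ_[p]).Δ = ((u ^ 2 + 64 : ℤ) : ℚ_[p]) := by
  rw [WeierstrassCurve.baseChange, map_Δ, curveE₁_Δ]; simp

theorem curveE₂_baseChange_Δ (p : ℕ) [Fact p.Prime] :
    ((curveE₂ u).baseChange ℚ_[p]).Δ = -((u ^ 2 + 64 : ℤ) : ℚ_[p]) ^ 2 := by
  rw [WeierstrassCurve.baseChange, map_Δ, curveE₂_Δ]; simp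

theorem curveE₁_isGlobalMinimal (hu : u ≡ 1 [ZMOD 4]) (hsq : Squarefree (u ^ 2 + 64)) :
    IsGlobalMinimal (curveE₁ u) := by
  intro p _
  have := curveE₁_isIntegral hu p
  refine isMinimal_of_valuation_Δ _ _ ?_
  rw [curveE₁_baseChange_Δ]
  refine lt_of_lt_of_le ?_ (exp_le_dvrValuation_of_squarefree hsq)
  rw [exp_lt_exp]; norm_num

theorem curveE₂_isGlobalMinimal (hu : u ≡ 1 [ZMOD 4]) (hsq : Squarefree (u ^ 2 + 64)) :
    IsGlobalMinimal (curveE₂ u) := by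
  intro p _
  have := curveE₂_isIntegral hu p
  refine isMinimal_of_valuation_Δ _ _ ?_
  rw [curveE₂_baseChange_Δ, Valuation.map_neg, map_pow]
  refine lt_of_lt_of_le ?_ (pow_le_pow_left' (exp_le_dvrValuation_of_squarefree hsq) 2)
  rw [← exp_nsmul, exp_lt_exp]; norm_num

/-- Two global minimal equations are related by a change of variables with `u = ±1`. -/
theorem u_eq_one_or_of_isGlobalMinimal {W : WeierstrassCurve ℚ} (hΔ : W.Δ ≠ 0)
    (hW : IsGlobalMinimal W) {C : VariableChange ℚ} (hC : IsGlobalMinimal (C • W)) :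
    (C.u : ℚ) = 1 ∨ (C.u : ℚ) = -1 := by
  have hval : ∀ p : ℕ, p.Prime → padicValRat p (C.u : ℚ) = 0 := by
    intro p hp
    have : Fact p.Prime := ⟨hp⟩
    have h1 := hW p
    have h2 : IsMinimal ℤ_[p] (C.baseChange ℚ_[p] • W.baseChange ℚ_[p]) := by
      have := hC p
      rwa [WeierstrassCurve.baseChange, ← map_variableChange] at this
    have h3 := valuation_u_eq_one_of_isMinimal ℤ_[p] (W.baseChange ℚ_[p]) (C.baseChange ℚ_[p])
      (by rw [WeierstrassCurve.baseChange, map_Δ]; simpa using hΔ)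
    have h4 : dvrValuation ℤ_[p] ℚ_[p] ((C.u : ℚ) : ℚ_[p]) = 1 := by
      simpa [VariableChange.baseChange, VariableChange.map] using h3
    have hnorm : ∀ q : ℚ, dvrValuation ℤ_[p] ℚ_[p] (q : ℚ_[p]) ≤ 1 → padicNorm p q ≤ 1 := by
      intro q hq
      obtain ⟨a, ha⟩ := (dvrValuation_le_one_iff _).1 hq
      have := PadicInt.norm_le_one a
      rw [PadicInt.norm_def] at this
      change (a : ℚ_[p]) = _ at ha
      rw [ha, Padic.eq_padicNorm] at this
      exact_mod_cast this
    have h5 := hnorm _ h4.le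
    -- Integrality of both `u` and `u⁻¹` pins the valuation at `p` to zero; a rational number with
    -- this property at every prime is `±1`.
    have h6 := hnorm (C.u : ℚ)⁻¹ (by rw [Rat.cast_inv, map_inv₀, h4, inv_one])
    rw [padicNorm.eq_zpow_of_nonzero (by simp)] at h5 h6
    have hp1 : (1 : ℚ) < p := by exact_mod_cast hp.one_lt
    rw [zpow_le_one_iff_right₀ hp1] at h5 h6
    rw [padicValRat.inv] at h6
    omega
  have hnat : ∀ n : ℕ, n ≠ 0 → (∀ p : ℕ, p.Prime → padicValNat p n = 0) → n = 1 := by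
    intro n hn h
    by_contra h1
    obtain ⟨p, hp, hd⟩ := Nat.exists_prime_and_dvd h1
    have : Fact p.Prime := ⟨hp⟩
    have := one_le_padicValNat_of_dvd hn hd
    rw [h p hp] at this
    omega
  have hcop := (C.u : ℚ).reduced
  have hboth : ∀ p : ℕ, p.Prime → padicValNat p (C.u : ℚ).num.natAbs = 0 ∧
      padicValNat p (C.u : ℚ).den = 0 := by
    intro p hp
    have : Fact p.Prime := ⟨hp⟩
    have h := hval p hp
    rw [padicValRat_def, padicValInt] at h
    by_contra hne
    have h1 : padicValNat p (C.u : ℚ).num.natAbs ≠ 0 ∧ padicValNat p (C.u : ℚ).den ≠ 0 := by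
      omega
    have hd1 := dvd_of_one_le_padicValNat (Nat.one_le_iff_ne_zero.2 h1.1)
    have hd2 := dvd_of_one_le_padicValNat (Nat.one_le_iff_ne_zero.2 h1.2)
    have := Nat.eq_one_of_dvd_coprimes hcop hd1 hd2
    exact hp.ne_one this
  have hnum := hnat _ (by simp) fun p hp => (hboth p hp).1
  have hden := hnat _ (C.u : ℚ).den_nz fun p hp => (hboth p hp).2
  rw [Int.natAbs_eq_iff] at hnum
  rw [← Rat.num_div_den (C.u : ℚ), hden]
  rcases hnum with h | h <;> rw [h] <;> simp

theorem mem_badPrimes_curveE₁ (hu : u ≡ 1 [ZMOD 4]) (hsq : Squarefree (u ^ 2 + 64))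
    (p : Nat.Primes) : p ∈ badPrimes (curveE₁ u) ↔ ((p : ℕ) : ℤ) ∣ u ^ 2 + 64 := by
  have : Fact (p : ℕ).Prime := ⟨p.2⟩
  have := curveE₁_isGlobalMinimal hu hsq p
  rw [← dvrValuation_intCast_lt_one_iff, ← curveE₁_baseChange_Δ, ← not_hasGoodReduction_minimal_iff]
  rfl

theorem mem_badPrimes_curveE₂ (hu : u ≡ 1 [ZMOD 4]) (hsq : Squarefree (u ^ 2 + 64))
    (p : Nat.Primes) : p ∈ badPrimes (curveE₂ u) ↔ ((p : ℕ) : ℤ) ∣ u ^ 2 + 64 := by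
  have : Fact (p : ℕ).Prime := ⟨p.2⟩
  have := curveE₂_isGlobalMinimal hu hsq p
  rw [← dvrValuation_intCast_lt_one_iff, ← pow_lt_one_iff (n := 2) two_ne_zero, ← map_pow,
    ← Valuation.map_neg, ← curveE₂_baseChange_Δ, ← not_hasGoodReduction_minimal_iff]
  rfl

theorem tamagawaFactor_curveE₁ (hu : u ≡ 1 [ZMOD 4]) (hsq : Squarefree (u ^ 2 + 64))
    {p : Nat.Primes} (hp : ((p : ℕ) : ℤ) ∣ u ^ 2 + 64) : tamagawaFactor (curveE₁ u) p = 1 := by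
  have : Fact (p : ℕ).Prime := ⟨p.2⟩
  have := curveE₁_isGlobalMinimal hu hsq p
  refine index_nonsingularReductionSubgroup_eq_one ?_
  rw [valuation_minimal_Δ, curveE₁_baseChange_Δ, dvrValuation_of_squarefree hsq hp]

/-- The coordinates of a point of order two are integral if two is a unit. -/
theorem valuation_le_one_of_twoTorsion {R K : Type*} [CommRing R] [IsDomain R]
    [IsDiscreteValuationRing R] [Field K] [Algebra R K] [IsFractionRing R K]
    {W : WeierstrassCurve K} [IsMinimal R W] (h2 : dvrValuation R K 2 = 1) {e f : K}
    (h : W.toAffine.Equation e f) (hT : 2 * f + W.a₁ * e + W.a₃ = 0) :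
    dvrValuation R K e ≤ 1 ∧ dvrValuation R K f ≤ 1 := by
  set v := dvrValuation R K
  have hb₂ : v W.b₂ ≤ 1 := (dvrValuation_le_one_iff _).2 ⟨_, integralModel_b₂_eq R W⟩
  have hb₄ : v W.b₄ ≤ 1 := (dvrValuation_le_one_iff _).2 ⟨_, integralModel_b₄_eq R W⟩
  have hb₆ : v W.b₆ ≤ 1 := (dvrValuation_le_one_iff _).2 ⟨_, integralModel_b₆_eq R W⟩
  have ha₃ : v W.a₃ ≤ 1 := (dvrValuation_le_one_iff _).2 ⟨_, integralModel_a₃_eq R W⟩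
  have ha₁ : v W.a₁ ≤ 1 := dvrValuation_a₁_le
  have he : v e ≤ 1 := by
    by_contra hlt
    rw [not_le] at hlt
    rw [equation_iff] at h
    have hzero : 4 * e ^ 3 + (W.b₂ * e ^ 2 + 2 * W.b₄ * e + W.b₆) = 0 := by
      simp only [WeierstrassCurve.b₂, WeierstrassCurve.b₄, WeierstrassCurve.b₆]
      linear_combination (2 * f + W.a₁ * e + W.a₃) * hT - 4 * h
    have h4 : v (4 * e ^ 3) = v e ^ 3 := by
      rw [show (4 : K) = 2 * 2 by norm_num, map_mul, map_mul, map_pow, h2, one_mul, one_mul]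
    have h1 : v e < v e ^ 3 := lt_self_pow₀ hlt (by norm_num)
    have hrest : v (W.b₂ * e ^ 2 + 2 * W.b₄ * e + W.b₆) < v (4 * e ^ 3) := by
      rw [h4]
      refine v.map_add_lt (v.map_add_lt ?_ ?_) ?_
      · rw [map_mul, map_pow]
        exact (mul_le_of_le_one_left' hb₂).trans_lt (pow_lt_pow_right₀ hlt (by norm_num))
      · rw [map_mul, map_mul, h2, one_mul]
        exact (mul_le_of_le_one_left' hb₄).trans_lt h1
      · exact hb₆.trans_lt (hlt.trans h1)
    have := valuation_add_eq_of_lt hrest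
    rw [hzero, _root_.map_zero] at this
    exact absurd hrest (by rw [← this]; exact not_lt.2 zero_le)
  refine ⟨he, ?_⟩
  have hf : v (2 * f) ≤ 1 := by
    rw [eq_neg_of_add_eq_zero_left ((add_assoc _ _ _).symm.trans hT), Valuation.map_neg]
    refine (v.map_add _ _).trans (max_le ?_ ha₃)
    rw [map_mul]
    exact mul_le_one' ha₁ he
  rwa [map_mul, h2, one_mul] at hf

/-- At `T = (-u/4, u/8)` the quantity `3e² + 2a₂e + a₄ - a₁f` equals `(u²+64)/16`, a uniformizer
because `u²+64` is square-free and `p` is odd. The data of `T` are transported to the chosen minimal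
equation, whose scaling factor is a unit. -/
theorem localTamagawa_curveE₂ (hu : u ≡ 1 [ZMOD 4]) (hsq : Squarefree (u ^ 2 + 64))
    (p : ℕ) [Fact p.Prime] (hp : (p : ℤ) ∣ u ^ 2 + 64) :
    localTamagawa ℤ_[p] ((curveE₂ u).baseChange ℚ_[p]) = 2 := by
  have := curveE₂_isGlobalMinimal hu hsq p
  have hΔ : ((curveE₂ u).baseChange ℚ_[p]).Δ ≠ 0 := by
    rw [curveE₂_baseChange_Δ, neg_ne_zero]
    exact pow_ne_zero 2 (Int.cast_ne_zero.2 (by positivity))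
  rw [localTamagawa]
  set v := dvrValuation ℤ_[p] ℚ_[p] with hv
  obtain ⟨C, hC⟩ := exists_minimal_eq_smul ℤ_[p] ((curveE₂ u).baseChange ℚ_[p])
  set V := ((curveE₂ u).baseChange ℚ_[p]).minimal ℤ_[p] with hV
  have hu1 : v C.u = 1 := by
    have : IsMinimal ℤ_[p] (C • (curveE₂ u).baseChange ℚ_[p]) := hC ▸ inferInstance
    exact valuation_u_eq_one_of_isMinimal _ _ C hΔ
  have hp2 : ¬ (p : ℤ) ∣ 2 := by
    intro h2
    have hle := Nat.le_of_dvd (by norm_num : 0 < 2)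
      (Int.natCast_dvd_natCast.1 (by exact_mod_cast h2))
    have hp2 : p = 2 := le_antisymm hle (Fact.out : p.Prime).two_le
    rw [hp2] at hp
    have h3 : Odd (u ^ 2 + 64) := (odd_of_modEq_one hu).pow.add_even (by decide)
    exact (Int.not_even_iff_odd.2 h3) (even_iff_two_dvd.2 (by exact_mod_cast hp))
  have hv2 : v 2 = 1 := by
    have := dvrValuation_intCast_eq_one hp2
    exact_mod_cast this
  set W := (curveE₂ u).baseChange ℚ_[p] with hW
  have hT : W.toAffine.Equation (-u / 4) (u / 8) := by
    rw [equation_iff]; simp [hW, curveE₂, WeierstrassCurve.baseChange]; ring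
  have hT2 : 2 * ((u : ℚ_[p]) / 8) + W.a₁ * (-u / 4) + W.a₃ = 0 := by
    simp [hW, curveE₂, WeierstrassCurve.baseChange]; ring
  have hTd : 16 * (3 * (-u / 4 : ℚ_[p]) ^ 2 + 2 * W.a₂ * (-u / 4) + W.a₄ - W.a₁ * (u / 8)) =
      ((u ^ 2 + 64 : ℤ) : ℚ_[p]) := by
    simp [hW, curveE₂, WeierstrassCurve.baseChange]; ring
  have hT' := equation_variableChange W C hT
  have hT2' := two_mul_add_variableChange W C (-u / 4) (u / 8)
  have hTd' := derivative_variableChange W C (-u / 4) (u / 8)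
  rw [hT2, mul_zero] at hT2'
  rw [hT2, mul_zero, sub_zero] at hTd'
  rw [← hC] at hT' hT2' hTd'
  obtain ⟨hve, hvf⟩ := valuation_le_one_of_twoTorsion (R := ℤ_[p]) hv2 hT' hT2'
  obtain ⟨e, he⟩ := (dvrValuation_le_one_iff _).1 hve
  obtain ⟨f, hf⟩ := (dvrValuation_le_one_iff _).1 hvf
  rw [← he, ← hf] at hT' hT2' hTd'
  have hΔ' : V.Δ ≠ 0 := by
    rw [hC, variableChange_Δ]
    exact mul_ne_zero (pow_ne_zero _ (Units.ne_zero _)) hΔ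
  refine index_nonsingularReductionSubgroup_eq_two
    ((equation_iff_nonsingular_of_Δ_ne_zero hΔ').1 hT') hT2' ?_ hv2
  have hv16 : v 16 = 1 := by
    rw [show (16 : ℚ_[p]) = 2 ^ 4 by norm_num, map_pow, hv2, one_pow]
  have hN := dvrValuation_of_squarefree hsq hp
  rw [← hTd, map_mul, ← hv, hv16, one_mul] at hN
  rw [hTd', ← hv, map_mul, map_pow, hN, Units.val_inv_eq_inv_val, map_inv₀, hu1, inv_one,
    one_pow, one_mul]

theorem tamagawaProduct_curveE₁ (hu : u ≡ 1 [ZMOD 4]) (hsq : Squarefree (u ^ 2 + 64)) :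
    tamagawaProduct (curveE₁ u) = 1 :=
  finprod_mem_of_eqOn_one fun p hp =>
    tamagawaFactor_curveE₁ hu hsq ((mem_badPrimes_curveE₁ hu hsq p).1 hp)

/-- Square-freeness makes the `p i` distinct, so the bad primes are indexed by `Fin k` and each
contributes a factor two. -/
theorem tamagawaProduct_curveE₂ (hu : u ≡ 1 [ZMOD 4]) (hsq : Squarefree (u ^ 2 + 64))
    (k : ℕ) (p : Fin k → ℕ) (hp : ∀ i, (p i).Prime) (hprod : u ^ 2 + 64 = ∏ i, (p i : ℤ)) :
    tamagawaProduct (curveE₂ u) = 2 ^ k := by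
  have hinj : Function.Injective fun i => (⟨p i, hp i⟩ : Nat.Primes) := by
    intro i j hij
    by_contra hne
    have hij' : p i = p j := congrArg Subtype.val hij
    have hdvd : (p i : ℤ) * p i ∣ u ^ 2 + 64 := by
      rw [hprod, ← Finset.mul_prod_erase _ _ (Finset.mem_univ i)]
      refine mul_dvd_mul_left _ ?_
      conv_lhs => rw [hij']
      exact Finset.dvd_prod_of_mem (fun k => (p k : ℤ)) (Finset.mem_erase.2 ⟨Ne.symm hne,
        Finset.mem_univ j⟩)
    have := hsq _ hdvd
    rw [Int.isUnit_iff] at this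
    have := (hp i).two_le
    omega
  have hbad : badPrimes (curveE₂ u) =
      ((Finset.univ.map ⟨fun i => (⟨p i, hp i⟩ : Nat.Primes), hinj⟩ : Finset Nat.Primes) :
        Set Nat.Primes) := by
    ext q
    rw [mem_badPrimes_curveE₂ hu hsq, hprod]
    simp only [Finset.coe_map, Finset.coe_univ, Set.image_univ,
      Set.mem_range]
    constructor
    · intro h
      obtain ⟨i, -, hi⟩ := (Prime.dvd_finsetProd_iff (Nat.prime_iff_prime_int.1 q.2) _).1 h
      refine ⟨i, Subtype.ext ?_⟩
      exact ((Nat.prime_dvd_prime_iff_eq q.2 (hp i)).1 (Int.natCast_dvd_natCast.1 hi)).symm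
    · rintro ⟨i, rfl⟩
      exact Finset.dvd_prod_of_mem (fun k => (p k : ℤ)) (Finset.mem_univ i)
  have hfac : ∀ q ∈ badPrimes (curveE₂ u), tamagawaFactor (curveE₂ u) q = 2 := by
    intro q hq
    have : Fact (q : ℕ).Prime := ⟨q.2⟩
    exact localTamagawa_curveE₂ hu hsq q ((mem_badPrimes_curveE₂ hu hsq q).1 hq)
  rw [tamagawaProduct, finprod_mem_congr rfl hfac, hbad, finprod_mem_coe_finset]
  simp

end Curves

/-! ### Connected components of the real locus -/

section RealLocus

open WeierstrassCurve WeierstrassCurve.Projective Filter Topology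

variable {u : ℤ}

theorem continuous_pointClass_mk :
    Continuous fun v : Fin 3 → ℝ => (⟦v⟧ : PointClass ℝ) := continuous_quot_mk

theorem pointClass_eq_iff {v w : Fin 3 → ℝ} :
    (⟦v⟧ : PointClass ℝ) = ⟦w⟧ ↔ ∃ c : ℝ, c ≠ 0 ∧ v = c • w := by
  rw [Quotient.eq]
  constructor
  · rintro ⟨c, rfl⟩
    exact ⟨c, c.ne_zero, rfl⟩
  · rintro ⟨c, hc, rfl⟩
    exact ⟨Units.mk0 c hc, rfl⟩

/-- The image in the projective plane of a scaling-invariant open set is open. -/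
theorem isOpen_pointClass_image {A : Set (Fin 3 → ℝ)} (hA : IsOpen A)
    (hinv : ∀ v ∈ A, ∀ c : ℝ, c ≠ 0 → c • v ∈ A) :
    IsOpen ((fun v => (⟦v⟧ : PointClass ℝ)) '' A) ∧
      ∀ v, (⟦v⟧ : PointClass ℝ) ∈ (fun v => (⟦v⟧ : PointClass ℝ)) '' A ↔ v ∈ A := by
  have hmem : ∀ v, (⟦v⟧ : PointClass ℝ) ∈ (fun v => (⟦v⟧ : PointClass ℝ)) '' A ↔ v ∈ A := by
    intro v
    constructor
    · rintro ⟨w, hw, h⟩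
      obtain ⟨c, hc, rfl⟩ := pointClass_eq_iff.1 h.symm
      exact hinv w hw c hc
    · exact fun hv => ⟨v, hv, rfl⟩
  refine ⟨?_, hmem⟩
  have hq : IsQuotientMap fun v : Fin 3 → ℝ => (⟦v⟧ : PointClass ℝ) := isQuotientMap_quot_mk
  rw [← hq.isOpen_preimage]
  convert hA using 1
  ext v
  exact hmem v

theorem mem_realLocus_iff {W : WeierstrassCurve ℚ} {v : Fin 3 → ℝ} :
    (⟦v⟧ : PointClass ℝ) ∈ realLocus W ↔ (W.baseChange ℝ).toProjective.Nonsingular v :=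
  Iff.rfl

theorem zero_one_zero_mem_realLocus (W : WeierstrassCurve ℚ) :
    (⟦![0, 1, 0]⟧ : PointClass ℝ) ∈ realLocus W := nonsingular_zero

theorem some_mem_realLocus_iff {W : WeierstrassCurve ℚ} (hΔ : W.Δ ≠ 0) {x y : ℝ} :
    (⟦![x, y, 1]⟧ : PointClass ℝ) ∈ realLocus W ↔ (W.baseChange ℝ).toAffine.Equation x y := by
  rw [mem_realLocus_iff, nonsingular_some]
  refine (Affine.equation_iff_nonsingular_of_Δ_ne_zero ?_).symm
  rw [WeierstrassCurve.baseChange, map_Δ]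
  simpa using hΔ

/-- A point of the real locus is affine or the point at infinity. -/
theorem realLocus_cases {W : WeierstrassCurve ℚ} {P : PointClass ℝ} (hP : P ∈ realLocus W) :
    P = ⟦![0, 1, 0]⟧ ∨ ∃ x y : ℝ, P = ⟦![x, y, 1]⟧ := by
  induction P using Quotient.inductionOn with
  | h v =>
    rw [mem_realLocus_iff] at hP
    by_cases hz : v 2 = 0
    · exact .inl (Quotient.sound (equiv_zero_of_Z_eq_zero hP hz))
    · exact .inr ⟨_, _, Quotient.sound (equiv_some_of_Z_ne_zero hz)⟩

/-- On `(2y+x)² = x(4x²+ux-4)` there is no point with `0 < x ≤ a`, and the part `x ≤ 0` is bounded.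
The oval is separated from the rest, including the point at infinity, by two open sets. -/
theorem not_isConnected_realLocus_curveE₁ : ¬ IsConnected (realLocus (curveE₁ u)) := by
  rintro ⟨-, hpre⟩
  set m : ℝ := |(u : ℝ)| with hm
  have hm0 : 0 ≤ m := abs_nonneg _
  have hum : (u : ℝ) ≤ m := le_abs_self _
  have hum' : -m ≤ (u : ℝ) := neg_abs_le _
  -- For `0 < x ≤ a` one has `4x² + ux - 4 < 0`. The constant `B` bounds `-x` on the oval and `K`
  -- bounds `y²` there.
  set a : ℝ := 1 / (m + 4) with ha
  have ha0 : 0 < a := by positivity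
  set B : ℝ := m + 8 with hB
  set K : ℝ := B * (4 + m * B) + B ^ 2 with hK
  -- The condition `x/z < a` is multiplied by `z²`: being of even degree, it is invariant under
  -- negative scalars too. The second condition on the other set captures the point at infinity,
  -- where `z = 0`.
  obtain ⟨hU, hUm⟩ := isOpen_pointClass_image (A := {v | v 0 * v 2 < a * v 2 ^ 2})
    (isOpen_lt (by fun_prop) (by fun_prop)) (by
      intro v hv c hc
      simp only [Set.mem_ofPred_eq, Pi.smul_apply, smul_eq_mul] at hv ⊢
      have := mul_lt_mul_of_pos_left hv (by positivity : 0 < c ^ 2)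
      linarith)
  obtain ⟨hV, hVm⟩ := isOpen_pointClass_image
    (A := {v | a * v 2 ^ 2 < v 0 * v 2} ∪ {v | K * v 2 ^ 2 < v 1 ^ 2})
    ((isOpen_lt (by fun_prop) (by fun_prop)).union (isOpen_lt (by fun_prop) (by fun_prop))) (by
      intro v hv c hc
      simp only [Set.mem_union, Set.mem_ofPred_eq, Pi.smul_apply, smul_eq_mul] at hv ⊢
      refine hv.imp (fun hv => ?_) (fun hv => ?_)
      · have := mul_lt_mul_of_pos_left hv (by positivity : 0 < c ^ 2)
        linarith
      · have := mul_lt_mul_of_pos_left hv (by positivity : 0 < c ^ 2)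
        linarith)
  have heq : ∀ {x y : ℝ}, (⟦![x, y, 1]⟧ : PointClass ℝ) ∈ realLocus (curveE₁ u) →
      (2 * y + x) ^ 2 = x * (4 * x ^ 2 + u * x - 4) := by
    intro x y h
    rw [some_mem_realLocus_iff (curveE₁_Δ_ne_zero u), Affine.equation_iff] at h
    simp [curveE₁, WeierstrassCurve.baseChange] at h
    linear_combination 4 * h
  have hgap : ∀ {x y : ℝ}, (⟦![x, y, 1]⟧ : PointClass ℝ) ∈ realLocus (curveE₁ u) →
      x ≤ 0 ∨ a < x := by
    intro x y h
    by_contra hc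
    rw [not_or, not_le, not_lt] at hc
    have h1 := heq h
    have h2 : x * (m + 4) ≤ 1 := by
      have := mul_le_mul_of_nonneg_right hc.2 (by positivity : 0 ≤ m + 4)
      rwa [ha, one_div, inv_mul_cancel₀ (by positivity)] at this
    have h3 : 4 * x ^ 2 + u * x - 4 < 0 := by nlinarith
    nlinarith [sq_nonneg (2 * y + x), mul_neg_of_pos_of_neg hc.1 h3]
  have hbound : ∀ {x y : ℝ}, (⟦![x, y, 1]⟧ : PointClass ℝ) ∈ realLocus (curveE₁ u) →
      x ≤ 0 → y ^ 2 ≤ K := by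
    intro x y h hx
    have h1 := heq h
    have hxB : -x ≤ B := by
      by_contra hc
      rw [not_le] at hc
      have h3 : 0 < 4 * x ^ 2 + u * x - 4 := by nlinarith
      nlinarith [sq_nonneg (2 * y + x), mul_pos (by linarith : 0 < -x) h3]
    have h2 : (2 * y + x) ^ 2 ≤ B * (4 + m * B) := by
      rw [h1]
      have : 4 - u * x - 4 * x ^ 2 ≤ 4 + m * B := by nlinarith
      have hp : 0 ≤ 4 + m * B := by positivity
      nlinarith
    have h3 : x ^ 2 ≤ B ^ 2 := by nlinarith
    nlinarith [sq_nonneg (2 * y + 2 * x)]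
  obtain ⟨P, hP, hPU, hPV⟩ := hpre _ _ hU hV (by
      intro P hP
      rcases realLocus_cases hP with rfl | ⟨x, y, rfl⟩
      · right; rw [hVm]; right; simp
      · rcases hgap hP with h | h
        · left; rw [hUm]; simp; linarith
        · right; rw [hVm]; left; simpa using h)
    ⟨⟦![0, 0, 1]⟧, by
      rw [some_mem_realLocus_iff (curveE₁_Δ_ne_zero u), Affine.equation_iff]
      simp [curveE₁, WeierstrassCurve.baseChange], by rw [hUm]; simpa using ha0⟩
    ⟨⟦![0, 1, 0]⟧, zero_one_zero_mem_realLocus _, by rw [hVm]; right; simp⟩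
  rcases realLocus_cases hP with rfl | ⟨x, y, rfl⟩
  · rw [hUm] at hPU
    simp at hPU
  · rw [hUm] at hPU
    rw [hVm] at hPV
    simp at hPU hPV
    rcases hPV with h | h
    · linarith
    · have hx : x ≤ 0 := (hgap hP).resolve_right (by linarith)
      exact absurd h (not_lt.2 (hbound hP hx))

/-- Since `x²+4 > 0`, the equation `(2y+x)² = (4x+u)(x²+4)` is parametrized by `s = (2y+x)/√(x²+4)`,
with `s² = 4x+u`. The affine real points are thus a continuous image of `ℝ`, and the point at
infinity is in its closure. -/
theorem isConnected_realLocus_curveE₂ : IsConnected (realLocus (curveE₂ u)) := by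
  set X : ℝ → ℝ := fun s => (s ^ 2 - u) / 4 with hX
  set Y : ℝ → ℝ := fun s => (s * √(X s ^ 2 + 4) - X s) / 2 with hY
  set f : ℝ → PointClass ℝ := fun s => ⟦![X s, Y s, 1]⟧ with hf
  have hXc : Continuous X := by fun_prop
  have hYc : Continuous Y := by fun_prop
  have hfc : Continuous f := by
    refine continuous_pointClass_mk.comp (continuous_pi fun i => ?_)
    fin_cases i
    · exact hXc
    · exact hYc
    · exact continuous_const
  have hcurve : ∀ {x y : ℝ}, (⟦![x, y, 1]⟧ : PointClass ℝ) ∈ realLocus (curveE₂ u) ↔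
      (2 * y + x) ^ 2 = (4 * x + u) * (x ^ 2 + 4) := by
    intro x y
    rw [some_mem_realLocus_iff (curveE₂_Δ_ne_zero u), Affine.equation_iff]
    simp only [curveE₂, WeierstrassCurve.baseChange, map_a₁, map_a₂, map_a₃, map_a₄, map_a₆]
    simp
    constructor
    · intro h; linear_combination 4 * h
    · intro h; linear_combination h / 4
  have hXY : ∀ s, (2 * Y s + X s) ^ 2 = (4 * X s + u) * (X s ^ 2 + 4) := by
    intro s
    have h1 : 2 * Y s + X s = s * √(X s ^ 2 + 4) := by simp only [hY]; ring
    have h2 : 4 * X s + u = s ^ 2 := by simp only [hX]; ring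
    rw [h1, h2, mul_pow, Real.sq_sqrt (by positivity)]
  refine IsConnected.subset_closure (isConnected_range hfc) ?_ ?_
  · rintro _ ⟨s, rfl⟩
    exact hcurve.2 (hXY s)
  intro P hP
  rcases realLocus_cases hP with rfl | ⟨x, y, rfl⟩
  · have hlim : Tendsto (fun s : ℝ => 2 / (s - 1)) atTop (𝓝 0) :=
      Tendsto.div_atTop tendsto_const_nhds (tendsto_atTop_add_const_right _ _ tendsto_id)
    have hev : ∀ᶠ s : ℝ in atTop, 1 < s ∧ 1 ≤ X s := by
      refine (eventually_gt_atTop 1).and ?_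
      filter_upwards [eventually_ge_atTop (|(u : ℝ)| + 4)] with s hs
      have := le_abs_self (u : ℝ)
      have h0 := abs_nonneg (u : ℝ)
      simp only [hX]
      nlinarith
    have hYX : ∀ s, 1 < s → 1 ≤ X s → X s * ((s - 1) / 2) ≤ Y s := by
      intro s hs hx
      have : X s ≤ √(X s ^ 2 + 4) := Real.le_sqrt_of_sq_le (by linarith)
      simp only [hY]
      nlinarith
    have hYpos : ∀ s, 1 < s → 1 ≤ X s → 0 < Y s := fun s hs hx =>
      (mul_pos (by linarith) (by linarith)).trans_le (hYX s hs hx)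
    have hlimX : Tendsto (fun s => X s / Y s) atTop (𝓝 0) := by
      refine tendsto_of_tendsto_of_tendsto_of_le_of_le' tendsto_const_nhds hlim ?_ ?_
      · filter_upwards [hev] with s hs
        exact div_nonneg (by linarith) (hYpos s hs.1 hs.2).le
      · filter_upwards [hev] with s hs
        rw [div_le_div_iff₀ (hYpos s hs.1 hs.2) (by linarith)]
        linarith [hYX s hs.1 hs.2]
    have hlimY : Tendsto (fun s => 1 / Y s) atTop (𝓝 0) := by
      refine tendsto_of_tendsto_of_tendsto_of_le_of_le' tendsto_const_nhds hlimX ?_ ?_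
      · filter_upwards [hev] with s hs
        exact div_nonneg zero_le_one (hYpos s hs.1 hs.2).le
      · filter_upwards [hev] with s hs
        exact div_le_div_of_nonneg_right hs.2 (hYpos s hs.1 hs.2).le
    have hlimf : Tendsto (fun s => ![X s / Y s, 1, 1 / Y s]) atTop (𝓝 ![(0 : ℝ), 1, 0]) := by
      rw [tendsto_pi_nhds]
      intro i
      fin_cases i
      · exact hlimX
      · exact tendsto_const_nhds
      · exact hlimY
    -- The representatives rescaled by `1/Y` converge to `(0, 1, 0)` as `s → ∞`.
    refine mem_closure_of_tendsto ((continuous_pointClass_mk.tendsto _).comp hlimf) ?_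
    filter_upwards [hev] with s hs
    have h0 := (hYpos s hs.1 hs.2).ne'
    refine ⟨s, pointClass_eq_iff.2 ⟨Y s, h0, ?_⟩⟩
    ext i
    fin_cases i <;> simp <;> field_simp
  · refine subset_closure ⟨(2 * y + x) / √(x ^ 2 + 4), ?_⟩
    have h := hcurve.1 hP
    have hpos : (0 : ℝ) < x ^ 2 + 4 := by positivity
    have hXs : X ((2 * y + x) / √(x ^ 2 + 4)) = x := by
      simp only [hX]
      rw [div_pow, Real.sq_sqrt hpos.le, h]
      field_simp
      ring
    have hYs : Y ((2 * y + x) / √(x ^ 2 + 4)) = y := by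
      simp only [hY]
      rw [hXs, div_mul_cancel₀ _ (Real.sqrt_pos.2 hpos).ne']
      ring
    simp only [hf, hXs, hYs]

end RealLocus

/-! ### Periods and changes of variables -/

section Periods

open WeierstrassCurve Set

theorem cubicGradient_apply (W : WeierstrassCurve ℂ) (v : Fin 3 → ℂ) :
    cubicGradient W v = ![W.a₁ * v 1 * v 2 - (3 * v 0 ^ 2 + 2 * W.a₂ * v 0 * v 2 + W.a₄ * v 2 ^ 2),
      2 * v 1 * v 2 + W.a₁ * v 0 * v 2 + W.a₃ * v 2 ^ 2,
      v 1 ^ 2 + W.a₁ * v 0 * v 1 + 2 * W.a₃ * v 1 * v 2 -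
        (W.a₂ * v 0 ^ 2 + 2 * W.a₄ * v 0 * v 2 + 3 * W.a₆ * v 2 ^ 2)] := by
  rw [cubicGradient, Projective.eval_polynomialX, Projective.eval_polynomialY,
    Projective.eval_polynomialZ]

theorem projective_equation_iff (W : WeierstrassCurve ℂ) (v : Fin 3 → ℂ) :
    W.toProjective.Equation v ↔
      v 1 ^ 2 * v 2 + W.a₁ * v 0 * v 1 * v 2 + W.a₃ * v 1 * v 2 ^ 2 =
        v 0 ^ 3 + W.a₂ * v 0 ^ 2 * v 2 + W.a₄ * v 0 * v 2 ^ 2 + W.a₆ * v 2 ^ 3 :=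
  (Projective.equation_iff v).trans sub_eq_zero

/-- The linear map on homogeneous coordinates induced by a change of variables. -/
noncomputable def variableChangeMap (C : VariableChange ℂ) : (Fin 3 → ℂ) →L[ℂ] (Fin 3 → ℂ) :=
  (Matrix.mulVecLin !![(C.u⁻¹ : ℂ) ^ 2, 0, -(C.u⁻¹ : ℂ) ^ 2 * C.r;
    -(C.u⁻¹ : ℂ) ^ 3 * C.s, (C.u⁻¹ : ℂ) ^ 3, (C.u⁻¹ : ℂ) ^ 3 * (C.s * C.r - C.t);
    0, 0, 1]).toContinuousLinearMap

theorem variableChangeMap_apply (C : VariableChange ℂ) (v : Fin 3 → ℂ) :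
    variableChangeMap C v = ![(C.u⁻¹ : ℂ) ^ 2 * (v 0 - C.r * v 2),
      (C.u⁻¹ : ℂ) ^ 3 * (v 1 - C.s * (v 0 - C.r * v 2) - C.t * v 2), v 2] := by
  ext i
  fin_cases i <;> simp [variableChangeMap, Matrix.mulVec, dotProduct, Fin.sum_univ_three] <;> ring

theorem variableChangeMap_ne_zero (C : VariableChange ℂ) {v : Fin 3 → ℂ} (hv : v ≠ 0) :
    variableChangeMap C v ≠ 0 := by
  intro h
  apply hv
  rw [variableChangeMap_apply] at h
  have h0 := congrFun h 0
  have h1 := congrFun h 1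
  have h2 := congrFun h 2
  simp at h0 h1 h2
  rw [h2] at h0 h1
  have h0' : v 0 = 0 := by simpa using h0
  rw [h0'] at h1
  ext i
  fin_cases i
  · exact h0'
  · simpa using h1
  · exact h2

/-- The induced linear map on homogeneous coordinates carries the lifted path to the new cubic, and
the invariant differential is multiplied by `C.u`. -/
theorem IsPeriod.variableChange {W : WeierstrassCurve ℂ} {z : ℂ} (h : IsPeriod W z)
    (C : VariableChange ℂ) : IsPeriod (C • W) (C.u * z) := by
  obtain ⟨γ, c, hγ, hc, hcl, hpt, hz⟩ := h
  refine ⟨fun t => variableChangeMap C (γ t), fun t => C.u * c t,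
    ((variableChangeMap C).restrictScalars ℝ).contDiff.comp_contDiffOn hγ,
    continuousOn_const.mul hc, by simp only [hcl], fun t ht => ?_, ?_⟩
  · obtain ⟨h0, heq, hcross⟩ := hpt t ht
    have hd : HasDerivWithinAt γ (derivWithin γ (Icc 0 1) t) (Icc 0 1) t :=
      (hγ.differentiableOn one_ne_zero t ht).hasDerivWithinAt
    have hd' : derivWithin (fun t => variableChangeMap C (γ t)) (Icc 0 1) t =
        variableChangeMap C (derivWithin γ (Icc 0 1) t) :=
      (((variableChangeMap C).restrictScalars ℝ).hasFDerivAt.comp_hasDerivWithinAt t hd).derivWithin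
        (uniqueDiffOn_Icc zero_lt_one t ht)
    refine ⟨variableChangeMap_ne_zero C h0, ?_, ?_⟩
    · rw [projective_equation_iff] at heq ⊢
      beta_reduce
      rw [variableChangeMap_apply]
      simp only [variableChange_def, Matrix.cons_val, Units.val_inv_eq_inv_val]
      generalize (C.u : ℂ)⁻¹ = w
      linear_combination w ^ 6 * heq
    · rw [hd']
      beta_reduce
      generalize derivWithin γ (Icc 0 1) t = d at *
      generalize γ t = v at *
      rw [cubicGradient_apply, cross_apply] at hcross
      have e0 := congrFun hcross 0
      have e1 := congrFun hcross 1
      have e2 := congrFun hcross 2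
      simp only [Matrix.cons_val, Pi.smul_apply, smul_eq_mul] at e0 e1 e2
      rw [cubicGradient_apply, cross_apply, variableChangeMap_apply, variableChangeMap_apply]
      have hu : (C.u : ℂ) ≠ 0 := C.u.ne_zero
      ext i
      fin_cases i
      · simp only [variableChange_def, Matrix.cons_val, Units.val_inv_eq_inv_val,
          Pi.smul_apply, smul_eq_mul, Fin.zero_eta]
        field_simp
        linear_combination e0 + C.s * e1
      · simp only [variableChange_def, Matrix.cons_val, Units.val_inv_eq_inv_val,
          Pi.smul_apply, smul_eq_mul, Fin.mk_one]
        field_simp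
        linear_combination e1
      · simp only [variableChange_def, Matrix.cons_val, Units.val_inv_eq_inv_val,
          Pi.smul_apply, smul_eq_mul, Fin.reduceFinMk]
        field_simp
        linear_combination e2 + C.r * e0 + C.t * e1
  · rw [hz, intervalIntegral.integral_const_mul]

/-- The automorphism `P ↦ -P` is a change of variables with `u = -1` that fixes the equation. -/
theorem IsPeriod.neg {W : WeierstrassCurve ℂ} {z : ℂ} (h : IsPeriod W z) : IsPeriod W (-z) := by
  have := h.variableChange ⟨-1, 0, -W.a₁, -W.a₃⟩
  convert this using 1
  · ext <;> simp [variableChange_def] <;> ring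
  · simp

theorem isPeriod_smul_iff {W : WeierstrassCurve ℂ} {C : VariableChange ℂ}
    (hC : (C.u : ℂ) = 1 ∨ (C.u : ℂ) = -1) {z : ℂ} : IsPeriod (C • W) z ↔ IsPeriod W z := by
  constructor
  · intro h
    have h1 := h.variableChange C⁻¹
    rw [inv_smul_smul] at h1
    rcases hC with hC | hC <;> simp [VariableChange.inv_def, hC] at h1
    · exact h1
    · simpa using h1.neg
  · intro h
    have h1 := h.variableChange C
    rcases hC with hC | hC <;> simp [hC] at h1
    · exact h1
    · simpa using h1.neg

theorem positiveRealPeriods_eq {W : WeierstrassCurve ℚ} (hΔ : W.Δ ≠ 0) (hW : IsGlobalMinimal W) :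
    positiveRealPeriods W = {T : ℝ | 0 < T ∧ IsPeriod (W.baseChange ℂ) T} := by
  ext T
  simp only [positiveRealPeriods, mem_ofPred_eq, and_congr_right_iff]
  intro _
  constructor
  · rintro ⟨C, hC, h⟩
    rw [WeierstrassCurve.baseChange, ← map_variableChange] at h
    refine (isPeriod_smul_iff ?_).1 h
    rcases u_eq_one_or_of_isGlobalMinimal hΔ hW hC with hu | hu <;>
      simp [VariableChange.map, hu]
  · intro h
    exact ⟨1, by rwa [one_smul], by rwa [one_smul]⟩

end Periods

/-! ### Rigidity of paths along which the invariant differential is prescribed -/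

section Rigidity

open Set Filter Topology

theorem smul_eq_smul_of_cross_eq_zero {a b : Fin 3 → ℂ} (h : a ⨯₃ b = 0) (i : Fin 3) :
    b i • a = a i • b := by
  rw [cross_apply] at h
  have e0 := congrFun h 0
  have e1 := congrFun h 1
  have e2 := congrFun h 2
  simp only [Matrix.cons_val, Pi.zero_apply] at e0 e1 e2
  ext j
  fin_cases i <;> fin_cases j <;>
    simp only [Fin.zero_eta, Fin.mk_one, Fin.reduceFinMk, Pi.smul_apply, smul_eq_mul] <;> grind

theorem cross_eq_zero_comm {a b : Fin 3 → ℂ} (h : a ⨯₃ b = 0) : b ⨯₃ a = 0 := by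
  rw [← cross_anticomm, h, neg_zero]

/-- A vanishing cross product of nonzero vectors expresses equality of projective points, so paths
can be compared without choosing compatible lifts. -/
theorem cross_eq_zero_trans {a b c : Fin 3 → ℂ} (hb : b ≠ 0) (hab : a ⨯₃ b = 0)
    (hbc : b ⨯₃ c = 0) : a ⨯₃ c = 0 := by
  obtain ⟨i, hi⟩ := Function.ne_iff.1 hb
  have h : b i • (a ⨯₃ c) = 0 := by
    rw [← LinearMap.smul_apply, ← map_smul, smul_eq_smul_of_cross_eq_zero hab i, map_smul,
      LinearMap.smul_apply, hbc, smul_zero]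
  exact (smul_eq_zero.1 h).resolve_left hi

/-- The vector field governing the dehomogenisation at the coordinate `i` of a path on the
Weierstrass cubic. -/
noncomputable def affineField (W : WeierstrassCurve ℂ) (i : Fin 3) (v : Fin 3 → ℂ) : Fin 3 → ℂ :=
  -((Pi.single i 1 : Fin 3 → ℂ) ⨯₃ cubicGradient W v)

theorem cubicGradient_smul (W : WeierstrassCurve ℂ) (r : ℂ) (v : Fin 3 → ℂ) :
    cubicGradient W (r • v) = r ^ 2 • cubicGradient W v := by
  rw [cubicGradient_apply, cubicGradient_apply]
  ext j
  fin_cases j <;>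
    simp only [Fin.zero_eta, Fin.mk_one, Fin.reduceFinMk, Pi.smul_apply, smul_eq_mul,
      Matrix.cons_val] <;> ring

theorem contDiff_affineField (W : WeierstrassCurve ℂ) (i : Fin 3) :
    ContDiff ℝ 1 (affineField W i) := by
  have h : ContDiff ℝ 1 (cubicGradient W) := by
    rw [contDiff_pi]
    intro j
    simp only [cubicGradient_apply]
    fin_cases j <;> simp only [Fin.zero_eta, Fin.mk_one, Fin.reduceFinMk, Matrix.cons_val] <;>
      fun_prop
  exact (((crossProduct (Pi.single i 1 : Fin 3 → ℂ)).restrictScalars ℝ).toContinuousLinearMap.contDiff.comp h).neg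

/-- By the triple product formula, `e_i × (a × a') = a'_i a - a_i a'`, which is `-a_i²` times the
derivative of `a / a_i`. As the gradient is homogeneous of degree two, the factors `a_i²` cancel and
the equation in the chart no longer depends on the lift. -/
theorem hasDerivWithinAt_dehomogenize {W : WeierstrassCurve ℂ} {a : ℝ → Fin 3 → ℂ}
    {a' : Fin 3 → ℂ} {c : ℂ} {s : Set ℝ} {t : ℝ} (ha : HasDerivWithinAt a a' s t)
    (hc : a t ⨯₃ a' = c • cubicGradient W (a t)) {i : Fin 3} (hi : a t i ≠ 0) :
    HasDerivWithinAt (fun τ => (a τ i)⁻¹ • a τ) (c • affineField W i ((a t i)⁻¹ • a t)) s t := by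
  have hai : HasDerivWithinAt (fun τ => a τ i) (a' i) s t := (hasDerivWithinAt_pi.1 ha) i
  refine ((hai.inv hi).smul ha).congr_deriv ?_
  have h := cross_cross_eq_smul_sub_smul' (Pi.single i 1 : Fin 3 → ℂ) (a t) a'
  rw [hc, map_smul, single_one_dotProduct, dotProduct_single_one] at h
  have hG : affineField W i ((a t i)⁻¹ • a t) =
      -((a t i)⁻¹ ^ 2 • (Pi.single i 1 : Fin 3 → ℂ) ⨯₃ cubicGradient W (a t)) := by
    rw [affineField, cubicGradient_smul, map_smul]
  rw [hG, smul_neg, smul_comm, h]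
  ext j
  simp only [Pi.neg_apply, Pi.smul_apply, Pi.sub_apply, Pi.add_apply, Pi.inv_apply, smul_eq_mul]
  field_simp
  ring

/-- Local uniqueness for `x' = c(t) G(x)`: near `t₀` the field is Lipschitz with constant `(‖c t₀‖ +
1) K`. Agreement to the right is what a continuation argument on `[0, 1]` requires. -/
theorem eventuallyEq_of_hasDerivWithinAt {E : Type*} [NormedAddCommGroup E] [NormedSpace ℝ E]
    [NormedSpace ℂ E] {G : E → E} (hG : ContDiff ℝ 1 G) {c : ℝ → ℂ} {t₀ : ℝ}
    (ht₀ : t₀ ∈ Ico (0 : ℝ) 1) (hc : ContinuousOn c (Icc 0 1)) {g h : ℝ → E}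
    (hg : ∀ᶠ t in 𝓝[Icc 0 1] t₀, HasDerivWithinAt g (c t • G (g t)) (Icc 0 1) t)
    (hh : ∀ᶠ t in 𝓝[Icc 0 1] t₀, HasDerivWithinAt h (c t • G (h t)) (Icc 0 1) t)
    (hgh : g t₀ = h t₀) : ∀ᶠ t in 𝓝[≥] t₀, g t = h t := by
  have ht₀' : t₀ ∈ Icc (0 : ℝ) 1 := Ico_subset_Icc_self ht₀
  obtain ⟨K, s, hs, hK⟩ := hG.contDiffAt.exists_lipschitzOnWith (x := g t₀)
  have hgc : ContinuousWithinAt g (Icc 0 1) t₀ := (hg.self_of_nhdsWithin ht₀').continuousWithinAt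
  have hhc : ContinuousWithinAt h (Icc 0 1) t₀ := (hh.self_of_nhdsWithin ht₀').continuousWithinAt
  have hcb : ∀ᶠ t in 𝓝[Icc 0 1] t₀, ‖c t‖₊ < ‖c t₀‖₊ + 1 :=
    (hc t₀ ht₀').nnnorm.eventually_lt_const (lt_add_one _)
  have hall : ∀ᶠ t in 𝓝[Icc 0 1] t₀, t ∈ Icc (0 : ℝ) 1 ∧
      HasDerivWithinAt g (c t • G (g t)) (Icc 0 1) t ∧
      HasDerivWithinAt h (c t • G (h t)) (Icc 0 1) t ∧ g t ∈ s ∧ h t ∈ s ∧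
      ‖c t‖₊ < ‖c t₀‖₊ + 1 := by
    filter_upwards [self_mem_nhdsWithin, hg, hh, hgc.eventually_mem hs,
      hhc.eventually_mem (hgh ▸ hs), hcb] with t h1 h2 h3 h4 h5 h6
    exact ⟨h1, h2, h3, h4, h5, h6⟩
  have hle : 𝓝[≥] t₀ ≤ 𝓝[Icc 0 1] t₀ :=
    nhdsWithin_le_of_mem (Icc_mem_nhdsGE_of_mem ht₀)
  obtain ⟨b, hb, hsub⟩ := mem_nhdsGE_iff_exists_Icc_subset.1 (hle hall)
  have hb1 : b ≤ 1 := (hsub (right_mem_Icc.2 hb.le)).1.2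
  have hIcc : Icc t₀ b ⊆ Icc 0 1 := Icc_subset_Icc ht₀.1 hb1
  have hmem : ∀ t ∈ Ico t₀ b, Icc (0 : ℝ) 1 ∈ 𝓝[≥] t := fun t ht =>
    Icc_mem_nhdsGE_of_mem ⟨ht₀.1.trans ht.1, ht.2.trans_le hb1⟩
  have := ODE_solution_unique_of_mem_Icc_right (a := t₀) (b := b) (v := fun t x => c t • G x)
    (K := (‖c t₀‖₊ + 1) * K) (s := fun _ => s) (f := g) (g := h) ?_
    (fun t ht => (hsub ht).2.1.continuousWithinAt.mono hIcc)
    (fun t ht => (hsub (Ico_subset_Icc_self ht)).2.1.mono_of_mem_nhdsWithin (hmem t ht))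
    (fun t ht => (hsub (Ico_subset_Icc_self ht)).2.2.2.1)
    (fun t ht => (hsub ht).2.2.1.continuousWithinAt.mono hIcc)
    (fun t ht => (hsub (Ico_subset_Icc_self ht)).2.2.1.mono_of_mem_nhdsWithin (hmem t ht))
    (fun t ht => (hsub (Ico_subset_Icc_self ht)).2.2.2.2.1) hgh
  · exact mem_of_superset (Icc_mem_nhdsGE hb) this
  · intro t ht
    rw [lipschitzOnWith_iff_norm_sub_le] at hK ⊢
    intro x hx y hy
    rw [← smul_sub, norm_smul, NNReal.coe_mul, mul_assoc]
    have hct : ‖c t‖ ≤ ((‖c t₀‖₊ + 1 : NNReal) : ℝ) :=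
      NNReal.coe_le_coe.2 (hsub (Ico_subset_Icc_self ht)).2.2.2.2.2.le
    exact mul_le_mul hct (hK hx hy) (norm_nonneg _) (NNReal.coe_nonneg _)

/-- `A` is a path on the projective curve `W(ℂ)`, given by homogeneous coordinates, that pulls the
invariant differential back to `c(t) dt`. -/
def IsPullbackPath (W : WeierstrassCurve ℂ) (c : ℝ → ℂ) (A : ℝ → Fin 3 → ℂ) : Prop :=
  ∀ t₀ ∈ Icc (0 : ℝ) 1, ∃ a a' : ℝ → Fin 3 → ℂ, ∀ᶠ t in 𝓝[Icc 0 1] t₀,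
    A t ≠ 0 ∧ a t ≠ 0 ∧ A t ⨯₃ a t = 0 ∧ HasDerivWithinAt a (a' t) (Icc 0 1) t ∧
      a t ⨯₃ a' t = c t • cubicGradient W (a t)

/-- In a common affine chart both paths solve the same differential equation. The set of times where
they agree is closed in `[0, 1]` and extends to the right of each of its points, so it is
everything. -/
theorem IsPullbackPath.cross_eq_zero {W : WeierstrassCurve ℂ} {c : ℝ → ℂ} {A B : ℝ → Fin 3 → ℂ}
    (hA : IsPullbackPath W c A) (hB : IsPullbackPath W c B) (hc : ContinuousOn c (Icc 0 1))
    (h0 : A 0 ⨯₃ B 0 = 0) : ∀ t ∈ Icc (0 : ℝ) 1, A t ⨯₃ B t = 0 := by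
  have key : ∀ t₀ ∈ Icc (0 : ℝ) 1, ∀ a b : ℝ → Fin 3 → ℂ,
      (∀ᶠ t in 𝓝[Icc 0 1] t₀, A t ≠ 0 ∧ a t ≠ 0 ∧ A t ⨯₃ a t = 0) →
      (∀ᶠ t in 𝓝[Icc 0 1] t₀, B t ≠ 0 ∧ b t ≠ 0 ∧ B t ⨯₃ b t = 0) →
      ∀ᶠ t in 𝓝[Icc 0 1] t₀, A t ⨯₃ B t = 0 ↔ a t ⨯₃ b t = 0 := by
    intro t₀ _ a b ha hb
    filter_upwards [ha, hb] with t ⟨hA0, ha0, hAa⟩ ⟨hB0, hb0, hBb⟩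
    exact ⟨fun h => cross_eq_zero_trans hA0 (cross_eq_zero_comm hAa)
        (cross_eq_zero_trans hB0 h hBb),
      fun h => cross_eq_zero_trans ha0 hAa (cross_eq_zero_trans hb0 h (cross_eq_zero_comm hBb))⟩
  refine IsClosed.Icc_subset_of_forall_exists_gt (s := {t | A t ⨯₃ B t = 0}) ?_ h0 ?_
  · refine isClosed_of_closure_subset fun t₀ ht₀ => ?_
    have ht₀I : t₀ ∈ Icc (0 : ℝ) 1 :=
      isClosed_Icc.closure_subset (closure_mono inter_subset_right ht₀)
    refine ⟨?_, ht₀I⟩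
    obtain ⟨a, a', ha⟩ := hA t₀ ht₀I
    obtain ⟨b, b', hb⟩ := hB t₀ ht₀I
    have hk := key t₀ ht₀I a b (ha.mono fun t h => ⟨h.1, h.2.1, h.2.2.1⟩)
      (hb.mono fun t h => ⟨h.1, h.2.1, h.2.2.1⟩)
    rw [mem_ofPred_eq, hk.self_of_nhdsWithin ht₀I]
    have hac := (ha.self_of_nhdsWithin ht₀I).2.2.2.1.continuousWithinAt
    have hbc := (hb.self_of_nhdsWithin ht₀I).2.2.2.1.continuousWithinAt
    have hcont : ContinuousWithinAt (fun t => a t ⨯₃ b t) (Icc 0 1) t₀ := by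
      rw [continuousWithinAt_pi] at hac hbc ⊢
      intro i
      simp only [cross_apply]
      fin_cases i <;> simp only [Fin.zero_eta, Fin.mk_one, Fin.reduceFinMk, Matrix.cons_val] <;>
        exact ((hac _).mul (hbc _)).sub ((hac _).mul (hbc _))
    have hne : (𝓝[{t | A t ⨯₃ B t = 0} ∩ Icc 0 1] t₀).NeBot :=
      mem_closure_iff_nhdsWithin_neBot.1 ht₀
    refine tendsto_nhds_unique (l := 𝓝[{t | A t ⨯₃ B t = 0} ∩ Icc 0 1] t₀)
      (hcont.mono_left (nhdsWithin_mono _ inter_subset_right))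
      (tendsto_const_nhds.congr' ?_)
    filter_upwards [self_mem_nhdsWithin, nhdsWithin_mono _ inter_subset_right hk] with t h1 h2
    exact (h2.1 h1.1).symm
  · rintro t₀ ⟨h, ht₀⟩ y hy
    have ht₀I : t₀ ∈ Icc (0 : ℝ) 1 := Ico_subset_Icc_self ht₀
    obtain ⟨a, a', ha⟩ := hA t₀ ht₀I
    obtain ⟨b, b', hb⟩ := hB t₀ ht₀I
    have hk := key t₀ ht₀I a b (ha.mono fun t h => ⟨h.1, h.2.1, h.2.2.1⟩)
      (hb.mono fun t h => ⟨h.1, h.2.1, h.2.2.1⟩)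
    have hab := (hk.self_of_nhdsWithin ht₀I).1 h
    obtain ⟨-, ha0, -, had, -⟩ := ha.self_of_nhdsWithin ht₀I
    obtain ⟨-, hb0, -, hbd, -⟩ := hb.self_of_nhdsWithin ht₀I
    obtain ⟨i, hi⟩ := Function.ne_iff.1 ha0
    have hbi : b t₀ i ≠ 0 := by
      intro hbi
      have := smul_eq_smul_of_cross_eq_zero hab i
      rw [hbi, zero_smul] at this
      exact (smul_ne_zero hi hb0) this.symm
    have hae : ∀ᶠ t in 𝓝[Icc 0 1] t₀, a t i ≠ 0 :=
      ((continuousWithinAt_pi.1 had.continuousWithinAt) i).eventually_ne hi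
    have hbe : ∀ᶠ t in 𝓝[Icc 0 1] t₀, b t i ≠ 0 :=
      ((continuousWithinAt_pi.1 hbd.continuousWithinAt) i).eventually_ne hbi
    have heq := eventuallyEq_of_hasDerivWithinAt (contDiff_affineField W i) ht₀ hc
      (g := fun τ => (a τ i)⁻¹ • a τ) (h := fun τ => (b τ i)⁻¹ • b τ)
      (by
        filter_upwards [ha, hae] with t h1 h2
        exact hasDerivWithinAt_dehomogenize h1.2.2.2.1 h1.2.2.2.2 h2)
      (by
        filter_upwards [hb, hbe] with t h1 h2
        exact hasDerivWithinAt_dehomogenize h1.2.2.2.1 h1.2.2.2.2 h2)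
      (by
        have := smul_eq_smul_of_cross_eq_zero hab i
        rw [inv_smul_eq_iff₀ hi, smul_comm, ← this, inv_smul_smul₀ hbi])
    have hle : 𝓝[≥] t₀ ≤ 𝓝[Icc 0 1] t₀ := nhdsWithin_le_of_mem (Icc_mem_nhdsGE_of_mem ht₀)
    have hfin : ∀ᶠ t in 𝓝[≥] t₀, A t ⨯₃ B t = 0 := by
      filter_upwards [heq, hle hk, hle hae, hle hbe] with t h1 h2 h3 h4
      rw [h2]
      have h5 : a t = (a t i * (b t i)⁻¹) • b t := by
        rw [mul_smul, ← h1, smul_inv_smul₀ h3]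
      rw [h5, map_smul, LinearMap.smul_apply, cross_self, smul_zero]
    have hgt : ∀ᶠ t in 𝓝[>] t₀, A t ⨯₃ B t = 0 ∧ t ∈ Ioc t₀ y :=
      (hfin.filter_mono (nhdsWithin_mono _ Ioi_subset_Ici_self)).and (Ioc_mem_nhdsGT hy)
    exact hgt.exists

end Rigidity

/-! ### Uniformization of a Weierstrass cubic by elliptic functions -/

section Uniformization

open Set Filter Topology

/-- The function `f`, with set of poles `P`, is the `x`-coordinate of a uniformization of the
Weierstrass cubic `W(ℂ)` by `ℂ` with respect to the invariant differential. -/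
structure IsUniformization (W : WeierstrassCurve ℂ) (f : ℂ → ℂ) (P : Set ℂ) : Prop where
  isClosed : IsClosed P
  zero_mem : (0 : ℂ) ∈ P
  analyticAt : ∀ z ∉ P, AnalyticAt ℂ f z
  deriv_sq : ∀ z ∉ P, deriv f z ^ 2 = 4 * f z ^ 3 + W.b₂ * f z ^ 2 + 2 * W.b₄ * f z + W.b₆
  deriv_deriv : ∀ z ∉ P, deriv (deriv f) z = 6 * f z ^ 2 + W.b₂ * f z + W.b₄
  pole : ∀ p ∈ P, ∃ φ : ℂ → ℂ, AnalyticAt ℂ φ p ∧ φ p = 1 ∧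
    ∀ᶠ z in 𝓝[≠] p, z ∉ P ∧ f z = φ z / (z - p) ^ 2
  map_neg : ∀ z, f (-z) = f z
  neg_mem : ∀ z ∈ P, -z ∈ P
  exists_eq : ∀ a, ∃ z ∉ P, f z = a

open scoped Classical in
/-- The uniformizing map, in homogeneous coordinates. -/
noncomputable def uniformizingMap (W : WeierstrassCurve ℂ) (f : ℂ → ℂ) (P : Set ℂ) (z : ℂ) :
    Fin 3 → ℂ :=
  if z ∈ P then ![0, 1, 0] else ![f z, (deriv f z - W.a₁ * f z - W.a₃) / 2, 1]

variable {W : WeierstrassCurve ℂ} {f : ℂ → ℂ} {P : Set ℂ}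

theorem uniformizingMap_of_mem {z : ℂ} (hz : z ∈ P) : uniformizingMap W f P z = ![0, 1, 0] :=
  if_pos hz

theorem uniformizingMap_of_notMem {z : ℂ} (hz : z ∉ P) :
    uniformizingMap W f P z = ![f z, (deriv f z - W.a₁ * f z - W.a₃) / 2, 1] :=
  if_neg hz

theorem uniformizingMap_ne_zero (z : ℂ) : uniformizingMap W f P z ≠ 0 := by
  by_cases hz : z ∈ P
  · rw [uniformizingMap_of_mem hz]
    exact fun h => one_ne_zero (congrFun h 1)
  · rw [uniformizingMap_of_notMem hz]
    exact fun h => one_ne_zero (congrFun h 2)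

namespace IsUniformization

theorem hasDerivAt_affine (h : IsUniformization W f P) {z : ℂ} (hz : z ∉ P) :
    HasDerivAt (fun z => ![f z, (deriv f z - W.a₁ * f z - W.a₃) / 2, 1])
      ![deriv f z, (deriv (deriv f) z - W.a₁ * deriv f z) / 2, 0] z := by
  have h1 := (h.analyticAt z hz).differentiableAt.hasDerivAt
  have h2 := (h.analyticAt z hz).deriv.differentiableAt.hasDerivAt
  rw [hasDerivAt_pi]
  intro i
  fin_cases i
  · exact h1
  · exact ((h2.sub (h1.const_mul W.a₁)).sub_const W.a₃).div_const 2
  · exact hasDerivAt_const z 1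

theorem cross_affine (h : IsUniformization W f P) {z : ℂ} (hz : z ∉ P) :
    ![f z, (deriv f z - W.a₁ * f z - W.a₃) / 2, 1] ⨯₃
        ![deriv f z, (deriv (deriv f) z - W.a₁ * deriv f z) / 2, 0] =
      cubicGradient W ![f z, (deriv f z - W.a₁ * f z - W.a₃) / 2, 1] := by
  have h1 := h.deriv_sq z hz
  have h2 := h.deriv_deriv z hz
  rw [WeierstrassCurve.b₂, WeierstrassCurve.b₄] at h2
  rw [WeierstrassCurve.b₂, WeierstrassCurve.b₄, WeierstrassCurve.b₆] at h1
  rw [cubicGradient_apply, cross_apply]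
  ext i
  fin_cases i <;> simp only [Fin.zero_eta, Fin.mk_one, Fin.reduceFinMk, Matrix.cons_val]
  · linear_combination -h2 / 2
  · ring
  · linear_combination f z * h2 / 2 - 3 / 4 * h1

theorem equation_affine (h : IsUniformization W f P) {z : ℂ} (hz : z ∉ P) :
    W.toProjective.Equation ![f z, (deriv f z - W.a₁ * f z - W.a₃) / 2, 1] := by
  have h1 := h.deriv_sq z hz
  rw [WeierstrassCurve.b₂, WeierstrassCurve.b₄, WeierstrassCurve.b₆] at h1
  rw [projective_equation_iff]
  simp only [Matrix.cons_val]
  linear_combination h1 / 4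

theorem exists_lift_of_notMem (h : IsUniformization W f P) {p : ℂ} (hp : p ∉ P) :
    ∃ a a' : ℂ → Fin 3 → ℂ, ∀ᶠ z in 𝓝 p, a z ≠ 0 ∧ uniformizingMap W f P z ⨯₃ a z = 0 ∧
      HasDerivAt a (a' z) z ∧ a z ⨯₃ a' z = cubicGradient W (a z) := by
  refine ⟨fun z => ![f z, (deriv f z - W.a₁ * f z - W.a₃) / 2, 1],
    fun z => ![deriv f z, (deriv (deriv f) z - W.a₁ * deriv f z) / 2, 0], ?_⟩
  filter_upwards [h.isClosed.isOpen_compl.mem_nhds hp] with z hz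
  refine ⟨?_, ?_, h.hasDerivAt_affine hz, h.cross_affine hz⟩
  · exact fun h => one_ne_zero (congrFun h 2)
  · rw [uniformizingMap_of_notMem hz, cross_self]

/-- Near a pole, `f = φ/(z-p)²` and the homogeneous coordinates are multiplied by `(z-p)³`. This
gives a holomorphic lift whose value at `p` is `(0, -1, 0)`. -/
theorem exists_lift_of_mem (h : IsUniformization W f P) {p : ℂ} (hp : p ∈ P) :
    ∃ a a' : ℂ → Fin 3 → ℂ, ∀ᶠ z in 𝓝 p, a z ≠ 0 ∧ uniformizingMap W f P z ⨯₃ a z = 0 ∧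
      HasDerivAt a (a' z) z ∧ a z ⨯₃ a' z = cubicGradient W (a z) := by
  obtain ⟨φ, hφ, hφp, hev⟩ := h.pole p hp
  refine ⟨fun z => ![(z - p) * φ z, ((z - p) * deriv φ z - 2 * φ z - W.a₁ * ((z - p) * φ z) -
      W.a₃ * (z - p) ^ 3) / 2, (z - p) ^ 3],
    fun z => ![φ z + (z - p) * deriv φ z, (deriv φ z + (z - p) * deriv (deriv φ) z - 2 * deriv φ z
      - W.a₁ * (φ z + (z - p) * deriv φ z) - W.a₃ * (3 * (z - p) ^ 2)) / 2, 3 * (z - p) ^ 2], ?_⟩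
  have hev' := eventually_eventually_nhdsWithin.2 hev
  rw [eventually_nhdsWithin_iff] at hev hev'
  filter_upwards [hev, hev', hφ.eventually_analyticAt, hφ.continuousAt.eventually_ne
    (hφp.trans_ne one_ne_zero)] with z hz hz' hφz hne
  have d1 := hφz.differentiableAt.hasDerivAt
  have d2 := hφz.deriv.differentiableAt.hasDerivAt
  have hδ : HasDerivAt (fun z => z - p) 1 z := (hasDerivAt_id z).sub_const p
  -- the differential equation, with denominators cleared
  have hode : ((z - p) * deriv φ z - 2 * φ z) ^ 2 = 4 * φ z ^ 3 + W.b₂ * (z - p) ^ 2 * φ z ^ 2 +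
        2 * W.b₄ * (z - p) ^ 4 * φ z + W.b₆ * (z - p) ^ 6 ∧
      (z - p) ^ 2 * deriv (deriv φ) z - 4 * (z - p) * deriv φ z + 6 * φ z =
        6 * φ z ^ 2 + W.b₂ * (z - p) ^ 2 * φ z + W.b₄ * (z - p) ^ 4 := by
    -- At the pole itself both equations reduce to `φ(p) = 1`; elsewhere they are those of `f`
    -- multiplied by powers of `z - p`.
    rcases eq_or_ne z p with rfl | hzp
    · simp [hφp]
      norm_num
    · obtain ⟨hzP, hfz⟩ := hz hzp
      have hzp' : z - p ≠ 0 := sub_ne_zero.2 hzp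
      have hnhds : ∀ᶠ w in 𝓝 z, w ≠ p ∧ f w = φ w / (w - p) ^ 2 ∧ AnalyticAt ℂ φ w := by
        have h1 := hz' hzp
        rw [isOpen_compl_singleton.nhdsWithin_eq hzp] at h1
        filter_upwards [h1, isOpen_ne.mem_nhds hzp, hφz.eventually_analyticAt] with w h1 h2 h3
        exact ⟨h2, h1.2, h3⟩
      have hder : ∀ w, w ≠ p → AnalyticAt ℂ φ w → HasDerivAt (fun w => φ w / (w - p) ^ 2)
          (deriv φ w / (w - p) ^ 2 - 2 * φ w / (w - p) ^ 3) w := by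
        intro w hw hφw
        have hw' : w - p ≠ 0 := sub_ne_zero.2 hw
        have := hφw.differentiableAt.hasDerivAt.div (((hasDerivAt_id w).sub_const p).pow 2)
          (pow_ne_zero 2 hw')
        refine this.congr_deriv ?_
        simp only [id, Pi.pow_apply]
        field_simp
        push_cast
        ring
      have hfe : f =ᶠ[𝓝 z] fun w => φ w / (w - p) ^ 2 := hnhds.mono fun w hw => hw.2.1
      have hf'e : deriv f =ᶠ[𝓝 z] fun w => deriv φ w / (w - p) ^ 2 - 2 * φ w / (w - p) ^ 3 := by
        filter_upwards [hfe.eventuallyEq_nhds, hnhds] with w hw hw'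
        rw [hw.deriv_eq, (hder w hw'.1 hw'.2.2).deriv]
      have hf'' : deriv (deriv f) z = deriv (deriv φ) z / (z - p) ^ 2 -
          4 * deriv φ z / (z - p) ^ 3 + 6 * φ z / (z - p) ^ 4 := by
        rw [hf'e.deriv_eq]
        have := (d2.div (hδ.pow 2) (pow_ne_zero 2 hzp')).sub
          ((d1.const_mul 2).div (hδ.pow 3) (pow_ne_zero 3 hzp'))
        refine (this.congr_deriv ?_).deriv
        simp only [Pi.pow_apply]
        field_simp
        push_cast
        ring
      have e1 := h.deriv_sq z hzP
      have e2 := h.deriv_deriv z hzP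
      rw [hf'', hfz] at e2
      rw [hf'e.self_of_nhds, hfz] at e1
      field_simp at e1 e2
      constructor
      · linear_combination e1
      · linear_combination e2
  obtain ⟨e1, e2⟩ := hode
  rw [WeierstrassCurve.b₂, WeierstrassCurve.b₄] at e2
  rw [WeierstrassCurve.b₂, WeierstrassCurve.b₄, WeierstrassCurve.b₆] at e1
  refine ⟨?_, ?_, ?_, ?_⟩
  · intro h0
    have h2 := congrFun h0 2
    have h1 := congrFun h0 1
    simp only [Matrix.cons_val, Pi.zero_apply] at h1 h2
    have h3 : z - p = 0 := pow_eq_zero_iff three_ne_zero |>.1 h2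
    rw [h3] at h1
    exact hne (by linear_combination -h1)
  · rcases eq_or_ne z p with rfl | hzp
    · rw [uniformizingMap_of_mem hp, cross_apply]
      ext i
      fin_cases i <;> simp
    · obtain ⟨hzP, hfz⟩ := hz hzp
      have hzp' : z - p ≠ 0 := sub_ne_zero.2 hzp
      have hfe : f =ᶠ[𝓝 z] fun w => φ w / (w - p) ^ 2 := by
        have h1 := hz' hzp
        rw [isOpen_compl_singleton.nhdsWithin_eq hzp] at h1
        exact h1.mono fun w hw => hw.2
      have hf' : deriv f z = deriv φ z / (z - p) ^ 2 - 2 * φ z / (z - p) ^ 3 := by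
        rw [hfe.deriv_eq]
        refine ((d1.div (hδ.pow 2) (pow_ne_zero 2 hzp')).congr_deriv ?_).deriv
        simp only [Pi.pow_apply]
        field_simp
        push_cast
        ring
      rw [uniformizingMap_of_notMem hzP, hf', hfz, cross_apply]
      ext i
      fin_cases i <;> simp only [Fin.zero_eta, Fin.mk_one, Fin.reduceFinMk, Matrix.cons_val,
        Pi.zero_apply] <;> field_simp <;> ring
  · rw [hasDerivAt_pi]
    intro i
    fin_cases i
    · exact (hδ.mul d1).congr_deriv (by simp only [Fin.zero_eta, Matrix.cons_val]; ring)
    · exact (((((hδ.mul d2).sub (d1.const_mul 2)).sub ((hδ.mul d1).const_mul W.a₁)).sub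
        ((hδ.pow 3).const_mul W.a₃)).div_const 2).congr_deriv (by push_cast; ring)
    · exact (hδ.pow 3).congr_deriv (by push_cast; ring)
  · rw [cubicGradient_apply, cross_apply]
    generalize z - p = δ at *
    ext i
    fin_cases i <;> simp only [Fin.zero_eta, Fin.mk_one, Fin.reduceFinMk, Matrix.cons_val]
    · linear_combination -δ ^ 2 * e2 / 2
    · ring
    · linear_combination φ z * e2 / 2 - 3 / 4 * e1

theorem isPullbackPath_comp (h : IsUniformization W f P) {c ζ : ℝ → ℂ}
    (hζ : ∀ t ∈ Icc (0 : ℝ) 1, HasDerivWithinAt ζ (c t) (Icc 0 1) t) :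
    IsPullbackPath W c fun t => uniformizingMap W f P (ζ t) := by
  intro t₀ ht₀
  obtain ⟨a, a', ha⟩ : ∃ a a' : ℂ → Fin 3 → ℂ, ∀ᶠ z in 𝓝 (ζ t₀), a z ≠ 0 ∧
      uniformizingMap W f P z ⨯₃ a z = 0 ∧
      HasDerivAt a (a' z) z ∧ a z ⨯₃ a' z = cubicGradient W (a z) := by
    by_cases hp : ζ t₀ ∈ P
    · exact h.exists_lift_of_mem hp
    · exact h.exists_lift_of_notMem hp
  refine ⟨fun t => a (ζ t), fun t => c t • a' (ζ t), ?_⟩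
  filter_upwards [(hζ t₀ ht₀).continuousWithinAt.eventually ha, self_mem_nhdsWithin]
    with t ⟨h1, h2, h3, h4⟩ ht
  refine ⟨uniformizingMap_ne_zero _, h1, h2, h3.scomp_hasDerivWithinAt t (hζ t ht), ?_⟩
  rw [map_smul, h4]

/-- The images of the segments from `z + T` to `T` and from `z` to `0` start at the same point and
carry the same differential `-z dt`. By rigidity they end at the same point, and `0` is sent to the
point at infinity. -/
theorem mem_of_cross_eq_zero (h : IsUniformization W f P) {z T : ℂ}
    (hzT : uniformizingMap W f P (z + T) ⨯₃ uniformizingMap W f P z = 0) : T ∈ P := by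
  have hd : ∀ w : ℂ, ∀ t ∈ Icc (0 : ℝ) 1,
      HasDerivWithinAt (fun t : ℝ => w - t * z) (-z) (Icc 0 1) t := fun w t _ => by
    have := ((Complex.ofRealCLM.hasDerivAt (x := t)).mul_const z).const_sub w
    exact (this.congr_deriv (by simp)).hasDerivWithinAt
  have key := (h.isPullbackPath_comp (hd (z + T))).cross_eq_zero (h.isPullbackPath_comp (hd z))
    continuousOn_const (by simpa using hzT) 1 (right_mem_Icc.2 zero_le_one)
  by_contra hT
  simp only [Complex.ofReal_one, one_mul, sub_self, add_sub_cancel_left] at key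
  rw [uniformizingMap_of_notMem hT, uniformizingMap_of_mem h.zero_mem, cross_apply] at key
  simpa using congrFun key 0

/-- Surjectivity: `f` takes every finite value, and `z` and `-z` give the two ordinates above it
because `f'` is odd. -/
theorem exists_cross_eq_zero (h : IsUniformization W f P) {v : Fin 3 → ℂ}
    (hv : W.toProjective.Equation v) : ∃ z, uniformizingMap W f P z ⨯₃ v = 0 := by
  rw [projective_equation_iff] at hv
  by_cases h2 : v 2 = 0
  · have h0 : v 0 = 0 := by
      rw [h2] at hv
      exact (pow_eq_zero_iff three_ne_zero).1 (by linear_combination -hv)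
    refine ⟨0, ?_⟩
    rw [uniformizingMap_of_mem h.zero_mem, cross_apply, h0, h2]
    ext i
    fin_cases i <;> simp
  obtain ⟨z, hz, hfz⟩ := h.exists_eq (v 0 / v 2)
  have hz' : -z ∉ P := fun hm => hz (by simpa using h.neg_mem _ hm)
  have hneg : deriv f (-z) = -deriv f z := by
    have := deriv_comp_neg f z
    simp only [h.map_neg] at this
    rw [this, neg_neg]
  have hsq := h.deriv_sq z hz
  rw [WeierstrassCurve.b₂, WeierstrassCurve.b₄, WeierstrassCurve.b₆, hfz] at hsq
  have hfac : (deriv f z - (2 * v 1 + W.a₁ * v 0 + W.a₃ * v 2) / v 2) *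
      (deriv f z + (2 * v 1 + W.a₁ * v 0 + W.a₃ * v 2) / v 2) = 0 := by
    field_simp at hsq ⊢
    rw [mul_zero]
    refine (mul_eq_zero.1 (?_ : v 2 * _ = 0)).resolve_left h2
    linear_combination hsq - 4 * hv
  rcases mul_eq_zero.1 hfac with h1 | h1
  · refine ⟨z, ?_⟩
    rw [uniformizingMap_of_notMem hz, cross_apply, hfz, sub_eq_zero.1 h1]
    ext i
    fin_cases i <;> simp only [Fin.zero_eta, Fin.mk_one, Fin.reduceFinMk, Matrix.cons_val,
        Pi.zero_apply] <;> field_simp <;> ring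
  · refine ⟨-z, ?_⟩
    rw [uniformizingMap_of_notMem hz', cross_apply, hneg, h.map_neg, hfz,
      eq_neg_of_add_eq_zero_left h1]
    ext i
    fin_cases i <;> simp only [Fin.zero_eta, Fin.mk_one, Fin.reduceFinMk, Matrix.cons_val,
        Pi.zero_apply] <;> field_simp <;> ring

/-- The closed path lifts to `ζ(t) = z₀ + ∫₀ᵗ c`, because its image under the uniformizing map has
the same differential and the same start. Closedness then says that `z₀` and `z₀ + T` have the same
image. -/
theorem mem_of_isPeriod (h : IsUniformization W f P) {T : ℂ} (hT : IsPeriod W T) : T ∈ P := by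
  obtain ⟨γ, c, hγ, hc, hcl, hpt, rfl⟩ := hT
  obtain ⟨z₀, hz₀⟩ := h.exists_cross_eq_zero (hpt 0 (left_mem_Icc.2 zero_le_one)).2.1
  -- Extending `c` continuously to `ℝ` makes the fundamental theorem of calculus available at the
  -- endpoints.
  let d : ℝ → ℂ := IccExtend zero_le_one ((Icc (0 : ℝ) 1).domRestrict c)
  have hd : Continuous d := (continuousOn_iff_continuous_domRestrict.1 hc).Icc_extend'
  have hdc : ∀ t ∈ Icc (0 : ℝ) 1, d t = c t := fun t ht => IccExtend_of_mem _ _ ht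
  have hζ : ∀ t ∈ Icc (0 : ℝ) 1,
      HasDerivWithinAt (fun t => z₀ + ∫ s in (0 : ℝ)..t, d s) (c t) (Icc 0 1) t := fun t ht => by
    rw [← hdc t ht]
    exact ((intervalIntegral.integral_hasDerivAt_right (hd.intervalIntegrable _ _)
      hd.aestronglyMeasurable.stronglyMeasurableAtFilter hd.continuousAt).const_add
        z₀).hasDerivWithinAt
  have hγp : IsPullbackPath W c γ := fun t₀ _ => by
    refine ⟨γ, derivWithin γ (Icc 0 1), ?_⟩
    filter_upwards [self_mem_nhdsWithin] with t ht
    obtain ⟨h0, -, h1⟩ := hpt t ht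
    exact ⟨h0, h0, cross_self _, (hγ.differentiableOn one_ne_zero t ht).hasDerivWithinAt, h1⟩
  have key := (h.isPullbackPath_comp hζ).cross_eq_zero hγp hc (by simpa using hz₀) 1
    (right_mem_Icc.2 zero_le_one)
  rw [← hcl] at key
  have hint : ∫ s in (0 : ℝ)..1, d s = ∫ s in (0 : ℝ)..1, c s :=
    intervalIntegral.integral_congr fun t ht => hdc t (by rwa [uIcc_of_le zero_le_one] at ht)
  refine h.mem_of_cross_eq_zero (z := z₀) ?_
  rw [← hint]
  exact cross_eq_zero_trans (hpt 0 (left_mem_Icc.2 zero_le_one)).1 key (cross_eq_zero_comm hz₀)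

theorem countable (h : IsUniformization W f P) : P.Countable := by
  have : DiscreteTopology P := by
    refine discreteTopology_subtype_iff.2 fun p hp => ?_
    obtain ⟨φ, -, -, hev⟩ := h.pole p hp
    rw [inf_principal_eq_bot]
    filter_upwards [hev] with z hz using hz.1
  exact countable_of_Lindelof_of_discrete

/-- Poles are countable, so some horizontal line avoids them all. A segment of length `|T|` on it
maps to a closed affine path with constant differential `T dt`. -/
theorem isPeriod_of_periodic (h : IsUniformization W f P) {T : ℝ} (hfT : ∀ z, f (z + T) = f z) :
    IsPeriod W T := by
  obtain ⟨y, hy⟩ : ∃ y : ℝ, y ∉ Complex.im '' P := by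
    by_contra! hall
    exact not_countable_univ ((h.countable.image Complex.im).mono fun y _ => hall y)
  have hP : ∀ t : ℝ, (y * Complex.I + t * T : ℂ) ∉ P := fun t ht => hy ⟨_, ht, by simp⟩
  have hf'T : deriv f (y * Complex.I + T) = deriv f (y * Complex.I) := by
    rw [← deriv_comp_add_const]
    simp only [hfT]
  have hd : ∀ t : ℝ, HasDerivAt (fun t : ℝ => (y * Complex.I + t * T : ℂ)) T t := fun t => by
    have := ((Complex.ofRealCLM.hasDerivAt (x := t)).mul_const (T : ℂ)).const_add
      (y * Complex.I : ℂ)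
    exact this.congr_deriv (by simp)
  refine ⟨fun t => ![f (y * Complex.I + t * T), (deriv f (y * Complex.I + t * T) -
      W.a₁ * f (y * Complex.I + t * T) - W.a₃) / 2, 1], fun _ => T, ?_, continuousOn_const, ?_,
      fun t ht => ⟨?_, h.equation_affine (hP t), ?_⟩, by simp⟩
  · have hline : ContDiff ℝ 1 fun t : ℝ => (y * Complex.I + t * T : ℂ) :=
      contDiff_const.add (Complex.ofRealCLM.contDiff.mul contDiff_const)
    have h1 : ContDiffOn ℝ 1 (fun t : ℝ => f (y * Complex.I + t * T)) (Icc 0 1) := fun t _ =>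
      ((h.analyticAt _ (hP t)).contDiffAt.restrict_scalars ℝ).comp_contDiffWithinAt t
        hline.contDiffWithinAt
    have h2 : ContDiffOn ℝ 1 (fun t : ℝ => deriv f (y * Complex.I + t * T)) (Icc 0 1) := fun t _ =>
      ContDiffAt.comp_contDiffWithinAt (g := deriv f) t
        ((h.analyticAt _ (hP t)).deriv.contDiffAt.restrict_scalars ℝ) hline.contDiffWithinAt
    rw [contDiffOn_pi]
    intro i
    fin_cases i
    · exact h1
    · exact ((h2.sub (contDiffOn_const.mul h1)).sub contDiffOn_const).div_const 2
    · exact contDiffOn_const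
  · simp [hf'T, hfT]
  · exact fun h => one_ne_zero (congrFun h 2)
  · refine (congrArg _ (((h.hasDerivAt_affine (hP t)).scomp t (hd t)).hasDerivWithinAt.derivWithin
      (uniqueDiffOn_Icc zero_lt_one t ht))).trans ?_
    exact (map_smul _ _ _).trans (congrArg _ (h.cross_affine (hP t)))

end IsUniformization

end Uniformization

/-! ### Uniformizations of the two curves -/

section TwoIsogeny

open Set Filter Topology

theorem AnalyticAt.exists_eventuallyEq_sq_mul {f : ℂ → ℂ} {p : ℂ} (hf : AnalyticAt ℂ f p)
    (h0 : f p = 0) (h1 : deriv f p = 0) : ∃ g : ℂ → ℂ, AnalyticAt ℂ g p ∧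
      2 * g p = deriv (deriv f) p ∧ ∀ᶠ z in 𝓝 p, f z = (z - p) ^ 2 * g z := by
  have hord : ((2 : ℕ) : ℕ∞) ≤ analyticOrderAt f p := by
    rw [natCast_le_analyticOrderAt_iff_iteratedDeriv_eq_zero hf]
    intro i hi
    interval_cases i
    · simpa using h0
    · simpa using h1
  obtain ⟨g, hg, hfg⟩ := (natCast_le_analyticOrderAt hf).1 hord
  simp only [smul_eq_mul] at hfg
  refine ⟨g, hg, ?_, hfg⟩
  have hδ : ∀ z, HasDerivAt (fun z => (z - p) ^ 2) (2 * (z - p)) z := fun z => by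
    simpa using ((hasDerivAt_id z).sub_const p).fun_pow 2
  have hf' : deriv f =ᶠ[𝓝 p] fun z => 2 * (z - p) * g z + (z - p) ^ 2 * deriv g z := by
    filter_upwards [hfg.eventually_nhds, hg.eventually_analyticAt] with z h1 h2
    rw [EventuallyEq.deriv_eq (f := fun z => (z - p) ^ 2 * g z) h1]
    exact ((hδ z).mul h2.differentiableAt.hasDerivAt).deriv
  rw [hf'.deriv_eq]
  have h2 : HasDerivAt (fun z : ℂ => 2 * (z - p)) 2 p := by
    simpa using ((hasDerivAt_id p).sub_const p).const_mul 2
  refine (((h2.mul hg.differentiableAt.hasDerivAt).add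
    ((hδ p).mul hg.deriv.differentiableAt.hasDerivAt)).deriv.trans ?_).symm
  simp

theorem curveE₁_baseChange_b (u : ℤ) : ((curveE₁ u).baseChange ℂ).b₂ = u ∧
    ((curveE₁ u).baseChange ℂ).b₄ = -2 ∧ ((curveE₁ u).baseChange ℂ).b₆ = 0 := by
  refine ⟨?_, ?_, ?_⟩ <;>
    simp [WeierstrassCurve.b₂, WeierstrassCurve.b₄, WeierstrassCurve.b₆, WeierstrassCurve.baseChange,
      WeierstrassCurve.map, curveE₁]
  ring

theorem curveE₂_baseChange_b (u : ℤ) : ((curveE₂ u).baseChange ℂ).b₂ = u ∧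
    ((curveE₂ u).baseChange ℂ).b₄ = 8 ∧ ((curveE₂ u).baseChange ℂ).b₆ = 4 * u := by
  refine ⟨?_, ?_, ?_⟩ <;>
    simp [WeierstrassCurve.b₂, WeierstrassCurve.b₄, WeierstrassCurve.b₆, WeierstrassCurve.baseChange,
      WeierstrassCurve.map, curveE₂] <;> ring

/-- The map `x ↦ x - 1/x` comes from the 2-isogeny with kernel `{O, (0,0)}`, which pulls the
invariant differential of E₂ back to that of E₁. The new poles are the zeros of `f`; there `f' = 0`
and `f'' = -2`, so `-1/f` has leading term `1/(z-p)²`. -/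
theorem IsUniformization.sub_inv {u : ℤ} {f : ℂ → ℂ} {P : Set ℂ}
    (h : IsUniformization ((curveE₁ u).baseChange ℂ) f P) :
    IsUniformization ((curveE₂ u).baseChange ℂ) (fun z => f z - (f z)⁻¹) (P ∪ f ⁻¹' {0}) := by
  obtain ⟨b2, b4, b6⟩ := curveE₁_baseChange_b u
  have hode1 := h.deriv_sq
  have hode2 := h.deriv_deriv
  simp only [b2, b4, b6] at hode1 hode2
  have hsub : ∀ z ∉ P ∪ f ⁻¹' {0}, z ∉ P ∧ f z ≠ 0 := fun z hz =>
    ⟨fun hp => hz (Or.inl hp), fun h0 => hz (Or.inr h0)⟩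
  have hopen : ∀ z ∉ P ∪ f ⁻¹' {0}, ∀ᶠ w in 𝓝 z, w ∉ P ∪ f ⁻¹' {0} := by
    intro z hz
    obtain ⟨hzP, hz0⟩ := hsub z hz
    filter_upwards [h.isClosed.isOpen_compl.mem_nhds hzP,
      (h.analyticAt z hzP).continuousAt.eventually_ne hz0] with w h1 h2 h3
    exact h3.elim h1 h2
  have hder : ∀ z ∉ P ∪ f ⁻¹' {0},
      HasDerivAt (fun z => f z - (f z)⁻¹) (deriv f z * (1 + (f z ^ 2)⁻¹)) z := by
    intro z hz
    obtain ⟨hzP, hz0⟩ := hsub z hz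
    have h1 := (h.analyticAt z hzP).differentiableAt.hasDerivAt
    refine (h1.sub (h1.inv hz0)).congr_deriv ?_
    field_simp
    ring
  refine ⟨?_, Or.inl h.zero_mem, ?_, ?_, ?_, ?_, ?_, ?_, ?_⟩
  · exact isOpen_compl_iff.1 (isOpen_iff_mem_nhds.2 hopen)
  · intro z hz
    obtain ⟨hzP, hz0⟩ := hsub z hz
    exact (h.analyticAt z hzP).sub ((h.analyticAt z hzP).inv hz0)
  · intro z hz
    obtain ⟨hzP, hz0⟩ := hsub z hz
    obtain ⟨c2, c4, c6⟩ := curveE₂_baseChange_b u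
    rw [(hder z hz).deriv, c2, c4, c6, mul_pow, hode1 z hzP]
    field_simp
    ring
  · intro z hz
    obtain ⟨hzP, hz0⟩ := hsub z hz
    obtain ⟨c2, c4, c6⟩ := curveE₂_baseChange_b u
    have he : deriv (fun z => f z - (f z)⁻¹) =ᶠ[𝓝 z]
        fun z => deriv f z * (1 + (f z ^ 2)⁻¹) := by
      filter_upwards [hopen z hz] with w hw
      exact (hder w hw).deriv
    have h1 := (h.analyticAt z hzP).differentiableAt.hasDerivAt
    have h2 := (h.analyticAt z hzP).deriv.differentiableAt.hasDerivAt
    have h3 := h2.mul (((h1.pow 2).inv (pow_ne_zero 2 hz0)).const_add 1)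
    have h4 : deriv (deriv fun z => f z - (f z)⁻¹) z =
        deriv (deriv f) z * (1 + (f z ^ 2)⁻¹) - 2 * deriv f z ^ 2 * (f z ^ 3)⁻¹ := by
      rw [he.deriv_eq]
      refine (h3.congr_deriv ?_).deriv
      simp only [Pi.inv_apply, Pi.pow_apply]
      field_simp
      push_cast
      ring
    rw [h4, hode2 z hzP, hode1 z hzP, c2, c4]
    field_simp
    ring
  · intro p hp
    by_cases hpP : p ∈ P
    · obtain ⟨φ, hφ, hφp, hev⟩ := h.pole p hpP
      have hne := hφ.continuousAt.eventually_ne (hφp.trans_ne one_ne_zero)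
      refine ⟨fun z => φ z - (z - p) ^ 4 * (φ z)⁻¹,
        hφ.sub (((analyticAt_id.sub analyticAt_const).pow 4).mul (hφ.inv (by simp [hφp]))),
        by simp [hφp], ?_⟩
      filter_upwards [hev, hne.filter_mono nhdsWithin_le_nhds, self_mem_nhdsWithin]
        with z ⟨h1, h2⟩ h3 h4
      have h5 : z - p ≠ 0 := sub_ne_zero.2 h4
      have h6 : f z ≠ 0 := by
        rw [h2]
        positivity
      refine ⟨fun h7 => h7.elim h1 h6, ?_⟩
      rw [h2]
      field_simp
    · have h0 : f p = 0 := hp.resolve_left hpP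
      have h1 : deriv f p = 0 := by
        have := hode1 p hpP
        rw [h0] at this
        exact pow_eq_zero_iff two_ne_zero |>.1 (by linear_combination this)
      have h2 := hode2 p hpP
      rw [h0] at h2
      obtain ⟨g, hg, hgp, hfg⟩ := (h.analyticAt p hpP).exists_eventuallyEq_sq_mul h0 h1
      have hgp' : g p = -1 := by linear_combination (hgp + h2) / 2
      have hne := hg.continuousAt.eventually_ne (hgp'.trans_ne (neg_ne_zero.2 one_ne_zero))
      refine ⟨fun z => (z - p) ^ 4 * g z - (g z)⁻¹,
        (((analyticAt_id.sub analyticAt_const).pow 4).mul hg).sub (hg.inv (by simp [hgp'])),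
        by simp [hgp'], ?_⟩
      filter_upwards [hfg.filter_mono nhdsWithin_le_nhds, hne.filter_mono nhdsWithin_le_nhds,
        self_mem_nhdsWithin, nhdsWithin_le_nhds (h.isClosed.isOpen_compl.mem_nhds hpP)]
        with z h2 h3 h4 h1
      have h5 : z - p ≠ 0 := sub_ne_zero.2 h4
      have h6 : f z ≠ 0 := by
        rw [h2]
        positivity
      refine ⟨fun h7 => h7.elim h1 h6, ?_⟩
      rw [h2]
      field_simp
  · intro z
    simp only [h.map_neg]
  · rintro z (hz | hz)
    · exact Or.inl (h.neg_mem z hz)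
    · exact Or.inr ((h.map_neg z).trans hz)
  · intro a
    -- The equation `x - 1/x = a` has the root `x = (a+s)/2`, which is nonzero because `(a+s)(s-a) =
    -- 4`.
    obtain ⟨s, hs⟩ := IsAlgClosed.exists_pow_nat_eq (a ^ 2 + 4) two_pos
    obtain ⟨z, hz, hfz⟩ := h.exists_eq ((a + s) / 2)
    have hne : (a + s) / 2 ≠ 0 := by
      intro h0
      have : (a + s) * (s - a) = 4 := by linear_combination hs
      rw [(div_eq_zero_iff.1 h0).resolve_right two_ne_zero, zero_mul] at this
      norm_num at this
    refine ⟨z, fun h7 => h7.elim hz fun h0 => hne (hfz.symm.trans h0), ?_⟩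
    have hne' : a + s ≠ 0 := fun h0 => hne (by rw [h0, zero_div])
    simp only [hfz]
    field_simp
    linear_combination hs

/-- All zeros of `f` are sent to the same point `(0, 0)`, where `f'` vanishes as well. -/
theorem IsUniformization.sub_mem_of_apply_eq_zero {u : ℤ} {f : ℂ → ℂ} {P : Set ℂ}
    (h : IsUniformization ((curveE₁ u).baseChange ℂ) f P) {w z : ℂ} (hw : w ∉ P) (hfw : f w = 0)
    (hz : z ∉ P) (hfz : f z = 0) : z - w ∈ P := by
  obtain ⟨b2, b4, b6⟩ := curveE₁_baseChange_b u
  have hode1 := h.deriv_sq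
  simp only [b2, b4, b6] at hode1
  have hd : ∀ z ∉ P, f z = 0 → deriv f z = 0 := fun z hz h0 => by
    have := hode1 z hz
    rw [h0] at this
    exact pow_eq_zero_iff two_ne_zero |>.1 (by linear_combination this)
  refine h.mem_of_cross_eq_zero (z := w) ?_
  rw [add_sub_cancel, uniformizingMap_of_notMem hz, uniformizingMap_of_notMem hw, hfw, hfz,
    hd w hw hfw, hd z hz hfz, cross_self]

end TwoIsogeny

/-! ### Series of hyperbolic functions attached to rectangular lattices -/

section HyperbolicSeries

open Set Filter Topology Real UpperHalfPlane

theorem Complex.sin_pi_mul_ne_zero {z : ℂ} (hz : z.im ≠ 0) : Complex.sin (π * z) ≠ 0 := by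
  intro h
  obtain ⟨k, hk⟩ := Complex.sin_eq_zero_iff.1 h
  have hπ : (π : ℂ) ≠ 0 := Complex.ofReal_ne_zero.2 pi_ne_zero
  have hzk : z = k := mul_left_cancel₀ hπ (hk.trans (mul_comm _ _))
  exact hz (by rw [hzk, Complex.intCast_im])

/-- This is the derivative of the partial fraction expansion of `π cot(πz)`. -/
theorem hasSum_one_div_add_int_sq {z : ℂ} (hz : 0 < z.im) :
    HasSum (fun n : ℤ => 1 / (z + n) ^ 2) (π ^ 2 / Complex.sin (π * z) ^ 2) := by
  have hs : Summable fun n : ℤ => 1 / (z + n) ^ 2 := by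
    simpa [one_div] using EisensteinSeries.linear_right_summable z 1 (k := 2) le_rfl
  have h := iteratedDerivWithin_cot_pi_mul_eq_mul_tsum_div_pow (k := 1) le_rfl
    (show z ∈ upperHalfPlaneSet from hz)
  have hsin := Complex.sin_pi_mul_ne_zero hz.ne'
  have hlin : HasDerivAt (fun x : ℂ => (π : ℂ) * x) π z := by
    simpa using (hasDerivAt_id z).const_mul (π : ℂ)
  have hd : HasDerivAt (fun x : ℂ => π * Complex.cot (π * x))
      (-(π ^ 2 / Complex.sin (π * z) ^ 2)) z := by
    simp only [Complex.cot_eq_cos_div_sin]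
    refine ((((Complex.hasDerivAt_cos _).comp z hlin).div ((Complex.hasDerivAt_sin _).comp z hlin)
      hsin).const_mul (π : ℂ)).congr_deriv ?_
    simp only [Function.comp_apply]
    field_simp
    linear_combination -(Complex.sin_sq_add_cos_sq (π * z))
  rw [iteratedDerivWithin_one, derivWithin_of_isOpen isOpen_upperHalfPlaneSet hz, hd.deriv] at h
  have h2 : π ^ 2 / Complex.sin (π * z) ^ 2 = ∑' n : ℤ, 1 / (z + n) ^ 2 := by
    simpa using h
  rw [h2]
  exact hs.hasSum

theorem hasSum_one_div_sub_int_sq {z : ℂ} (hz : z.im ≠ 0) :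
    HasSum (fun n : ℤ => 1 / (z - n) ^ 2) (π ^ 2 / Complex.sin (π * z) ^ 2) := by
  rcases hz.lt_or_gt with hz | hz
  · have := hasSum_one_div_add_int_sq (z := -z) (by simpa using hz)
    rw [mul_neg, Complex.sin_neg, neg_sq] at this
    have e : (fun n : ℤ => 1 / (z - n) ^ 2) = fun n : ℤ => 1 / (-z + n) ^ 2 :=
      funext fun n => by rw [← neg_sq (z - n)]; congr 2; ring
    rw [e]
    exact this
  · have := (Equiv.neg ℤ).hasSum_iff.2 (hasSum_one_div_add_int_sq hz)
    have e : (fun n : ℤ => 1 / (z - n) ^ 2) = (fun n : ℤ => 1 / (z + n) ^ 2) ∘ Equiv.neg ℤ :=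
      funext fun n => by simp [sub_eq_add_neg]
    rw [e]
    exact this

/-- The function `sech² + csch²`. -/
noncomputable def sechSqAddCschSq (x : ℝ) : ℝ := 1 / cosh x ^ 2 + 1 / sinh x ^ 2

theorem sechSqAddCschSq_neg (x : ℝ) : sechSqAddCschSq (-x) = sechSqAddCschSq x := by
  simp [sechSqAddCschSq]

theorem sechSqAddCschSq_nonneg (x : ℝ) : 0 ≤ sechSqAddCschSq x := by
  unfold sechSqAddCschSq
  positivity

/-- On the lines of real part `1/2` and `0`, `sin²` becomes `cosh²` and `-sinh²`. A row of the
difference of two `℘`-series therefore sums to a positive real number. -/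
theorem hasSum_half_add_sub {x : ℝ} (hx : x ≠ 0) :
    HasSum (fun n : ℤ => 1 / (1 / 2 + x * Complex.I - n) ^ 2 - 1 / (x * Complex.I - n) ^ 2)
      ((π ^ 2 * sechSqAddCschSq (π * x) : ℝ) : ℂ) := by
  have h1 := hasSum_one_div_sub_int_sq (z := 1 / 2 + x * Complex.I) (by simpa using hx)
  have h2 := hasSum_one_div_sub_int_sq (z := x * Complex.I) (by simpa using hx)
  have e1 : Complex.sin (π * (1 / 2 + x * Complex.I)) = (cosh (π * x) : ℝ) := by
    rw [show (π * (1 / 2 + x * Complex.I) : ℂ) = (π * x : ℝ) * Complex.I + π / 2 by push_cast; ring,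
      Complex.sin_add_pi_div_two, Complex.cos_mul_I, Complex.ofReal_cosh]
  have e2 : Complex.sin (π * (x * Complex.I)) ^ 2 = -((sinh (π * x) ^ 2 : ℝ) : ℂ) := by
    rw [show (π * (x * Complex.I) : ℂ) = (π * x : ℝ) * Complex.I by push_cast; ring,
      Complex.sin_mul_I, mul_pow, Complex.I_sq, ← Complex.ofReal_sinh]
    push_cast
    ring
  have e3 : ((π ^ 2 * sechSqAddCschSq (π * x) : ℝ) : ℂ) =
      π ^ 2 / Complex.sin (π * (1 / 2 + x * Complex.I)) ^ 2 -
        π ^ 2 / Complex.sin (π * (x * Complex.I)) ^ 2 := by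
    rw [e1, e2, sechSqAddCschSq]
    push_cast
    ring
  rw [e3]
  exact h1.sub h2

theorem sechSqAddCschSq_le {x : ℝ} (hx : x ≠ 0) : sechSqAddCschSq x ≤ 2 / x ^ 2 := by
  have h1 : x ^ 2 ≤ sinh x ^ 2 := by
    rw [sq_le_sq, abs_sinh]
    exact self_le_sinh_iff.2 (abs_nonneg x)
  have h2 : x ^ 2 ≤ cosh x ^ 2 := h1.trans (by rw [cosh_sq]; linarith)
  have h0 : 0 < x ^ 2 := by positivity
  have := add_le_add (one_div_le_one_div_of_le h0 h2) (one_div_le_one_div_of_le h0 h1)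
  refine this.trans_eq ?_
  ring

theorem half_sub_int_ne_zero (n : ℤ) : (1 / 2 - n : ℝ) ≠ 0 := by
  intro h
  have h2 : (1 : ℝ) = 2 * n := by linarith
  have h3 : (1 : ℤ) = 2 * n := by exact_mod_cast h2
  omega

/-- The difference `e₂ - e₃` of values of `℘` at half-periods of the lattice `ℤ + ℤit`. -/
noncomputable def halfPeriodGap (t : ℝ) : ℝ :=
  ∑' n : ℤ, π ^ 2 * sechSqAddCschSq (π * ((1 / 2 - n) * t))

theorem term_le {t : ℝ} (ht : 0 < t) (n : ℤ) :
    π ^ 2 * sechSqAddCschSq (π * ((1 / 2 - n) * t)) ≤ 2 / t ^ 2 * (1 / (1 / 2 - n : ℝ) ^ 2) := by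
  have hn := half_sub_int_ne_zero n
  have h := sechSqAddCschSq_le (x := π * ((1 / 2 - n) * t)) (by positivity)
  refine (mul_le_mul_of_nonneg_left h (sq_nonneg π)).trans_eq ?_
  field_simp

theorem summable_one_div_half_sub_int_sq : Summable fun n : ℤ => 1 / (1 / 2 - n : ℝ) ^ 2 := by
  refine ((summable_one_div_int_add_rpow (-(1 / 2)) 2).2 one_lt_two).congr fun n => ?_
  rw [rpow_two, sq_abs]
  congr 1
  ring

theorem summable_term {t : ℝ} (ht : 0 < t) :
    Summable fun n : ℤ => π ^ 2 * sechSqAddCschSq (π * ((1 / 2 - n) * t)) :=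
  (summable_one_div_half_sub_int_sq.mul_left (2 / t ^ 2)).of_nonneg_of_le
    (fun _ => mul_nonneg (sq_nonneg π) (sechSqAddCschSq_nonneg _)) (term_le ht)

theorem continuousOn_halfPeriodGap : ContinuousOn halfPeriodGap (Ioi 0) := by
  intro t ht
  have ht' : (0 : ℝ) < t := ht
  have h2 : (0 : ℝ) < t / 2 := by positivity
  have : ContinuousOn halfPeriodGap (Ioi (t / 2)) := by
    refine continuousOn_tsum (fun n x hx => ?_)
      (summable_one_div_half_sub_int_sq.mul_left (2 / (t / 2) ^ 2)) fun n x hx => ?_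
    · have hx0 : 0 < x := h2.trans hx
      have hn := half_sub_int_ne_zero n
      have hs : sinh (π * ((1 / 2 - n) * x)) ≠ 0 := by
        rw [Ne, sinh_eq_zero]
        positivity
      have hc := (cosh_pos (π * ((1 / 2 - n) * x))).ne'
      unfold sechSqAddCschSq
      refine ContinuousAt.continuousWithinAt ?_
      fun_prop (disch := positivity)
    · have hx0 : 0 < x := h2.trans hx
      rw [norm_of_nonneg (mul_nonneg (sq_nonneg π) (sechSqAddCschSq_nonneg _))]
      refine (term_le hx0 n).trans ?_
      gcongr
      exact le_of_lt hx
  exact (this.continuousAt (Ioi_mem_nhds (by linarith))).continuousWithinAt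

theorem le_halfPeriodGap {t : ℝ} (ht : 0 < t) :
    π ^ 2 * (sinh (π * (1 / 2 * t)) ^ 2)⁻¹ ≤ halfPeriodGap t := by
  refine le_trans ?_ ((summable_term ht).le_tsum 0 fun n _ =>
    mul_nonneg (sq_nonneg π) (sechSqAddCschSq_nonneg _))
  rw [Int.cast_zero, sub_zero, sechSqAddCschSq, one_div (sinh _ ^ 2)]
  have : 0 ≤ 1 / cosh (π * (1 / 2 * t)) ^ 2 := by positivity
  exact mul_le_mul_of_nonneg_left (by linarith) (sq_nonneg π)

theorem halfPeriodGap_pos {t : ℝ} (ht : 0 < t) : 0 < halfPeriodGap t := by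
  refine lt_of_lt_of_le ?_ (le_halfPeriodGap ht)
  have : 0 < sinh (π * (1 / 2 * t)) := sinh_pos_iff.2 (by positivity)
  positivity

theorem exists_halfPeriodGap_le : ∃ C : ℝ, 0 < C ∧ ∀ t, 0 < t → halfPeriodGap t ≤ C / t ^ 2 := by
  refine ⟨2 * ∑' n : ℤ, 1 / (1 / 2 - n : ℝ) ^ 2, ?_, fun t ht => ?_⟩
  · have := summable_one_div_half_sub_int_sq.le_tsum 0 fun n _ => by positivity
    have h4 : (0 : ℝ) < 1 / (1 / 2 - (0 : ℤ)) ^ 2 := by norm_num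
    linarith
  · refine ((summable_term ht).tsum_le_tsum (term_le ht)
      (summable_one_div_half_sub_int_sq.mul_left _)).trans_eq ?_
    rw [tsum_mul_left]
    ring

theorem tendsto_halfPeriodGap : Tendsto halfPeriodGap (𝓝[>] 0) atTop := by
  refine tendsto_atTop_mono' _ (f₁ := fun t => π ^ 2 * (sinh (π * (1 / 2 * t)) ^ 2)⁻¹) ?_ ?_
  · filter_upwards [self_mem_nhdsWithin] with t ht using le_halfPeriodGap ht
  · refine Tendsto.const_mul_atTop (by positivity) (Tendsto.inv_tendsto_nhdsGT_zero ?_)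
    refine tendsto_nhdsWithin_iff.2 ⟨?_, ?_⟩
    · have : ContinuousAt (fun t : ℝ => sinh (π * (1 / 2 * t)) ^ 2) 0 := by fun_prop
      simpa [ContinuousAt] using this.tendsto.mono_left nhdsWithin_le_nhds
    · filter_upwards [self_mem_nhdsWithin] with t ht
      have ht' : (0 : ℝ) < t := ht
      have : 0 < sinh (π * (1 / 2 * t)) := sinh_pos_iff.2 (by positivity)
      exact pow_pos this 2

/-- The ratio `(e₁ - e₂) / (e₂ - e₃)` for the lattices `ℤ + ℤit` takes every positive value. -/
theorem exists_halfPeriodGap_ratio_eq {ρ : ℝ} (hρ : 0 < ρ) :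
    ∃ t : ℝ, 0 < t ∧ (t ^ 2)⁻¹ * halfPeriodGap t⁻¹ / halfPeriodGap t = ρ := by
  set r : ℝ → ℝ := fun t => (t ^ 2)⁻¹ * halfPeriodGap t⁻¹ / halfPeriodGap t with hr
  obtain ⟨C, hC, hle⟩ := exists_halfPeriodGap_le
  -- The ratio `r` is unbounded as `t → ∞`, and `r(1/t) = 1/r(t)`. Hence for small `x` it takes
  -- values on both sides of `ρ` at the ends of `[x, 1/x]`.
  have hlow : ∀ t, 0 < t → halfPeriodGap t⁻¹ / C ≤ r t := by
    intro t ht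
    have h1 := hle t ht
    have h2 := halfPeriodGap_pos ht
    have h3 := (halfPeriodGap_pos (inv_pos.2 ht)).le
    rw [hr]
    beta_reduce
    rw [div_le_div_iff₀ hC h2]
    calc halfPeriodGap t⁻¹ * halfPeriodGap t ≤ halfPeriodGap t⁻¹ * (C / t ^ 2) :=
          mul_le_mul_of_nonneg_left h1 h3
      _ = _ := by ring
  have hinv : ∀ t, 0 < t → r t⁻¹ = (r t)⁻¹ := by
    intro t ht
    have h2 := (halfPeriodGap_pos ht).ne'
    have h3 := (halfPeriodGap_pos (inv_pos.2 ht)).ne'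
    simp only [hr, inv_inv]
    field_simp
  obtain ⟨x, hx, hx0, hx1⟩ := ((tendsto_halfPeriodGap.eventually_ge_atTop (C * max ρ ρ⁻¹)).and
    (Ioo_mem_nhdsGT (zero_lt_one (α := ℝ)))).exists
  have hx' : 0 < x⁻¹ := inv_pos.2 hx0
  have hmax : max ρ ρ⁻¹ ≤ r x⁻¹ := by
    refine le_trans ?_ (hlow x⁻¹ hx')
    rw [inv_inv, le_div_iff₀ hC, mul_comm]
    exact hx
  have hcont : ContinuousOn r (Icc x x⁻¹) := by
    have hsub : Icc x x⁻¹ ⊆ Ioi 0 := fun y hy => hx0.trans_le hy.1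
    have hg := continuousOn_halfPeriodGap.mono hsub
    have hi : ContinuousOn (fun t : ℝ => halfPeriodGap t⁻¹) (Icc x x⁻¹) :=
      continuousOn_halfPeriodGap.comp (continuousOn_id.inv₀ fun y hy => (hsub hy).ne')
        fun y hy => mem_Ioi.2 (inv_pos.2 (mem_Ioi.1 (hsub hy)))
    exact ((((continuousOn_id.pow 2).inv₀ fun y hy => pow_ne_zero 2 (hsub hy).ne').mul hi).div hg
      fun y hy => (halfPeriodGap_pos (hsub hy)).ne')
  have hlt : x ≤ x⁻¹ := hx1.le.trans (one_le_inv₀ hx0 |>.2 hx1.le)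
  have hρr : ρ ∈ Icc (r x) (r x⁻¹) := by
    refine ⟨?_, (le_max_left _ _).trans hmax⟩
    have h1 := hinv x hx0
    have h2 : ρ⁻¹ ≤ (r x)⁻¹ := h1 ▸ (le_max_right _ _).trans hmax
    have h3 : 0 < r x := inv_pos.1 ((inv_pos.2 hρ).trans_le h2)
    exact (inv_le_inv₀ hρ h3).1 h2
  obtain ⟨t, ht, hrt⟩ := intermediate_value_Icc hlt hcont hρr
  exact ⟨t, hx0.trans_le ht.1, hrt⟩

end HyperbolicSeries

/-! ### Elliptic functions of rectangular lattices -/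

section WeierstrassP

open Set Filter Topology Real

namespace PeriodPair

variable (L : PeriodPair)

theorem exists_weierstrassP_pole {l : ℂ} (hl : l ∈ L.lattice) : ∃ φ : ℂ → ℂ, AnalyticAt ℂ φ l ∧
    φ l = 1 ∧ ∀ᶠ z in 𝓝[≠] l, z ∉ L.lattice ∧ L.weierstrassP z = φ z / (z - l) ^ 2 := by
  refine ⟨fun z => (z - l) ^ 2 * L.weierstrassPExcept l z + 1 - (z - l) ^ 2 / l ^ 2, ?_, by simp,
    ?_⟩
  · have h1 := L.analyticAt_weierstrassPExcept l
    have h2 : AnalyticAt ℂ (fun z : ℂ => (z - l) ^ 2) l := by fun_prop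
    exact ((h2.mul h1).add analyticAt_const).sub (h2.div_const)
  · filter_upwards [self_mem_nhdsWithin,
      nhdsWithin_le_nhds (L.compl_lattice_sdiff_singleton_mem_nhds l)] with z hz hz'
    refine ⟨fun h => hz' ⟨h, hz⟩, ?_⟩
    rw [← L.ite_eq_one_sub_sq_mul_weierstrassP l hl, if_neg (show z ≠ l from hz),
      mul_div_cancel_left₀ _ (pow_ne_zero 2 (sub_ne_zero.2 hz))]

/-- If `℘` omitted `a`, then `1/(℘ - a)`, extended by zero on the lattice, would be entire and
doubly periodic, hence constant by Liouville; but it is nonzero at `ω₁/2`. -/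
theorem exists_weierstrassP_eq (a : ℂ) : ∃ z ∉ L.lattice, L.weierstrassP z = a := by
  classical
  by_contra! hne
  let g : ℂ → ℂ := fun z => if z ∈ L.lattice then 0 else (L.weierstrassP z - a)⁻¹
  have hg : Differentiable ℂ g := by
    intro z
    refine AnalyticAt.differentiableAt ?_
    by_cases hz : z ∈ L.lattice
    · obtain ⟨φ, hφ, hφz, hev⟩ := L.exists_weierstrassP_pole hz
      have hδ : AnalyticAt ℂ (fun w : ℂ => (w - z) ^ 2) z := by fun_prop
      have hden : AnalyticAt ℂ (fun w => φ w - a * (w - z) ^ 2) z :=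
        hφ.sub (analyticAt_const.mul hδ)
      refine (hδ.mul (hden.inv (by simp [hφz]))).congr ?_
      filter_upwards [eventually_nhdsWithin_iff.1 hev] with w hw
      rcases eq_or_ne w z with rfl | hwz
      · simp [g, hz]
      · obtain ⟨h1, h2⟩ := hw hwz
        have h3 : w - z ≠ 0 := sub_ne_zero.2 hwz
        simp only [g, if_neg h1, Pi.mul_apply, Pi.inv_apply, h2]
        rw [← inv_inv ((w - z) ^ 2), ← mul_inv]
        congr 1
        field_simp
    · refine (((L.analyticOnNhd_weierstrassP z hz).sub analyticAt_const).inv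
        (sub_ne_zero.2 (hne z hz))).congr ?_
      filter_upwards [L.isClosed_lattice.isOpen_compl.mem_nhds hz] with w hw
      exact (if_neg hw).symm
  have hper : ∀ z w, w ∈ L.lattice → g (z + w) = g z := by
    intro z w hw
    have h1 : z + w ∈ L.lattice ↔ z ∈ L.lattice := L.lattice.add_mem_iff_left hw
    simp only [g, h1, L.weierstrassP_add_coe z ⟨w, hw⟩]
  have h := hg.apply_eq_apply_of_bounded
    (IsZLattice.isCompact_range_of_periodic L.lattice g hg.continuous hper).isBounded
    (L.ω₁ / 2) 0
  simp only [g, if_neg L.ω₁_div_two_notMem_lattice, if_pos (zero_mem L.lattice)] at h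
  exact inv_ne_zero (sub_ne_zero.2 (hne _ L.ω₁_div_two_notMem_lattice)) h

theorem derivWeierstrassP_eq_zero {w : ℂ} (hw : 2 * w ∈ L.lattice) : L.derivWeierstrassP w = 0 := by
  have h1 := L.derivWeierstrassP_add_coe (-w) ⟨2 * w, hw⟩
  rw [show -w + ((⟨2 * w, hw⟩ : L.lattice) : ℂ) = w by simp; ring, L.derivWeierstrassP_neg] at h1
  linear_combination h1 / 2

/-- The values of `℘` at the three half-periods are roots of `4x³ - g₂x - g₃`. Being distinct, they
determine the factorization. -/
theorem derivWeierstrassP_sq_eq_prod {w₁ w₂ w₃ : ℂ} (h₁ : 2 * w₁ ∈ L.lattice)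
    (h₂ : 2 * w₂ ∈ L.lattice) (h₃ : 2 * w₃ ∈ L.lattice) (h₁' : w₁ ∉ L.lattice)
    (h₂' : w₂ ∉ L.lattice) (h₃' : w₃ ∉ L.lattice) (h₁₂ : L.weierstrassP w₁ ≠ L.weierstrassP w₂)
    (h₂₃ : L.weierstrassP w₂ ≠ L.weierstrassP w₃) (h₁₃ : L.weierstrassP w₁ ≠ L.weierstrassP w₃)
    {z : ℂ} (hz : z ∉ L.lattice) : L.derivWeierstrassP z ^ 2 = 4 *
      (L.weierstrassP z - L.weierstrassP w₁) * (L.weierstrassP z - L.weierstrassP w₂) *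
        (L.weierstrassP z - L.weierstrassP w₃) := by
  have r₁ := L.derivWeierstrassP_sq w₁ h₁'
  have r₂ := L.derivWeierstrassP_sq w₂ h₂'
  have r₃ := L.derivWeierstrassP_sq w₃ h₃'
  rw [L.derivWeierstrassP_eq_zero h₁] at r₁
  rw [L.derivWeierstrassP_eq_zero h₂] at r₂
  rw [L.derivWeierstrassP_eq_zero h₃] at r₃
  rw [L.derivWeierstrassP_sq z hz]
  generalize L.weierstrassP z = x
  generalize L.weierstrassP w₁ = e₁ at *
  generalize L.weierstrassP w₂ = e₂ at *
  generalize L.weierstrassP w₃ = e₃ at *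
  have s₁₂ : 4 * (e₁ ^ 2 + e₁ * e₂ + e₂ ^ 2) = L.g₂ :=
    mul_left_cancel₀ (sub_ne_zero.2 h₁₂) (by linear_combination r₂ - r₁)
  have s₂₃ : 4 * (e₂ ^ 2 + e₂ * e₃ + e₃ ^ 2) = L.g₂ :=
    mul_left_cancel₀ (sub_ne_zero.2 h₂₃) (by linear_combination r₃ - r₂)
  have s : e₁ + e₂ + e₃ = 0 :=
    mul_left_cancel₀ (sub_ne_zero.2 h₁₃) (by linear_combination (s₁₂ - s₂₃) / 4)
  have hg₃ : L.g₃ = 4 * e₁ ^ 3 - L.g₂ * e₁ := by linear_combination r₁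
  have he₃ : e₃ = -e₁ - e₂ := by linear_combination s
  rw [hg₃, ← s₁₂, he₃]
  ring

end PeriodPair

/-- Differentiating the first-order equation gives the claim multiplied by `2f'`. Division is
legitimate near `z₀`, and the identity theorem carries the result across the zeros of `f'`. -/
theorem deriv_deriv_eq_of_deriv_sq_eq {f : ℂ → ℂ} {U : Set ℂ} (hU : IsOpen U)
    (hU' : IsPreconnected U) (hf : AnalyticOnNhd ℂ f U) {b₂ b₄ b₆ : ℂ}
    (hode : ∀ z ∈ U, deriv f z ^ 2 = 4 * f z ^ 3 + b₂ * f z ^ 2 + 2 * b₄ * f z + b₆) {z₀ : ℂ}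
    (hz₀ : z₀ ∈ U) (hne : deriv f z₀ ≠ 0) :
    ∀ z ∈ U, deriv (deriv f) z = 6 * f z ^ 2 + b₂ * f z + b₄ := by
  have hE : AnalyticOnNhd ℂ
      (fun z => deriv (deriv f) z - (6 * f z ^ 2 + b₂ * f z + b₄)) U := fun z hz => by
    have h1 := hf z hz
    have h2 := h1.deriv.deriv
    fun_prop
  have hev : (fun z => deriv (deriv f) z - (6 * f z ^ 2 + b₂ * f z + b₄)) =ᶠ[𝓝 z₀] 0 := by
    filter_upwards [(hf z₀ hz₀).deriv.continuousAt.eventually_ne hne, hU.mem_nhds hz₀] with z h1 hz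
    have d1 := (hf z hz).differentiableAt.hasDerivAt
    have d2 := (hf z hz).deriv.differentiableAt.hasDerivAt
    have heq : (fun z => deriv f z ^ 2) =ᶠ[𝓝 z]
        fun z => 4 * f z ^ 3 + b₂ * f z ^ 2 + 2 * b₄ * f z + b₆ := by
      filter_upwards [hU.mem_nhds hz] with w hw using hode w hw
    have e := heq.deriv_eq
    have d3 := (((((d1.fun_pow 3).const_mul 4).add ((d1.fun_pow 2).const_mul b₂)).add
      (d1.const_mul (2 * b₄))).add_const b₆).deriv
    replace e := ((d2.fun_pow 2).deriv.symm.trans e).trans d3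
    push_cast at e
    refine mul_left_cancel₀ (mul_ne_zero two_ne_zero h1) ?_
    rw [Pi.zero_apply]
    linear_combination e
  intro z hz
  exact sub_eq_zero.1 (hE.eqOn_zero_of_preconnected_of_eventuallyEq_zero hU' hz₀ hev hz)

theorem HasSum.congr_apply {α β : Type*} [AddCommMonoid α] [TopologicalSpace α] {f g : β → α}
    {a : α} (h : HasSum f a) (hfg : ∀ x, f x = g x) : HasSum g a :=
  funext hfg ▸ h

/-- The lattice `ℤ + ℤit`. -/
noncomputable def rectangularPeriodPair (t : ℝ) (ht : t ≠ 0) : PeriodPair where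
  ω₁ := 1
  ω₂ := t * Complex.I
  indep := by
    rw [LinearIndependent.pair_iff]
    intro a b h
    have h1 := congrArg Complex.re h
    have h2 := congrArg Complex.im h
    simp at h1 h2
    exact ⟨h1, h2.resolve_right ht⟩

theorem mem_rectangularPeriodPair_lattice {t : ℝ} (ht : t ≠ 0) {z : ℂ} :
    z ∈ (rectangularPeriodPair t ht).lattice ↔ ∃ m n : ℤ, m + n * (t * Complex.I) = z := by
  simp [PeriodPair.mem_lattice, rectangularPeriodPair]

theorem PeriodPair.hasSum_weierstrassP_sub (L : PeriodPair) (a b : ℂ) :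
    HasSum (fun x : ℤ × ℤ => 1 / (a - (x.1 * L.ω₁ + x.2 * L.ω₂)) ^ 2 -
      1 / (b - (x.1 * L.ω₁ + x.2 * L.ω₂)) ^ 2) (L.weierstrassP a - L.weierstrassP b) := by
  have h := (L.hasSum_weierstrassP a).sub (L.hasSum_weierstrassP b)
  simp only [sub_sub_sub_cancel_right] at h
  have h' := L.latticeEquivProd.symm.toEquiv.hasSum_iff.2 h
  refine HasSum.congr_apply h' fun x => ?_
  have hx : ((L.latticeEquivProd.symm.toEquiv x : L.lattice) : ℂ) = x.1 * L.ω₁ + x.2 * L.ω₂ :=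
    L.latticeEquiv_symm_apply x
  simp only [Function.comp_apply, hx]

/-- The lattice sum is taken along horizontal rows first, each of which is evaluated by
`hasSum_half_add_sub`. -/
theorem rectangular_weierstrassP_gap {t : ℝ} (ht : 0 < t) :
    (rectangularPeriodPair t ht.ne').weierstrassP (1 / 2 + t * Complex.I / 2) -
      (rectangularPeriodPair t ht.ne').weierstrassP (t * Complex.I / 2) = halfPeriodGap t := by
  have h := (rectangularPeriodPair t ht.ne').hasSum_weierstrassP_sub
    (1 / 2 + t * Complex.I / 2) (t * Complex.I / 2)
  have hfib := ((Equiv.prodComm ℤ ℤ).hasSum_iff.2 h).prod_fiberwise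
    (g := fun n : ℤ => ((π ^ 2 * sechSqAddCschSq (π * ((1 / 2 - n) * t)) : ℝ) : ℂ)) fun n => by
      have := hasSum_half_add_sub (mul_ne_zero (half_sub_int_ne_zero n) ht.ne')
      refine HasSum.congr_apply this fun m => ?_
      simp only [Function.comp_apply, Equiv.prodComm_apply, Prod.fst_swap, Prod.snd_swap,
        rectangularPeriodPair]
      push_cast
      congr 3 <;> ring
  exact hfib.unique (Complex.hasSum_ofReal.2 (summable_term ht).hasSum)

/-- The sum is taken along vertical columns first. Factoring `it` out of each denominator turns a
column into a row for the parameter `1/t`, with the factor `-1/t²`. -/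
theorem rectangular_weierstrassP_gap' {t : ℝ} (ht : 0 < t) :
    (rectangularPeriodPair t ht.ne').weierstrassP (1 / 2) -
      (rectangularPeriodPair t ht.ne').weierstrassP (1 / 2 + t * Complex.I / 2) =
        ((t ^ 2)⁻¹ * halfPeriodGap t⁻¹ : ℝ) := by
  have h := (rectangularPeriodPair t ht.ne').hasSum_weierstrassP_sub
    (1 / 2) (1 / 2 + t * Complex.I / 2)
  have hfib := h.prod_fiberwise
    (g := fun m : ℤ => (((t ^ 2)⁻¹ * (π ^ 2 * sechSqAddCschSq (π * ((1 / 2 - m) * t⁻¹))) : ℝ) : ℂ))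
    fun m => by
      have := (hasSum_half_add_sub (neg_ne_zero.2
        (mul_ne_zero (half_sub_int_ne_zero m) (inv_ne_zero ht.ne')))).mul_left ((t ^ 2)⁻¹ : ℂ)
      rw [mul_neg, sechSqAddCschSq_neg, ← Complex.ofReal_pow, ← Complex.ofReal_inv,
        ← Complex.ofReal_mul] at this
      refine HasSum.congr_apply this fun n => ?_
      have ht' : (t : ℂ) ≠ 0 := Complex.ofReal_ne_zero.2 ht.ne'
      have e : ∀ w v : ℂ, v = t * Complex.I * w →
          1 / v ^ 2 = -((t : ℂ) ^ 2)⁻¹ * (1 / w ^ 2) := fun w v hv => by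
        rw [hv, mul_pow, mul_pow, Complex.I_sq, one_div, one_div, mul_inv, mul_neg_one, inv_neg]
      simp only [rectangularPeriodPair]
      rw [e ((-((1 / 2 - m) * t⁻¹) : ℝ) * Complex.I - n) (1 / 2 - (m * 1 + n * (t * Complex.I))),
        e (1 / 2 + (-((1 / 2 - m) * t⁻¹) : ℝ) * Complex.I - n)
          (1 / 2 + t * Complex.I / 2 - (m * 1 + n * (t * Complex.I)))]
      · push_cast
        ring
      · push_cast
        field_simp
        linear_combination (-(2 * m - 1) : ℂ) * Complex.I_sq
      · push_cast
        field_simp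
        linear_combination (-(2 * m - 1) : ℂ) * Complex.I_sq
  exact hfib.unique
    (Complex.hasSum_ofReal.2 ((summable_term (inv_pos.2 ht)).hasSum.mul_left _))

/-- Placing the root `e₂` at the origin leaves the roots `s²(e₁-e₂)` and `s²(e₃-e₂)`. The hypotheses
on their product and sum identify the cubic with `x(4x²+ux-4)`. -/
theorem isUniformization_weierstrassP (L : PeriodPair) {s : ℝ} (hs : 0 < s) {e₁ e₂ e₃ : ℂ}
    (hode : ∀ z ∉ L.lattice, L.derivWeierstrassP z ^ 2 = 4 * (L.weierstrassP z - e₁) *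
      (L.weierstrassP z - e₂) * (L.weierstrassP z - e₃)) {u : ℤ}
    (hprod : (s : ℂ) ^ 4 * ((e₁ - e₂) * (e₃ - e₂)) = -1)
    (hsum : (s : ℂ) ^ 2 * (4 * ((e₁ - e₂) + (e₃ - e₂))) = -u) :
    IsUniformization ((curveE₁ u).baseChange ℂ) (fun z => s ^ 2 * (L.weierstrassP (s * z) - e₂))
      {z | s * z ∈ L.lattice} := by
  obtain ⟨b2, b4, b6⟩ := curveE₁_baseChange_b u
  have hs' : (s : ℂ) ≠ 0 := Complex.ofReal_ne_zero.2 hs.ne'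
  have hlin : ∀ z : ℂ, HasDerivAt (fun z : ℂ => s * z) s z := fun z => by
    simpa using (hasDerivAt_id z).const_mul (s : ℂ)
  have hclosed : IsClosed {z : ℂ | s * z ∈ L.lattice} :=
    L.isClosed_lattice.preimage (continuous_const_mul (s : ℂ))
  have hcount : {z : ℂ | s * z ∈ L.lattice}.Countable :=
    Countable.preimage_of_injOn (countable_coe_iff.1 (countable_of_Lindelof_of_discrete
      (X := L.lattice))) (mul_right_injective₀ hs').injOn
  have han : ∀ z : ℂ, s * z ∉ L.lattice →
      AnalyticAt ℂ (fun z => s ^ 2 * (L.weierstrassP (s * z) - e₂)) z := fun z hz =>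
    analyticAt_const.mul (((L.analyticOnNhd_weierstrassP _ hz).comp
      (analyticAt_const.mul analyticAt_id)).sub analyticAt_const)
  have hderiv : ∀ z : ℂ, s * z ∉ L.lattice →
      deriv (fun z => s ^ 2 * (L.weierstrassP (s * z) - e₂)) z =
        s ^ 3 * L.derivWeierstrassP (s * z) := fun z hz => by
    have h1 := (L.analyticOnNhd_weierstrassP _ hz).differentiableAt.hasDerivAt
    rw [L.deriv_weierstrassP] at h1
    refine ((((h1.comp z (hlin z)).sub_const e₂).const_mul ((s : ℂ) ^ 2)).congr_deriv ?_).deriv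
    ring
  have hsq : ∀ z : ℂ, s * z ∉ L.lattice →
      deriv (fun z => s ^ 2 * (L.weierstrassP (s * z) - e₂)) z ^ 2 =
        4 * (s ^ 2 * (L.weierstrassP (s * z) - e₂)) ^ 3 +
        u * (s ^ 2 * (L.weierstrassP (s * z) - e₂)) ^ 2 +
        2 * (-2) * (s ^ 2 * (L.weierstrassP (s * z) - e₂)) + 0 := fun z hz => by
    rw [hderiv z hz, mul_pow, hode _ hz]
    generalize L.weierstrassP (s * z) = x
    linear_combination 4 * s ^ 2 * (x - e₂) * hprod - s ^ 4 * (x - e₂) ^ 2 * hsum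
  have hsurj : ∀ a : ℂ, ∃ z : ℂ, s * z ∉ L.lattice ∧
      s ^ 2 * (L.weierstrassP (s * z) - e₂) = a := fun a => by
    obtain ⟨z, hz, hza⟩ := L.exists_weierstrassP_eq (a / s ^ 2 + e₂)
    refine ⟨z / s, by rwa [mul_div_cancel₀ _ hs'], ?_⟩
    rw [mul_div_cancel₀ _ hs', hza]
    field_simp
    ring
  refine ⟨hclosed, by simp, han, by rwa [b2, b4, b6], ?_, ?_, ?_, ?_, hsurj⟩
  -- Where `f = i` one has `f'² = -u - 8i`, which is not zero.
  · obtain ⟨z₀, hz₀, hz₀I⟩ := hsurj Complex.I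
    have hne : deriv (fun z => s ^ 2 * (L.weierstrassP (s * z) - e₂)) z₀ ≠ 0 := by
      intro h0
      have h1 := hsq z₀ hz₀
      rw [h0, hz₀I] at h1
      have h2 := congrArg Complex.im h1
      simp [pow_succ] at h2
      norm_num at h2
    rw [b2, b4]
    exact deriv_deriv_eq_of_deriv_sq_eq hclosed.isOpen_compl
      (hcount.isConnected_compl_of_one_lt_rank (by simp)).isPreconnected han hsq hz₀ hne
  · intro p hp
    obtain ⟨φ, hφ, hφp, hev⟩ := L.exists_weierstrassP_pole hp
    have hφs : AnalyticAt ℂ (fun z : ℂ => φ (s * z)) p :=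
      AnalyticAt.fun_comp hφ (analyticAt_const.mul analyticAt_id)
    refine ⟨fun z => φ (s * z) - s ^ 2 * e₂ * (z - p) ^ 2, hφs.sub (by fun_prop), by simp [hφp], ?_⟩
    have htend : Tendsto (fun z : ℂ => s * z) (𝓝[≠] p) (𝓝[≠] (s * p)) := by
      refine tendsto_nhdsWithin_iff.2 ⟨((hlin p).continuousAt.tendsto).mono_left nhdsWithin_le_nhds,
        ?_⟩
      filter_upwards [self_mem_nhdsWithin] with z hz h
      exact hz (mul_left_cancel₀ hs' h)
    filter_upwards [htend.eventually hev, self_mem_nhdsWithin] with z ⟨h1, h2⟩ h3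
    have h4 : z - p ≠ 0 := sub_ne_zero.2 h3
    refine ⟨h1, ?_⟩
    rw [h2, ← mul_sub]
    field_simp
  · intro z
    rw [mul_neg, L.weierstrassP_neg]
  · intro z hz
    rw [mem_ofPred_eq, mul_neg]
    exact neg_mem hz

/-- The roots of `4x²+ux-4` are `α > 0` and `-β < 0`. The parameter `t` is chosen so that `(e₁-e₂) :
(e₂-e₃) = α : β`, and the scale `s` so that the gaps become `α` and `β`. The real period is `1/s`.
The zero `w` of `f` comes from the half-period `(1+it)/2`, whose height differs from that of every
lattice point; this keeps the kernel of the isogeny from creating real periods. -/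
theorem exists_uniformization_curveE₁ (u : ℤ) : ∃ (ω : ℝ) (f : ℂ → ℂ) (P : Set ℂ) (w : ℂ),
    0 < ω ∧ IsUniformization ((curveE₁ u).baseChange ℂ) f P ∧ (∀ z, f (z + ω) = f z) ∧
    (∀ x : ℝ, (x : ℂ) ∈ P → ∃ n : ℤ, x = n * ω) ∧ w ∉ P ∧ f w = 0 ∧
    ∀ x : ℝ, (x : ℂ) - w ∉ P := by
  obtain ⟨α, β, hα, hβ, hαβ, hsum⟩ : ∃ α β : ℝ, 0 < α ∧ 0 < β ∧ α * β = 1 ∧ 4 * (α - β) = -u := by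
    have hD : √((u : ℝ) ^ 2 + 64) ^ 2 = (u : ℝ) ^ 2 + 64 := sq_sqrt (by positivity)
    have hlt : |(u : ℝ)| < √((u : ℝ) ^ 2 + 64) := by
      rw [lt_sqrt (abs_nonneg _), sq_abs]
      linarith
    obtain ⟨h1, h2⟩ := abs_lt.1 hlt
    refine ⟨(√((u : ℝ) ^ 2 + 64) - u) / 8, (√((u : ℝ) ^ 2 + 64) + u) / 8, by linarith, by linarith,
      by linear_combination hD / 64, by ring⟩
  obtain ⟨t, ht, hratio⟩ := exists_halfPeriodGap_ratio_eq (div_pos hα hβ)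
  have hgap := rectangular_weierstrassP_gap ht
  have hgap' := rectangular_weierstrassP_gap' ht
  have hB := halfPeriodGap_pos ht
  have hA : 0 < (t ^ 2)⁻¹ * halfPeriodGap t⁻¹ :=
    mul_pos (by positivity) (halfPeriodGap_pos (inv_pos.2 ht))
  generalize (t ^ 2)⁻¹ * halfPeriodGap t⁻¹ = A at *
  generalize halfPeriodGap t = B at *
  have hmem := @mem_rectangularPeriodPair_lattice t ht.ne'
  have hω₁ : (rectangularPeriodPair t ht.ne').ω₁ = 1 := rfl
  generalize rectangularPeriodPair t ht.ne' = L at *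
  have hs : 0 < √(α / A) := sqrt_pos.2 (div_pos hα hA)
  have hsA : √(α / A) ^ 2 * A = α := by
    rw [sq_sqrt (div_pos hα hA).le, div_mul_cancel₀ _ hA.ne']
  have hsB : √(α / A) ^ 2 * B = β := by
    rw [div_eq_div_iff hB.ne' hβ.ne'] at hratio
    refine mul_left_cancel₀ hA.ne' ?_
    linear_combination B * hsA - hratio
  generalize √(α / A) = s at *
  have hs' : (s : ℂ) ≠ 0 := Complex.ofReal_ne_zero.2 hs.ne'
  have hre : ∀ m n : ℤ, ((m + n * (t * Complex.I) : ℂ)).re = m := fun m n => by simp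
  have him : ∀ m n : ℤ, ((m + n * (t * Complex.I) : ℂ)).im = n * t := fun m n => by simp
  have hhalf : ∀ n : ℤ, (1 / 2 : ℝ) ≠ n := fun n h => by
    have := half_sub_int_ne_zero n
    exact this (sub_eq_zero.2 h)
  have h1 : (1 / 2 : ℂ) ∉ L.lattice := fun h => by
    obtain ⟨m, n, h⟩ := hmem.1 h
    have h2 := congrArg Complex.re h
    rw [hre] at h2
    exact hhalf m (by simpa using h2.symm)
  have him2 : ∀ x : ℂ, x.im = 0 → x + t * Complex.I / 2 ∉ L.lattice := fun x hx h => by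
    obtain ⟨m, n, h⟩ := hmem.1 h
    have h2 := congrArg Complex.im h
    rw [him] at h2
    have h3 : (n : ℝ) * t = 1 / 2 * t := by
      rw [h2]
      simp [hx]
      ring
    exact hhalf n (mul_right_cancel₀ ht.ne' h3).symm
  have h2 : (1 / 2 + t * Complex.I / 2 : ℂ) ∉ L.lattice := him2 _ (by simp)
  have h3 : (t * Complex.I / 2 : ℂ) ∉ L.lattice := by simpa using him2 0 (by simp)
  have hA' : (A : ℂ) ≠ 0 := Complex.ofReal_ne_zero.2 hA.ne'
  have hB' : (B : ℂ) ≠ 0 := Complex.ofReal_ne_zero.2 hB.ne'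
  have hAB' : (A + B : ℂ) ≠ 0 := by exact_mod_cast (add_pos hA hB).ne'
  have hode := fun z hz => L.derivWeierstrassP_sq_eq_prod (w₁ := 1 / 2)
    (w₂ := 1 / 2 + t * Complex.I / 2) (w₃ := t * Complex.I / 2) (z := z)
    (hmem.2 ⟨1, 0, by simp⟩) (hmem.2 ⟨1, 1, by push_cast; ring⟩) (hmem.2 ⟨0, 1, by push_cast; ring⟩)
    h1 h2 h3 (fun h => hA' (by rw [← hgap', h, sub_self])) (fun h => hB' (by rw [← hgap, h, sub_self]))
    (fun h => hAB' (by rw [← hgap, ← hgap', h]; ring)) hz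
  generalize L.weierstrassP (1 / 2) = e₁ at *
  generalize L.weierstrassP (t * Complex.I / 2) = e₃ at *
  have hsA' : (s : ℂ) ^ 2 * A = α := by exact_mod_cast hsA
  have hsB' : (s : ℂ) ^ 2 * B = β := by exact_mod_cast hsB
  have hαβ' : (α : ℂ) * β = 1 := by exact_mod_cast hαβ
  have hsum' : 4 * (α - β : ℂ) = -u := by exact_mod_cast hsum
  refine ⟨s⁻¹, _, _, (1 / 2 + t * Complex.I / 2) / s, inv_pos.2 hs,
    isUniformization_weierstrassP L hs hode (u := u) ?_ ?_, fun z => ?_, fun x hx => ?_, ?_, ?_,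
    fun x hx => ?_⟩
  · rw [hgap', ← neg_sub, hgap]
    linear_combination -(s : ℂ) ^ 2 * B * hsA' - α * hsB' - hαβ'
  · rw [hgap', ← neg_sub _ e₃, hgap]
    linear_combination 4 * hsA' - 4 * hsB' + hsum'
  · have h := L.weierstrassP_add_coe (s * z) ⟨L.ω₁, L.ω₁_mem_lattice⟩
    simp only [hω₁] at h
    rw [Complex.ofReal_inv, mul_add, mul_inv_cancel₀ hs', h]
  · obtain ⟨m, n, h⟩ := hmem.1 hx
    have h4 := congrArg Complex.re h
    rw [hre] at h4
    refine ⟨m, ?_⟩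
    rw [h4, ← Complex.ofReal_mul, Complex.ofReal_re]
    field_simp
  · rwa [mem_ofPred_eq, mul_div_cancel₀ _ hs']
  · rw [mul_div_cancel₀ _ hs', sub_self, mul_zero]
  · rw [mem_ofPred_eq, mul_sub, mul_div_cancel₀ _ hs', ← neg_mem_iff] at hx
    refine him2 (1 / 2 - s * x) ?_ ?_
    · rw [← Complex.ofReal_mul]
      simp
    · convert hx using 1
      ring

end WeierstrassP

/-! ### The least real period -/

section LeastPeriod

theorem exists_isLeast_positiveRealPeriods {u : ℤ} (hu : u ≡ 1 [ZMOD 4])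
    (hsq : Squarefree (u ^ 2 + 64)) : ∃ ω : ℝ, IsLeast (positiveRealPeriods (curveE₁ u)) ω ∧
      IsLeast (positiveRealPeriods (curveE₂ u)) ω := by
  obtain ⟨ω, f, P, w, hω, h, hper, hreal, hwP, hfw, hw⟩ := exists_uniformization_curveE₁ u
  rw [positiveRealPeriods_eq (curveE₁_Δ_ne_zero u) (curveE₁_isGlobalMinimal hu hsq),
    positiveRealPeriods_eq (curveE₂_Δ_ne_zero u) (curveE₂_isGlobalMinimal hu hsq)]
  have hle : ∀ T : ℝ, 0 < T → (T : ℂ) ∈ P → ω ≤ T := by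
    intro T hT hTP
    obtain ⟨n, rfl⟩ := hreal T hTP
    have hn : 0 < n := by
      by_contra! hn
      exact hT.not_ge (mul_nonpos_of_nonpos_of_nonneg (by exact_mod_cast hn) hω.le)
    exact le_mul_of_one_le_left hω.le (by exact_mod_cast hn)
  refine ⟨ω, ⟨⟨hω, h.isPeriod_of_periodic hper⟩, fun T hT => hle T hT.1 (h.mem_of_isPeriod hT.2)⟩,
    ⟨hω, h.sub_inv.isPeriod_of_periodic fun z => by simp only [hper]⟩, fun T hT => ?_⟩
  -- A real period of E₂ outside `P` would be a zero of `f`, hence differ from `w` by an element of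
  -- `P`, which no real number does.
  by_cases hTP : (T : ℂ) ∈ P
  · exact hle T hT.1 hTP
  · exact (hw T (h.sub_mem_of_apply_eq_zero hwP hfw hTP
      ((h.sub_inv.mem_of_isPeriod hT.2).resolve_left hTP))).elim

end LeastPeriod

theorem lemma1 (u : ℤ) (hu : u ≡ 1 [ZMOD 4]) (hsq : Squarefree (u ^ 2 + 64)) :
    (Nonempty (AddCommGroup.torsion (curveE₁ u).toAffine.Point ≃+ ZMod 2) ∧
      Nonempty (AddCommGroup.torsion (curveE₂ u).toAffine.Point ≃+ ZMod 2)) ∧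
    (IsLeast (positiveRealPeriods (curveE₁ u)) (leastRealPeriod (curveE₁ u)) ∧
      IsLeast (positiveRealPeriods (curveE₂ u)) (leastRealPeriod (curveE₂ u)) ∧
      leastRealPeriod (curveE₁ u) = leastRealPeriod (curveE₂ u) ∧
      archimedeanFactor (curveE₁ u) = 2 * leastRealPeriod (curveE₁ u) ∧
      archimedeanFactor (curveE₂ u) = leastRealPeriod (curveE₂ u)) ∧
    (tamagawaProduct (curveE₁ u) = 1 ∧
      ∀ (k : ℕ) (p : Fin k → ℕ), (∀ i, (p i).Prime) → u ^ 2 + 64 = ∏ i, (p i : ℤ) →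
        tamagawaProduct (curveE₂ u) = 2 ^ k) := by
  obtain ⟨ω, h₁, h₂⟩ := exists_isLeast_positiveRealPeriods hu hsq
  have hω₁ : leastRealPeriod (curveE₁ u) = ω := h₁.csInf_eq
  have hω₂ : leastRealPeriod (curveE₂ u) = ω := h₂.csInf_eq
  refine ⟨⟨curveE₁_torsion hu hsq, curveE₂_torsion hu hsq⟩,
    ⟨hω₁ ▸ h₁, hω₂ ▸ h₂, hω₁.trans hω₂.symm, if_neg not_isConnected_realLocus_curveE₁,
      if_pos isConnected_realLocus_curveE₂⟩, tamagawaProduct_curveE₁ hu hsq,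
    fun k p hp hprod => tamagawaProduct_curveE₂ hu hsq k p hp hprod⟩
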